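/- Let $M$ be a closed oriented smooth 3-manifold. A *flag structure* on $M$ is a pair of smooth complex line subbundles $T^1,T^2\subset TM\otimes\mathbb C$ with $T^1\cap T^2=0$ such that $T^1\oplus T^2$ is locally the kernel of a complex 1-form $\theta$ with $\theta\wedge d\theta$ nowhere zero. Let $Y\to M$ be its coframe bundle. A (global) section $s$ of $Y$ amounts to four smooth complex 1-forms $\theta,\theta^1,\theta^2,\varphi$ on $M$ (the pullbacks by $s$ of the tautological forms $\omega,\omega^1,\omega^2,\varphi$ of $Y$) with $\ker\theta=T^1\oplus T^2$; $\theta^1|_{T^2}=0$ and $\theta^1|_{T^1}\neq0$ at each point; $\theta^2|_{T^1}=0$ and $\theta^2|_{T^2}\ne0$ at each point; and $d\theta=\theta\wedge\varphi+\theta^1\wedge\theta^2$. For each section there are unique smooth 1-forms $\omega_1^1,\varphi^1,\varphi^2,\psi$ on $M$ (the pullbacks of the other components of the adapted connection) such that $$d\theta^1=\tfrac12\theta^1\wedge\varphi+\theta^1\wedge\omega_1^1+\theta\wedge\varphi^1,\qquad d\theta^2=\tfrac12\theta^2\wedge\varphi-\theta^2\wedge\omega_1^1+\theta\wedge\varphi^2,$$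 $$d\varphi=\theta^1\wedge\varphi^2-\theta^2\wedge\varphi^1+\theta\wedge\psi,\qquad d\omega_1^1=\tfrac32\theta^2\wedge\varphi^1+\tfrac32\theta^1\wedge\varphi^2,$$ and $d\varphi^1-\varphi^1\wedge\omega_1^1-\frac12\theta^1\wedge\psi-\frac12\varphi\wedge\varphi^1$ is a multiple of $\theta\wedge\theta^2$. The adapted connection $\pi$ and its curvature are given by $$s^*\pi=\begin{pmatrix}-\frac12\varphi-\frac13\omega_1^1&-\varphi^2&-\frac14\psi\\ \theta^1&\frac23\omega_1^1&\frac12\varphi^1\\ 2\theta&2\theta^2&\frac12\varphi-\frac13\omega_1^1\end{pmatrix},\qquad \Pi=d\pi+\pi\wedge\pi .$$ If $Y$ has a section, the number $$\mu=\frac1{24\pi^2}\int_M s^*\operatorname{tr}(\pi\wedge\pi\wedge\pi)$$ does not depend on the section $s$. **Proposition 6.3.** Let $F_t$, $t\in(-\varepsilon,\varepsilon)$, be a smooth path of flag structures on $M$ such that the coframe bundle of $F_0$ has a global section. Then for $t$ near $0$ the coframe bundles of the $F_t$ have sections $s_t$ depending smoothly on $t$. For every such family of sections the forms $s_t^*\pi_t$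 depend smoothly on $t$, the invariant $\mu(t)=\mu(F_t)$ is differentiable at $t=0$, and $\delta\mu=\frac{d}{dt}\mu(0)$ is $$\delta\mu=-\frac1{4\pi^2}\int_M s^*\operatorname{tr}(\dot\pi\wedge\Pi),$$ where $s=s_0$, $\Pi$ is the curvature of $F_0$ and $s^*\dot\pi=\frac{d}{dt}\big|_{t=0}s_t^*\pi_t$. Consequently $\delta\mu=0$ for every such deformation of a structure $F_0$ with zero curvature ($\Pi=0$). In particular this holds if $F_0$ is induced by a totally real immersion $f:M\to \mathbf{SL}(3,\mathbb C)/B$ into the flag space ($B$ the upper triangular subgroup), i.e. a smooth map whose complexified differential $T_pM\otimes\mathbb C\to T_{f(p)}(\mathbf{SL}(3,\mathbb C)/B)$ is an isomorphism at each $p$, where $T^1$ and $T^2$ are the preimages of the tangent lines of the fibres of the projections of a flag to its line and to its plane respectively; such an $F_0$ has zero curvature. -/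

import Mathlib

open Set Filter Topology MeasureTheory
open scoped Manifold ContDiff TensorProduct

noncomputable section

namespace FlagGeometry

/-- The model space of 3-manifolds. -/
abbrev E3 : Type := EuclideanSpace ℝ (Fin 3)

/-! ### Exterior algebra of a 3-dimensional real vector space, with complex values -/

/-- The wedge product of a complex valued 1-form with a complex valued `k`-form, with the convention
`(α ∧ β)(v₀, …, v_k) = ∑ i, (-1) ^ i α(v_i) β(v₀, …, v̂_i, …, v_k)`;
for two 1-forms this is `α(v₀) β(v₁) - α(v₁) β(v₀)`. -/
def covWedge {k : ℕ} (α : E3 [⋀^Fin 1]→L[ℝ] ℂ) (β : E3 [⋀^Fin k]→L[ℝ] ℂ) :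
    E3 [⋀^Fin (k + 1)]→L[ℝ] ℂ :=
  ContinuousAlternatingMap.alternatizeUncurryFin
    (((ContinuousAlternatingMap.ofSubsingleton ℝ E3 ℂ (0 : Fin 1)).symm α).smulRight β)

section Manifold

variable (M : Type*) [TopologicalSpace M] [ChartedSpace E3 M]

/-! ### Complex valued differential forms on a 3-manifold -/

/-- A (not necessarily smooth) complex valued differential `k`-form on `M`. -/
abbrev Form (k : ℕ) : Type _ :=
  (p : M) → (TangentSpace (𝓡 3) p) [⋀^Fin k]→L[ℝ] ℂ

/-- The complexified tangent space of `M` at `p`. -/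
abbrev CTangent {M : Type*} [TopologicalSpace M] [ChartedSpace E3 M] (p : M) : Type :=
  ℂ ⊗[ℝ] TangentSpace (𝓡 3) p

variable {M}

namespace Form

variable {k : ℕ}

/-- The coordinate expression of a form in the preferred chart at `x`: its pullback by the inverse
of the chart. It is meaningful on the target of the chart. -/
def rep (α : Form M k) (x : M) (y : E3) : E3 [⋀^Fin k]→L[ℝ] ℂ :=
  (α ((extChartAt (𝓡 3) x).symm y)).compContinuousLinearMap
    (mfderiv 𝓘(ℝ, E3) (𝓡 3) (extChartAt (𝓡 3) x).symm y)

/-- A family of forms `α t` depending on a real parameter is smooth on `W ⊆ ℝ × M`, jointly in the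
parameter and the point, if all its coordinate expressions are. -/
def SmoothFamilyOn (α : ℝ → Form M k) (W : Set (ℝ × M)) : Prop :=
  ∀ x : M, ContDiffOn ℝ ∞ (fun z : ℝ × E3 => (α z.1).rep x z.2)
    {z | z.2 ∈ (extChartAt (𝓡 3) x).target ∧ (z.1, (extChartAt (𝓡 3) x).symm z.2) ∈ W}

/-- Smoothness of a form on a set `U ⊆ M` (to be used for open `U`). -/
def SmoothOn (α : Form M k) (U : Set M) : Prop :=
  ∀ x : M, ContDiffOn ℝ ∞ (α.rep x)
    {y | y ∈ (extChartAt (𝓡 3) x).target ∧ (extChartAt (𝓡 3) x).symm y ∈ U}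

/-- The exterior derivative, computed at `p` in the preferred chart at `p`. -/
def d (α : Form M k) : Form M (k + 1) := fun p =>
  (extDeriv (α.rep p) (extChartAt (𝓡 3) p p)).compContinuousLinearMap
    (mfderiv (𝓡 3) 𝓘(ℝ, E3) (extChartAt (𝓡 3) p) p)

/-- The wedge product of a 1-form and a `k`-form. -/
def wedge (α : Form M 1) (β : Form M k) : Form M (k + 1) := fun p => covWedge (α p) (β p)

/-- The derivative at `t = 0` of a family of forms, taken pointwise. -/
def dot (α : ℝ → Form M k) : Form M k := fun p =>
  (deriv (fun t : ℝ => (α t p : E3 [⋀^Fin k]→L[ℝ] ℂ)) 0 : E3 [⋀^Fin k]→L[ℝ] ℂ)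

/-- The extension of (the value at `p` of) a 1-form to a complex linear functional on the
complexified tangent space. -/
def complexify (α : Form M 1) (p : M) : CTangent p →ₗ[ℂ] ℂ :=
  LinearMap.liftBaseChange ℂ
    (((ContinuousAlternatingMap.ofSubsingleton ℝ (TangentSpace (𝓡 3) p) ℂ (0 : Fin 1)).symm
      (α p)).toLinearMap)

end Form

/-- The wedge product of a 1-form and a `k`-form. -/
scoped infixr:67 " ⋏ " => Form.wedge

variable (M) in
/-- The charts of `M` form an oriented atlas: all coordinate changes have positive Jacobian
determinant. `M` then carries the orientation for which these charts are positive. -/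
def IsOrientedAtlas : Prop :=
  ∀ x x' : M, ∀ y ∈ ((extChartAt (𝓡 3) x).symm.trans (extChartAt (𝓡 3) x')).source,
    0 < (fderiv ℝ (extChartAt (𝓡 3) x' ∘ (extChartAt (𝓡 3) x).symm) y).det

variable (M) in
/-- A smooth partition of unity subordinate to the cover of `M` by the domains of its charts. -/
def chartPartition [IsManifold (𝓡 3) ∞ M] [CompactSpace M] [T2Space M] :
    SmoothPartitionOfUnity M (𝓡 3) M univ :=
  Classical.choose (SmoothPartitionOfUnity.exists_isSubordinate_chartAt_source (𝓡 3) M)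

/-- The integral of a 3-form over a closed 3-manifold oriented by its atlas: the form is cut by a
partition of unity subordinate to the charts, and each piece is integrated in its chart. -/
def Form.integral [IsManifold (𝓡 3) ∞ M] [CompactSpace M] [T2Space M] (α : Form M 3) : ℂ :=
  ∑ᶠ x : M, ∫ y in (extChartAt (𝓡 3) x).target,
    ((chartPartition M x ((extChartAt (𝓡 3) x).symm y) : ℝ) : ℂ) *
      α.rep x y (fun i => EuclideanSpace.single i (1 : ℝ))

/-! ### Flag structures -/

variable [IsManifold (𝓡 3) ∞ M]

/-- The complex tangent vector `u + i v` for real tangent vectors `u`, `v`. -/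
def cvec {p : M} (u v : TangentSpace (𝓡 3) p) : CTangent p :=
  (1 : ℂ) ⊗ₜ[ℝ] u + Complex.I ⊗ₜ[ℝ] v

/-- A family of (real) vector fields is smooth on `W ⊆ ℝ × M`, jointly in the parameter and the
point. -/
def SmoothFieldFamilyOn (u : ℝ → (p : M) → TangentSpace (𝓡 3) p) (W : Set (ℝ × M)) : Prop :=
  ContMDiffOn (𝓘(ℝ, ℝ).prod (𝓡 3)) (𝓡 3).tangent ∞
    (fun z : ℝ × M => (⟨z.2, u z.1 z.2⟩ : TangentBundle (𝓡 3) M)) W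

/-- Near `(t₀, p₀)`, the family `L t p` of subspaces of the complexified tangent spaces is a family
of complex lines spanned by a nowhere zero complex vector field, smooth in `(t, p)`. -/
def SmoothLineFamilyAt (L : ℝ → (p : M) → Submodule ℂ (CTangent p)) (t₀ : ℝ) (p₀ : M) : Prop :=
  ∃ W ∈ 𝓝 (t₀, p₀), ∃ u v : ℝ → (p : M) → TangentSpace (𝓡 3) p,
    SmoothFieldFamilyOn u W ∧ SmoothFieldFamilyOn v W ∧
    ∀ z ∈ W, cvec (u z.1 z.2) (v z.1 z.2) ≠ 0 ∧
      L z.1 z.2 = Submodule.span ℂ {cvec (u z.1 z.2) (v z.1 z.2)}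

/-- A smooth complex line subbundle of the complexified tangent bundle: the case of a family that
does not depend on the parameter. -/
def IsLineSubbundle (L : (p : M) → Submodule ℂ (CTangent p)) : Prop :=
  ∀ p₀ : M, SmoothLineFamilyAt (fun _ => L) 0 p₀

variable (M) in
/-- A flag structure: two smooth complex line subbundles `T₁`, `T₂` of the complexified tangent
bundle with `T₁ ∩ T₂ = 0` such that `T₁ ⊕ T₂` is a contact distribution, i.e. is locally the kernel
of a complex 1-form `θ` with `θ ∧ dθ` nowhere zero. -/
structure FlagStructure where
  T₁ : (p : M) → Submodule ℂ (CTangent p)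
  T₂ : (p : M) → Submodule ℂ (CTangent p)
  line₁ : IsLineSubbundle T₁
  line₂ : IsLineSubbundle T₂
  inf_eq_bot : ∀ p, T₁ p ⊓ T₂ p = ⊥
  contact : ∀ p₀ : M, ∃ U : Set M, IsOpen U ∧ p₀ ∈ U ∧ ∃ θ : Form M 1, θ.SmoothOn U ∧
    ∀ p ∈ U, LinearMap.ker (θ.complexify p) = T₁ p ⊔ T₂ p ∧ (θ ⋏ θ.d) p ≠ 0

/-- A smooth path of flag structures, defined for `t` in an interval around `0`. -/
def IsSmoothDeformation (F : ℝ → FlagStructure M) : Prop :=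
  ∃ ε > 0, ∀ t ∈ Ioo (-ε) ε, ∀ p : M,
    SmoothLineFamilyAt (fun t => (F t).T₁) t p ∧ SmoothLineFamilyAt (fun t => (F t).T₂) t p

/-! ### The coframe bundle `Y` and its sections -/

variable (M) in
/-- The four 1-forms on `M` that make up a section of the coframe bundle `Y → M`. -/
structure Coframe where
  θ : Form M 1
  θ₁ : Form M 1
  θ₂ : Form M 1
  φ : Form M 1

/-- `s` is a (smooth, global) section of the coframe bundle `Y → M` of the flag structure `F`.

A point of `Y` over `p` is a point `θ` of the `ℂˣ`-bundle `E` of contact forms (`ker θ = T₁ ⊕ T₂`)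
at `p`, together with `(ω, ω¹, ω², φ)` at `θ ∈ E`, where `ω` is the tautological form, `ω¹, ω²` are
pulled back from `θ₁, θ₂` at `p` with `θ₁(T₂) = 0 ≠ θ₁(T₁)`, `θ₂(T₁) = 0 ≠ θ₂(T₂)`, and
`dω = ω ∧ φ + ω¹ ∧ ω²`. The vertical part of `φ` is then forced to be `-dλ/λ`, so that a section
`s` of `Y` is the same as the quadruple of the pullbacks `θ, θ₁, θ₂, φ` of its components
to `M`, with `dθ = θ ∧ φ + θ₁ ∧ θ₂`; in terms of `s` they are `s^*ω, s^*ω¹, s^*ω², s^*φ`, the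
pullbacks of the tautological forms of `Y`. -/
structure IsSection (F : FlagStructure M) (s : Coframe M) : Prop where
  smooth_θ : s.θ.SmoothOn univ
  smooth_θ₁ : s.θ₁.SmoothOn univ
  smooth_θ₂ : s.θ₂.SmoothOn univ
  smooth_φ : s.φ.SmoothOn univ
  ker_θ : ∀ p, LinearMap.ker (s.θ.complexify p) = F.T₁ p ⊔ F.T₂ p
  θ₁_T₂ : ∀ p, F.T₂ p ≤ LinearMap.ker (s.θ₁.complexify p)
  θ₁_T₁ : ∀ p, ¬ F.T₁ p ≤ LinearMap.ker (s.θ₁.complexify p)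
  θ₂_T₁ : ∀ p, F.T₁ p ≤ LinearMap.ker (s.θ₂.complexify p)
  θ₂_T₂ : ∀ p, ¬ F.T₂ p ≤ LinearMap.ker (s.θ₂.complexify p)
  d_θ : s.θ.d = s.θ ⋏ s.φ + s.θ₁ ⋏ s.θ₂

/-- For `|t| < δ`, the `s t` are sections of the coframe bundles of the flag structures `F t`, and
they depend smoothly on `t`. -/
structure IsSmoothSectionFamily (F : ℝ → FlagStructure M) (s : ℝ → Coframe M) (δ : ℝ) : Prop where
  isSection : ∀ t ∈ Ioo (-δ) δ, IsSection (F t) (s t)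
  smooth_θ : Form.SmoothFamilyOn (fun t => (s t).θ) (Ioo (-δ) δ ×ˢ univ)
  smooth_θ₁ : Form.SmoothFamilyOn (fun t => (s t).θ₁) (Ioo (-δ) δ ×ˢ univ)
  smooth_θ₂ : Form.SmoothFamilyOn (fun t => (s t).θ₂) (Ioo (-δ) δ ×ˢ univ)
  smooth_φ : Form.SmoothFamilyOn (fun t => (s t).φ) (Ioo (-δ) δ ×ˢ univ)

/-! ### The adapted connection -/

variable (M) in
/-- The remaining components `ω₁¹, φ¹, φ², ψ` of a connection, pulled back by a section of `Y`. -/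
structure ConnectionForms where
  ω₁₁ : Form M 1
  φ₁ : Form M 1
  φ₂ : Form M 1
  ψ : Form M 1

instance : Nonempty (ConnectionForms M) := ⟨⟨0, 0, 0, 0⟩⟩

/-- `c` consists of the pullbacks by the section `s` of the components of the adapted connection:
the structure equations hold, with the normalizations `Ω₁¹ = 0` (first of the last two equations)
and `Φ¹ = Q¹ θ ∧ θ₂` (no term in `θ₁ ∧ θ`). -/
structure IsAdapted (s : Coframe M) (c : ConnectionForms M) : Prop where
  smooth_ω₁₁ : c.ω₁₁.SmoothOn univ
  smooth_φ₁ : c.φ₁.SmoothOn univ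
  smooth_φ₂ : c.φ₂.SmoothOn univ
  smooth_ψ : c.ψ.SmoothOn univ
  d_θ₁ : s.θ₁.d = (1 / 2 : ℂ) • s.θ₁ ⋏ s.φ + s.θ₁ ⋏ c.ω₁₁ + s.θ ⋏ c.φ₁
  d_θ₂ : s.θ₂.d = (1 / 2 : ℂ) • s.θ₂ ⋏ s.φ - s.θ₂ ⋏ c.ω₁₁ + s.θ ⋏ c.φ₂
  d_φ : s.φ.d = s.θ₁ ⋏ c.φ₂ - s.θ₂ ⋏ c.φ₁ + s.θ ⋏ c.ψ
  d_ω₁₁ : c.ω₁₁.d = (3 / 2 : ℂ) • s.θ₂ ⋏ c.φ₁ + (3 / 2 : ℂ) • s.θ₁ ⋏ c.φ₂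
  d_φ₁ : ∃ Q : M → ℂ,
    c.φ₁.d - c.φ₁ ⋏ c.ω₁₁ - (1 / 2 : ℂ) • s.θ₁ ⋏ c.ψ - (1 / 2 : ℂ) • s.φ ⋏ c.φ₁ =
      fun p => Q p • (s.θ ⋏ s.θ₂) p

/-- The components of the adapted connection in the gauge `s` (there is exactly one choice of them
when `s` is a section of the coframe bundle of a flag structure). -/
def Coframe.connectionForms (s : Coframe M) : ConnectionForms M :=
  Classical.epsilon (IsAdapted s)

/-- The pullback `s^*π` of the `𝔰𝔩(3, ℂ)`-valued adapted connection form `π` on `Y`, as a matrix of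
1-forms on `M`. -/
def Coframe.connection (s : Coframe M) : Matrix (Fin 3) (Fin 3) (Form M 1) :=
  let c := s.connectionForms
  !![-(1 / 2 : ℂ) • s.φ - (1 / 3 : ℂ) • c.ω₁₁, -c.φ₂, -(1 / 4 : ℂ) • c.ψ;
     s.θ₁, (2 / 3 : ℂ) • c.ω₁₁, (1 / 2 : ℂ) • c.φ₁;
     (2 : ℂ) • s.θ, (2 : ℂ) • s.θ₂, (1 / 2 : ℂ) • s.φ - (1 / 3 : ℂ) • c.ω₁₁]

/-- The pullback `s^*Π` of the curvature `Π = dπ + π ∧ π`. -/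
def Coframe.curvature (s : Coframe M) : Matrix (Fin 3) (Fin 3) (Form M 2) :=
  Matrix.of fun i j => (s.connection i j).d + ∑ k, s.connection i k ⋏ s.connection k j

/-- `tr(A ∧ B)` for a matrix `A` of 1-forms and a matrix `B` of `k`-forms. -/
def trWedge {k : ℕ} (A : Matrix (Fin 3) (Fin 3) (Form M 1))
    (B : Matrix (Fin 3) (Fin 3) (Form M k)) : Form M (k + 1) :=
  ∑ i, ∑ j, A i j ⋏ B j i

/-- `A ∧ A` for a matrix `A` of 1-forms. -/
def wedgeSq (A : Matrix (Fin 3) (Fin 3) (Form M 1)) : Matrix (Fin 3) (Fin 3) (Form M 2) :=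
  Matrix.of fun i j => ∑ k, A i k ⋏ A k j

section Invariant

variable [CompactSpace M] [T2Space M]

/-- The integral `(1 / 24π²) ∫_M s^* tr(π ∧ π ∧ π)` for a section `s`. -/
def Coframe.muIntegral (s : Coframe M) : ℂ :=
  1 / (24 * (Real.pi : ℂ) ^ 2) * (trWedge s.connection (wedgeSq s.connection)).integral

open Classical in
/-- The global invariant `μ` of a flag structure with trivial coframe bundle on a closed oriented
3-manifold, computed with an arbitrary section (and `0` if there is no section). -/
def FlagStructure.mu (F : FlagStructure M) : ℂ :=
  if h : ∃ s, IsSection F s then (Classical.choose h).muIntegral else 0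

end Invariant

/-! ### Totally real immersions into the flag space -/

/-- `SL(3, ℂ)`. -/
abbrev SL3 : Type := Matrix.SpecialLinearGroup (Fin 3) ℂ

/-- The Borel subgroup of upper triangular matrices in `SL(3, ℂ)`. -/
def borel : Subgroup SL3 where
  carrier := {g | ∀ i j : Fin 3, j < i → (g : Matrix (Fin 3) (Fin 3) ℂ) i j = 0}
  one_mem' := by
    intro i j h
    simp [Matrix.one_apply_ne (ne_of_gt h)]
  mul_mem' := by
    intro a b ha hb
    have ha' : (a : Matrix (Fin 3) (Fin 3) ℂ).BlockTriangular id := fun i j h => ha i j h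
    have hb' : (b : Matrix (Fin 3) (Fin 3) ℂ).BlockTriangular id := fun i j h => hb i j h
    intro i j h
    rw [Matrix.SpecialLinearGroup.coe_mul]
    exact ha'.mul hb' h
  inv_mem' := by
    intro a ha
    have h10 : (a : Matrix (Fin 3) (Fin 3) ℂ) 1 0 = 0 := ha 1 0 (by decide)
    have h20 : (a : Matrix (Fin 3) (Fin 3) ℂ) 2 0 = 0 := ha 2 0 (by decide)
    have h21 : (a : Matrix (Fin 3) (Fin 3) ℂ) 2 1 = 0 := ha 2 1 (by decide)
    intro i j h
    rw [Matrix.SpecialLinearGroup.coe_inv, Matrix.adjugate_fin_three]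
    fin_cases i <;> fin_cases j <;> simp_all

/-- The space of complete flags in `ℂ³`. -/
abbrev FlagSpace : Type := SL3 ⧸ borel

/-- Upper triangular matrices. As `𝔰𝔩(3, ℂ)` contains all the strictly lower triangular matrices,
`Mat₃(ℂ) ⧸ upperTriangular` is `𝔰𝔩(3, ℂ) ⧸ 𝔟`, the tangent space of the flag space at the base
point. -/
def upperTriangular : Submodule ℂ (Matrix (Fin 3) (Fin 3) ℂ) where
  carrier := {m | m 1 0 = 0 ∧ m 2 0 = 0 ∧ m 2 1 = 0}
  zero_mem' := by simp
  add_mem' := by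
    rintro a b ⟨h1, h2, h3⟩ ⟨k1, k2, k3⟩
    simp_all
  smul_mem' := by
    rintro c a ⟨h1, h2, h3⟩
    simp_all

/-- The infinitesimal stabilizer of the line of the standard flag; modulo `upperTriangular` it is the
tangent line to the fibre of the projection of a flag to its line. -/
def parabolic₁ : Submodule ℂ (Matrix (Fin 3) (Fin 3) ℂ) where
  carrier := {m | m 1 0 = 0 ∧ m 2 0 = 0}
  zero_mem' := by simp
  add_mem' := by
    rintro a b ⟨h1, h2⟩ ⟨k1, k2⟩
    simp_all
  smul_mem' := by
    rintro c a ⟨h1, h2⟩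
    simp_all

/-- The infinitesimal stabilizer of the plane of the standard flag; modulo `upperTriangular` it is
the tangent line to the fibre of the projection of a flag to its plane. -/
def parabolic₂ : Submodule ℂ (Matrix (Fin 3) (Fin 3) ℂ) where
  carrier := {m | m 2 0 = 0 ∧ m 2 1 = 0}
  zero_mem' := by simp
  add_mem' := by
    rintro a b ⟨h1, h2⟩ ⟨k1, k2⟩
    simp_all
  smul_mem' := by
    rintro c a ⟨h1, h2⟩
    simp_all

/-- On the open set `U`, the map `g` is a smooth lift to `SL(3, ℂ)` of the map `f` to the flag
space. -/
structure IsSmoothLiftOn (f : M → FlagSpace) (g : M → SL3) (U : Set M) : Prop where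
  isOpen : IsOpen U
  smooth : ∀ i j, ContMDiffOn (𝓡 3) 𝓘(ℝ, ℂ) ∞
    (fun p => (g p : Matrix (Fin 3) (Fin 3) ℂ) i j) U
  lift : ∀ p ∈ U, (QuotientGroup.mk (g p) : FlagSpace) = f p

/-- The map `g⁻¹ dg` from the complexified tangent space at `p` to matrices. -/
def maurerCartan (g : M → SL3) (p : M) : CTangent p →ₗ[ℂ] Matrix (Fin 3) (Fin 3) ℂ :=
  LinearMap.liftBaseChange ℂ
    ({ toFun := fun v => ((g p)⁻¹ : SL3).1 * Matrix.of fun i j =>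
          (mfderiv (𝓡 3) 𝓘(ℝ, ℂ) (fun q => (g q : Matrix (Fin 3) (Fin 3) ℂ) i j) p v : ℂ)
       map_add' := by
        intro v w
        rw [← mul_add]
        congr 1
        ext i j
        simp only [map_add, Matrix.add_apply]
        rfl
       map_smul' := by
        intro c v
        rw [RingHom.id_apply, ← Matrix.mul_smul]
        congr 1
        ext i j
        simp only [map_smul, Matrix.smul_apply]
        rfl } : TangentSpace (𝓡 3) p →ₗ[ℝ] Matrix (Fin 3) (Fin 3) ℂ)

/-- `f` is a smooth totally real immersion into the flag space: it has local smooth lifts `g` to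
`SL(3, ℂ)`, and its complexified differential is an isomorphism at each point. The tangent space of
the flag space at `f p = g(p) B` is identified by the translation by `g(p)` with `𝔰𝔩(3, ℂ) ⧸ 𝔟`;
the complexified differential is then `g⁻¹ dg` modulo `𝔟`. -/
structure IsTotallyRealImmersion (f : M → FlagSpace) : Prop where
  smooth : ∀ p, ∃ U g, p ∈ U ∧ IsSmoothLiftOn f g U
  bijective : ∀ p U g, p ∈ U → IsSmoothLiftOn f g U →
    Function.Bijective (upperTriangular.mkQ ∘ₗ maurerCartan g p)

/-- The flag structure `F` is induced by the totally real immersion `f`: the complexified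
differential of `f` maps `T₁` and `T₂` to the tangent lines of the fibres of the two projections
of the flag space (to lines and to planes). -/
structure IsInducedBy (F : FlagStructure M) (f : M → FlagSpace) : Prop where
  immersion : IsTotallyRealImmersion f
  T₁_eq : ∀ p U g, p ∈ U → IsSmoothLiftOn f g U → F.T₁ p = parabolic₁.comap (maurerCartan g p)
  T₂_eq : ∀ p U g, p ∈ U → IsSmoothLiftOn f g U → F.T₂ p = parabolic₂.comap (maurerCartan g p)

end Manifold

end FlagGeometry

end

open FlagGeometry

noncomputable section

namespace FlagGeometry

set_option linter.unusedSectionVars false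
set_option linter.unusedSimpArgs false

/-! ### Exterior algebra of `E3` in coordinates -/

/-! The integrand of the invariant is a multiple of the Chern–Simons form of the adapted connection,
and the curvature of that connection is degenerate enough to make the first variation formula short.
By the structure equations Π is strictly upper triangular, and the normalization of `φ₁` makes Π₁₂ a
multiple of θ ∧ θ₂. Applying d² = 0 to the structure equations gives θ₁ ∧ Π₀₁ = θ ∧ Π₀₁ = θ ∧ Π₀₂ =
0 (`bianchi`). Hence tr(π ∧ Π) = 0 (`IsFramed.tr2_curvAt`), that is, tr π³ = -tr(π ∧ dπ).
Differentiating the left side gives 3 tr(π̇ ∧ π ∧ π), and differentiating the right side gives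
-tr(π̇ ∧ dπ) - tr(π ∧ dπ̇). Three times the second expression minus twice the first is -6 tr(π̇ ∧ Π)
- 3 d tr(π̇ ∧ π) (`c3_dotAt_cubeForm_eq`). Stokes' theorem (`Form.integral_d`) removes the exact
term, and the factor 6/24 is the constant 1/4 of the formula.

This argument never sees the flags. It holds for every smooth family of coframes with θ, θ₁, θ₂
independent and dθ = θ ∧ φ + θ₁ ∧ θ₂ (`Coframe.IsFramed`). For such a coframe the structure
equations can be solved one coefficient at a time. The solution `Coframe.adapted` is an explicit
expression in coefficients and exterior derivatives, so it depends smoothly on parameters. The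
components not used for solving hold because d² = 0 (`adaptedAt_adapted`), and the solution is
locally unique (`adapted_unique`).

Two sections of one structure differ by a rescaling of θ₁, θ₂ by nowhere zero functions and by
adding multiples of θ to them (`IsSection.exists_scale`). The second change is joined to the
identity by an affine path, along which tr(π̇ ∧ Π) vanishes pointwise, so the variation formula
itself shows that the integral is constant. A rescaling need not be homotopic to the identity. There
the integrand is computed directly, and it changes by an exact form (`cubeForm_scale`).

For a deformation, the slopes of the lines of F_t with respect to a fixed section of F₀ are smooth
functions. They yield forms annihilating the right lines, which are then rescaled so that the
equation for dθ holds (`Deformation.deform`). Compactness makes the construction work on all of M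
for small t.

For a totally real immersion, a local lift g to SL(3, ℂ) is changed by an upper triangular gauge
transformation until the entries of g⁻¹ dg below the diagonal are fixed multiples of θ, θ₁, θ₂ and
the difference of two diagonal entries is φ (`isFlatFrameAt_of_aligned`). The negative of the
reflection of g⁻¹ dg in the antidiagonal, made trace free, then has exactly the shape of the adapted
connection. By local uniqueness it is the adapted connection, and the Maurer–Cartan equation says
that it is flat.

Pointwise identities are checked in the coordinates `c1`, `c2`, `c3` of the model space, where they
become polynomial identities. -/

/-- The space of complex valued alternating `k`-forms on `E3`. -/
abbrev Alt (k : ℕ) : Type := E3 [⋀^Fin k]→L[ℝ] ℂ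

/-- The standard basis of `E3`. -/
abbrev stdE (i : Fin 3) : E3 := EuclideanSpace.single i (1 : ℝ)

theorem covWedge_apply {k : ℕ} (α : Alt 1) (β : Alt k) (v : Fin (k + 1) → E3) :
    covWedge α β v = ∑ i : Fin (k + 1), (-1 : ℂ) ^ (i : ℕ) * (α (fun _ => v i) * β (i.removeNth v)) := by
  unfold covWedge
  rw [ContinuousAlternatingMap.alternatizeUncurryFin_apply]
  refine Finset.sum_congr rfl fun i _ => ?_
  rw [zsmul_eq_mul]
  push_cast
  rfl

/-- The coordinates of a 1-form. -/
def c1 (α : Alt 1) (i : Fin 3) : ℂ := α (fun _ => stdE i)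
/-- The coordinates of a 2-form. -/
def c2 (α : Alt 2) (i j : Fin 3) : ℂ := α ![stdE i, stdE j]
/-- The coordinate of a 3-form. -/
def c3 (α : Alt 3) : ℂ := α (fun i => stdE i)

theorem c2_covWedge (α β : Alt 1) (i j : Fin 3) :
    c2 (covWedge α β) i j = c1 α i * c1 β j - c1 α j * c1 β i := by
  unfold c2 c1
  rw [covWedge_apply, Fin.sum_univ_two]
  have h0 : (Fin.removeNth (0 : Fin 2) ![stdE i, stdE j]) = fun _ => stdE j := by
    ext k; fin_cases k; rfl
  have h1 : (Fin.removeNth (1 : Fin 2) ![stdE i, stdE j]) = fun _ => stdE i := by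
    ext k; fin_cases k; rfl
  rw [h0, h1]
  simp
  ring

theorem c3_covWedge (α : Alt 1) (β : Alt 2) :
    c3 (covWedge α β) = c1 α 0 * c2 β 1 2 - c1 α 1 * c2 β 0 2 + c1 α 2 * c2 β 0 1 := by
  unfold c3 c2 c1
  rw [covWedge_apply, Fin.sum_univ_three]
  have h0 : (Fin.removeNth (0 : Fin 3) (fun i : Fin 3 => stdE i)) = ![stdE 1, stdE 2] := by
    ext k; fin_cases k <;> rfl
  have h1 : (Fin.removeNth (1 : Fin 3) (fun i : Fin 3 => stdE i)) = ![stdE 0, stdE 2] := by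
    ext k; fin_cases k <;> rfl
  have h2 : (Fin.removeNth (2 : Fin 3) (fun i : Fin 3 => stdE i)) = ![stdE 0, stdE 1] := by
    ext k; fin_cases k <;> rfl
  rw [h0, h1, h2]
  simp
  ring

section
variable {k : ℕ} (c : ℂ)
@[simp] theorem c1_add (α β : Alt 1) (i) : c1 (α + β) i = c1 α i + c1 β i := rfl
@[simp] theorem c1_sub (α β : Alt 1) (i) : c1 (α - β) i = c1 α i - c1 β i := rfl
@[simp] theorem c1_neg (α : Alt 1) (i) : c1 (-α) i = -c1 α i := rfl
@[simp] theorem c1_zero (i) : c1 0 i = 0 := rfl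
@[simp] theorem c1_smul (α : Alt 1) (i) : c1 (c • α) i = c * c1 α i := rfl
@[simp] theorem c2_add (α β : Alt 2) (i j) : c2 (α + β) i j = c2 α i j + c2 β i j := rfl
@[simp] theorem c2_sub (α β : Alt 2) (i j) : c2 (α - β) i j = c2 α i j - c2 β i j := rfl
@[simp] theorem c2_neg (α : Alt 2) (i j) : c2 (-α) i j = -c2 α i j := rfl
@[simp] theorem c2_zero (i j) : c2 0 i j = 0 := rfl
@[simp] theorem c2_smul (α : Alt 2) (i j) : c2 (c • α) i j = c * c2 α i j := rfl
@[simp] theorem c3_add (α β : Alt 3) : c3 (α + β) = c3 α + c3 β := rfl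
@[simp] theorem c3_sub (α β : Alt 3) : c3 (α - β) = c3 α - c3 β := rfl
@[simp] theorem c3_zero : c3 0 = 0 := rfl
@[simp] theorem c3_smul (α : Alt 3) : c3 (c • α) = c * c3 α := rfl
attribute [simp] c2_covWedge c3_covWedge
end

/-- The standard basis of `E3`, as a basis. -/
abbrev stdB : Module.Basis (Fin 3) ℝ E3 := (EuclideanSpace.basisFun (Fin 3) ℝ).toBasis

theorem stdB_apply (i : Fin 3) : stdB i = stdE i := by simp [stdB, stdE]

theorem alt_ext {k : ℕ} {α β : Alt k}
    (h : ∀ v : Fin k → Fin 3, Function.Injective v →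
      α (fun i => stdE (v i)) = β (fun i => stdE (v i))) : α = β := by
  apply ContinuousAlternatingMap.toAlternatingMap_injective
  refine Module.Basis.ext_alternating stdB fun v hv => ?_
  simp only [stdB_apply]
  exact h v hv

theorem alt1_ext {α β : Alt 1} (h : ∀ i, c1 α i = c1 β i) : α = β := by
  refine alt_ext fun v _ => ?_
  have : (fun i => stdE (v i)) = fun _ => stdE (v 0) := by
    ext k; rw [Subsingleton.elim k 0]
  rw [this]; exact h _

theorem c2_swap (α : Alt 2) (i j) : c2 α i j = -c2 α j i := by
  unfold c2
  have := α.toAlternatingMap.map_swap ![stdE j, stdE i] (i := 0) (j := 1) (by decide)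
  rw [← ContinuousAlternatingMap.coe_toAlternatingMap, ← this]
  congr 1
  ext k; fin_cases k <;> rfl

theorem alt2_ext {α β : Alt 2} (h01 : c2 α 0 1 = c2 β 0 1) (h02 : c2 α 0 2 = c2 β 0 2)
    (h12 : c2 α 1 2 = c2 β 1 2) : α = β := by
  refine alt_ext fun v hv => ?_
  have e : (fun i => stdE (v i)) = ![stdE (v 0), stdE (v 1)] := by
    ext k; fin_cases k <;> rfl
  rw [e]
  change c2 α (v 0) (v 1) = c2 β (v 0) (v 1)
  have hne : v 0 ≠ v 1 := fun h => by simpa using hv h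
  have sα := c2_swap α
  have sβ := c2_swap β
  generalize v 0 = a at hne
  generalize v 1 = b at hne
  fin_cases a <;> fin_cases b <;> first | (exact absurd rfl hne) | assumption | skip
  · exact (sα 1 0).trans (h01 ▸ (sβ 1 0).symm)
  · exact (sα 2 0).trans (h02 ▸ (sβ 2 0).symm)
  · exact (sα 2 1).trans (h12 ▸ (sβ 2 1).symm)

theorem alt3_ext {α β : Alt 3} (h : c3 α = c3 β) : α = β := by
  refine alt_ext fun v hv => ?_
  -- Three distinct indices form a permutation, so every value on basis vectors is the single
  -- coordinate up to sign.
  let σ : Equiv.Perm (Fin 3) := Equiv.ofBijective v (Finite.injective_iff_bijective.1 hv)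
  have hα := α.toAlternatingMap.map_perm (fun i => stdE i) σ
  have hβ := β.toAlternatingMap.map_perm (fun i => stdE i) σ
  change α (fun i => stdE (v i)) = _ • c3 α at hα
  change β (fun i => stdE (v i)) = _ • c3 β at hβ
  rw [hα, hβ, h]

/-- A 3-form is determined by its coordinate; under a linear map it is multiplied by the
determinant. -/
theorem c3_comp (α : Alt 3) (L : E3 →L[ℝ] E3) :
    c3 (α.compContinuousLinearMap L) = (L.det : ℂ) * c3 α := by
  -- A 3-form is its coordinate times the determinant in the standard basis, and the determinant is
  -- multiplicative.
  have h1 : α.toAlternatingMap =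
      (LinearMap.toSpanSingleton ℝ ℂ (c3 α)).compAlternatingMap stdB.det := by
    refine Module.Basis.ext_alternating stdB fun v hv => ?_
    let σ : Equiv.Perm (Fin 3) := Equiv.ofBijective v (Finite.injective_iff_bijective.1 hv)
    have hα := α.toAlternatingMap.map_perm (fun i => stdE i) σ
    change α (fun i => stdE (v i)) = _ • c3 α at hα
    have hd := (stdB.det).map_perm stdB σ
    rw [Module.Basis.det_self] at hd
    simp only [stdB_apply]
    refine hα.trans ?_
    have : stdB.det (fun i => stdE (v i)) = Equiv.Perm.sign σ • (1 : ℝ) := by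
      rw [← hd]; congr 1; ext1 i; exact (stdB_apply _).symm
    rw [LinearMap.compAlternatingMap_apply, this, LinearMap.toSpanSingleton_apply]
    rcases Int.units_eq_one_or (Equiv.Perm.sign σ) with h | h <;> rw [h] <;> simp
  have h2 : c3 (α.compContinuousLinearMap L) = α.toAlternatingMap (fun i => L (stdE i)) := rfl
  have h3 := stdB.det_comp L.toLinearMap stdB
  rw [Module.Basis.det_self, mul_one] at h3
  rw [h2, h1, LinearMap.compAlternatingMap_apply, LinearMap.toSpanSingleton_apply,
    Complex.real_smul]
  congr 2
  rw [ContinuousLinearMap.det, ← h3]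
  congr 1; ext1 i
  exact congrArg L (stdB_apply i).symm

/-! ### The wedge product as a continuous bilinear map -/

theorem covWedge_add_left {k : ℕ} (α α' : Alt 1) (β : Alt k) :
    covWedge (α + α') β = covWedge α β + covWedge α' β := by
  ext v
  simp only [covWedge_apply, ContinuousAlternatingMap.add_apply, ← Finset.sum_add_distrib]
  exact Finset.sum_congr rfl fun i _ => by ring

theorem covWedge_add_right {k : ℕ} (α : Alt 1) (β β' : Alt k) :
    covWedge α (β + β') = covWedge α β + covWedge α β' := by
  ext v
  simp only [covWedge_apply, ContinuousAlternatingMap.add_apply, ← Finset.sum_add_distrib]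
  exact Finset.sum_congr rfl fun i _ => by ring

theorem covWedge_smul_left {k : ℕ} (c : ℂ) (α : Alt 1) (β : Alt k) :
    covWedge (c • α) β = c • covWedge α β := by
  ext v
  simp only [covWedge_apply, ContinuousAlternatingMap.smul_apply, smul_eq_mul, Finset.mul_sum]
  exact Finset.sum_congr rfl fun i _ => by ring

theorem covWedge_smul_right {k : ℕ} (c : ℂ) (α : Alt 1) (β : Alt k) :
    covWedge α (c • β) = c • covWedge α β := by
  ext v
  simp only [covWedge_apply, ContinuousAlternatingMap.smul_apply, smul_eq_mul, Finset.mul_sum]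
  exact Finset.sum_congr rfl fun i _ => by ring

theorem covWedge_comp {k : ℕ} (α : Alt 1) (β : Alt k) (L : E3 →L[ℝ] E3) :
    (covWedge α β).compContinuousLinearMap L =
      covWedge (α.compContinuousLinearMap L) (β.compContinuousLinearMap L) := by
  ext v
  rw [covWedge_apply, ContinuousAlternatingMap.compContinuousLinearMap_apply, covWedge_apply]
  rfl

/-- The wedge product with a 1-form as a continuous bilinear map. -/
def covWedgeL (k : ℕ) : Alt 1 →L[ℝ] Alt k →L[ℝ] Alt (k + 1) :=
  LinearMap.mkContinuous₂
    (LinearMap.mk₂ ℝ covWedge covWedge_add_left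
      (fun c α β => by
        rw [← Complex.coe_smul, ← Complex.coe_smul, covWedge_smul_left])
      covWedge_add_right
      (fun c α β => by
        rw [← Complex.coe_smul, ← Complex.coe_smul, covWedge_smul_right]))
    -- The alternatization is a sum of k + 1 terms, each bounded by the product of the norms.
    (k + 1)
    (fun α β => by
      refine (ContinuousAlternatingMap.norm_alternatizeUncurryFin_le _).trans ?_
      rw [mul_assoc]
      refine mul_le_mul_of_nonneg_left ?_ (by positivity)
      refine ContinuousLinearMap.opNorm_le_bound _ (by positivity) fun v => ?_
      rw [ContinuousLinearMap.smulRight_apply, norm_smul, mul_right_comm]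
      refine mul_le_mul_of_nonneg_right ?_ (norm_nonneg _)
      refine (ContinuousLinearMap.le_opNorm _ v).trans (le_of_eq ?_)
      congr 1
      conv_rhs =>
        rw [← (ContinuousAlternatingMap.ofSubsingleton ℝ E3 ℂ (0 : Fin 1)).apply_symm_apply α]
      exact (ContinuousAlternatingMap.norm_ofSubsingleton _ _).symm)

/-! ### The exterior derivative on `E3` -/

/-- The differential of a complex valued function, as an alternating map. -/
abbrev altOf (l : E3 →L[ℝ] ℂ) : Alt 1 := ContinuousAlternatingMap.ofSubsingleton ℝ E3 ℂ (0 : Fin 1) l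

theorem extDeriv_funSMul {k : ℕ} {f : E3 → ℂ} {η : E3 → Alt k} {y : E3}
    (hf : DifferentiableAt ℝ f y) (hη : DifferentiableAt ℝ η y) :
    extDeriv (fun y => f y • η y) y =
      covWedge (altOf (fderiv ℝ f y)) (η y) + f y • extDeriv η y := by
  ext v
  have h : HasFDerivAt (fun y => f y • η y)
      (f y • fderiv ℝ η y + (fderiv ℝ f y).smulRight (η y)) y :=
    hf.hasFDerivAt.smul hη.hasFDerivAt
  rw [extDeriv, h.fderiv, ContinuousAlternatingMap.alternatizeUncurryFin_apply,
    ContinuousAlternatingMap.add_apply, covWedge_apply, ContinuousAlternatingMap.smul_apply,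
    extDeriv, ContinuousAlternatingMap.alternatizeUncurryFin_apply, Finset.smul_sum,
    ← Finset.sum_add_distrib]
  refine Finset.sum_congr rfl fun i _ => ?_
  simp only [_root_.add_apply, _root_.smul_apply,
    ContinuousLinearMap.smulRight_apply, ContinuousAlternatingMap.add_apply,
    ContinuousAlternatingMap.smul_apply, smul_eq_mul, zsmul_eq_mul,
    ContinuousAlternatingMap.ofSubsingleton_apply_apply]
  push_cast
  ring

/-- The usual rule is d(α ∧ β) = dα ∧ β - α ∧ dβ. Since `covWedge` only takes a 1-form on the left,
dα ∧ β appears as β ∧ dα; a 1-form and a 2-form commute. -/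
theorem extDeriv_covWedge {α β : E3 → Alt 1} {y : E3}
    (hα : DifferentiableAt ℝ α y) (hβ : DifferentiableAt ℝ β y) :
    extDeriv (fun y => covWedge (α y) (β y)) y =
      covWedge (β y) (extDeriv α y) - covWedge (α y) (extDeriv β y) := by
  have h : HasFDerivAt (fun y => covWedge (α y) (β y)) _ y :=
    (covWedgeL 1).hasFDerivAt_of_bilinear hα.hasFDerivAt hβ.hasFDerivAt
  rw [extDeriv, h.fderiv]
  apply alt3_ext
  have key : ∀ (L : E3 →L[ℝ] Alt 1) (i j : Fin 3),
      c2 (ContinuousAlternatingMap.alternatizeUncurryFin L) i j =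
        c1 (L (stdE i)) j - c1 (L (stdE j)) i := by
    intro L i j
    unfold c2
    rw [ContinuousAlternatingMap.alternatizeUncurryFin_apply, Fin.sum_univ_two]
    have h0 : (Fin.removeNth (0 : Fin 2) ![stdE i, stdE j]) = fun _ => stdE j := by
      ext k; fin_cases k; rfl
    have h1 : (Fin.removeNth (1 : Fin 2) ![stdE i, stdE j]) = fun _ => stdE i := by
      ext k; fin_cases k; rfl
    rw [h0, h1]
    simp [c1]
    ring
  have key3 : ∀ (L : E3 →L[ℝ] Alt 2),
      c3 (ContinuousAlternatingMap.alternatizeUncurryFin L) =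
        c2 (L (stdE 0)) 1 2 - c2 (L (stdE 1)) 0 2 + c2 (L (stdE 2)) 0 1 := by
    intro L
    unfold c3
    rw [ContinuousAlternatingMap.alternatizeUncurryFin_apply, Fin.sum_univ_three]
    have h0 : (Fin.removeNth (0 : Fin 3) (fun i : Fin 3 => stdE i)) = ![stdE 1, stdE 2] := by
      ext k; fin_cases k <;> rfl
    have h1 : (Fin.removeNth (1 : Fin 3) (fun i : Fin 3 => stdE i)) = ![stdE 0, stdE 2] := by
      ext k; fin_cases k <;> rfl
    have h2 : (Fin.removeNth (2 : Fin 3) (fun i : Fin 3 => stdE i)) = ![stdE 0, stdE 1] := by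
      ext k; fin_cases k <;> rfl
    rw [h0, h1, h2]
    simp [c2]
    ring
  rw [key3, c3_sub, c3_covWedge, c3_covWedge, extDeriv, extDeriv]
  simp only [key]
  have e : ∀ v i j, c2 (((covWedgeL 1).precompR E3 (α y) (fderiv ℝ β y) +
      (covWedgeL 1).precompL E3 (fderiv ℝ α y) (β y)) v) i j =
      c2 (covWedge (α y) (fderiv ℝ β y v)) i j + c2 (covWedge (fderiv ℝ α y v) (β y)) i j :=
    fun v i j => rfl
  rw [e, e, e]
  simp only [c2_covWedge]
  ring

variable {M : Type*} [TopologicalSpace M] [ChartedSpace E3 M]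

/-! ### Coordinate expressions of forms -/

/-- The derivative of the preferred chart at `x`. -/
def dChart (x p : M) : E3 →L[ℝ] E3 := mfderiv (𝓡 3) 𝓘(ℝ, E3) (extChartAt (𝓡 3) x) p

/-- The derivative of the inverse of the preferred chart at `x`. -/
def dSymm (x : M) (y : E3) : E3 →L[ℝ] E3 := mfderiv 𝓘(ℝ, E3) (𝓡 3) (extChartAt (𝓡 3) x).symm y

/-- The coordinate change between two preferred charts. -/
def coordChange (x z : M) (y : E3) : E3 := extChartAt (𝓡 3) z ((extChartAt (𝓡 3) x).symm y)

/-- The value of a form at a point, as an alternating map on the model space. -/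
def Form.val {k : ℕ} (α : Form M k) (p : M) : Alt k := α p

theorem Form.ext_val {k : ℕ} {α β : Form M k} (h : ∀ p, α.val p = β.val p) : α = β := funext h

theorem Form.rep_eq {k : ℕ} (α : Form M k) (x : M) (y : E3) :
    α.rep x y = (α.val ((extChartAt (𝓡 3) x).symm y)).compContinuousLinearMap (dSymm x y) := rfl

theorem Form.val_d {k : ℕ} (α : Form M k) (p : M) :
    α.d.val p = (extDeriv (α.rep p) (extChartAt (𝓡 3) p p)).compContinuousLinearMap
      (dChart p p) := rfl

variable [IsManifold (𝓡 3) ∞ M]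

theorem symm_mem_source {x : M} {y : E3} (hy : y ∈ (extChartAt (𝓡 3) x).target) :
    (extChartAt (𝓡 3) x).symm y ∈ (extChartAt (𝓡 3) x).source := (extChartAt (𝓡 3) x).map_target hy

theorem dChart_comp_dSymm {x : M} {y : E3} (hy : y ∈ (extChartAt (𝓡 3) x).target) :
    (dChart x ((extChartAt (𝓡 3) x).symm y)).comp (dSymm x y) = ContinuousLinearMap.id ℝ E3 := by
  have := mfderiv_extChartAt_comp_mfderivWithin_extChartAt_symm (I := 𝓡 3) hy
  rw [ModelWithCorners.range_eq_univ, mfderivWithin_univ] at this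
  exact this

theorem dSymm_comp_dChart {x : M} {y : E3} (hy : y ∈ (extChartAt (𝓡 3) x).target) :
    (dSymm x y).comp (dChart x ((extChartAt (𝓡 3) x).symm y)) = ContinuousLinearMap.id ℝ E3 := by
  have := mfderivWithin_extChartAt_symm_comp_mfderiv_extChartAt (I := 𝓡 3) hy
  rw [ModelWithCorners.range_eq_univ, mfderivWithin_univ] at this
  exact this

theorem contDiffAt_coordChange {x z : M} {y : E3} (hy : y ∈ (extChartAt (𝓡 3) x).target)
    (hz : (extChartAt (𝓡 3) x).symm y ∈ (extChartAt (𝓡 3) z).source) :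
    ContDiffAt ℝ ∞ (coordChange x z) y := by
  rw [← contMDiffAt_iff_contDiffAt]
  refine ContMDiffAt.comp y (I' := 𝓡 3) ?_ ?_
  · exact contMDiffAt_extChartAt' (by rwa [extChartAt_source] at hz)
  · exact (contMDiffOn_extChartAt_symm x).contMDiffAt (extChartAt_target_mem_nhds' hy)

theorem fderiv_coordChange {x z : M} {y : E3} (hy : y ∈ (extChartAt (𝓡 3) x).target)
    (hz : (extChartAt (𝓡 3) x).symm y ∈ (extChartAt (𝓡 3) z).source) :
    fderiv ℝ (coordChange x z) y =
      (dChart z ((extChartAt (𝓡 3) x).symm y)).comp (dSymm x y) := by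
  rw [← mfderiv_eq_fderiv]
  refine mfderiv_comp y (I' := 𝓡 3) ?_ ?_
  · exact mdifferentiableAt_extChartAt (by rwa [extChartAt_source] at hz)
  · exact ((contMDiffOn_extChartAt_symm (n := ∞) x).contMDiffAt
      (extChartAt_target_mem_nhds' hy)).mdifferentiableAt (by simp)

/-- The points of the target of the chart at `x` that lie over a neighbourhood. -/
theorem eventually_symm_mem {x : M} {y : E3} (hy : y ∈ (extChartAt (𝓡 3) x).target) {U : Set M}
    (hU : U ∈ 𝓝 ((extChartAt (𝓡 3) x).symm y)) :
    ∀ᶠ y' in 𝓝 y, y' ∈ (extChartAt (𝓡 3) x).target ∧ (extChartAt (𝓡 3) x).symm y' ∈ U :=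
  Filter.Eventually.and (extChartAt_target_mem_nhds' hy)
    ((continuousAt_extChartAt_symm'' hy).eventually hU)

theorem alt_comp_comp {k : ℕ} (α : Alt k) (A B : E3 →L[ℝ] E3) :
    (α.compContinuousLinearMap A).compContinuousLinearMap B =
      α.compContinuousLinearMap (A.comp B) := rfl

theorem alt_comp_id {k : ℕ} (α : Alt k) :
    α.compContinuousLinearMap (ContinuousLinearMap.id ℝ E3) = α := rfl

namespace Form
variable {k : ℕ}

/-- A form is recovered from its coordinate expressions. -/
theorem val_eq_rep (α : Form M k) {x : M} {y : E3} (hy : y ∈ (extChartAt (𝓡 3) x).target) :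
    α.val ((extChartAt (𝓡 3) x).symm y) =
      (α.rep x y).compContinuousLinearMap (dChart x ((extChartAt (𝓡 3) x).symm y)) := by
  rw [rep_eq, alt_comp_comp, dSymm_comp_dChart hy, alt_comp_id]

/-- Coordinate expressions in two charts are related by pullback by the coordinate change. -/
theorem rep_coordChange (α : Form M k) {x z : M} {y : E3}
    (hy : y ∈ (extChartAt (𝓡 3) x).target)
    (hz : (extChartAt (𝓡 3) x).symm y ∈ (extChartAt (𝓡 3) z).source) :
    α.rep x y = (α.rep z (coordChange x z y)).compContinuousLinearMap
      (fderiv ℝ (coordChange x z) y) := by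
  rw [fderiv_coordChange hy hz, rep_eq, rep_eq, alt_comp_comp, ← ContinuousLinearMap.comp_assoc]
  have h := (extChartAt (𝓡 3) z).left_inv hz
  have h' := dSymm_comp_dChart ((extChartAt (𝓡 3) z).map_source hz)
  unfold coordChange
  rw [h] at h' ⊢
  rw [h']
  rfl

/-- The coordinate expression of the exterior derivative. -/
theorem rep_d (α : Form M k) {x : M} {y : E3} (hy : y ∈ (extChartAt (𝓡 3) x).target)
    (hα : DifferentiableAt ℝ (α.rep x) y) : α.d.rep x y = extDeriv (α.rep x) y := by
  set q := (extChartAt (𝓡 3) x).symm y with hq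
  have hqs : q ∈ (extChartAt (𝓡 3) q).source := mem_extChartAt_source q
  have hqx : q ∈ (extChartAt (𝓡 3) x).source := symm_mem_source hy
  have hyq : extChartAt (𝓡 3) q q ∈ (extChartAt (𝓡 3) q).target := mem_extChartAt_target q
  have hsq : (extChartAt (𝓡 3) q).symm (extChartAt (𝓡 3) q q) = q := extChartAt_to_inv q
  have hcc : coordChange q x (extChartAt (𝓡 3) q q) = y := by
    rw [coordChange, hsq, hq, (extChartAt (𝓡 3) x).right_inv hy]
  -- The derivative `d` at q is computed in the chart at q, and q moves with y. Near q the
  -- expression in that chart is the pullback of the expression in the fixed chart at x, so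
  -- naturality of `extDeriv` moves the computation to x, where the derivatives of the charts
  -- cancel.
  have hev : α.rep q =ᶠ[𝓝 (extChartAt (𝓡 3) q q)] fun y' =>
      (α.rep x (coordChange q x y')).compContinuousLinearMap (fderiv ℝ (coordChange q x) y') := by
    have hU : (extChartAt (𝓡 3) x).source ∈
        𝓝 ((extChartAt (𝓡 3) q).symm (extChartAt (𝓡 3) q q)) := by
      rw [hsq]; exact (isOpen_extChartAt_source x).mem_nhds hqx
    filter_upwards [eventually_symm_mem hyq hU] with y' h
    exact rep_coordChange α h.1 h.2
  have hsx : (extChartAt (𝓡 3) q).symm (extChartAt (𝓡 3) q q) ∈ (extChartAt (𝓡 3) x).source := by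
    rwa [hsq]
  rw [rep_eq, ← hq, val_d, hev.extDeriv_eq, extDeriv_pullback (r := ∞) (by rwa [hcc])
    (contDiffAt_coordChange hyq hsx) (by simp [ENat.LEInfty.out]), hcc, alt_comp_comp, alt_comp_comp,
    fderiv_coordChange hyq hsx]
  have h1 := dSymm_comp_dChart hyq
  have h2 := dChart_comp_dSymm hy
  rw [hsq] at h1 ⊢
  rw [← hq] at h2
  rw [ContinuousLinearMap.comp_assoc, ← ContinuousLinearMap.comp_assoc (dSymm q _), h1]
  exact congrArg _ h2

end Form

/-! ### Smoothness of families of forms and functions at a point -/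

/-- A family of forms is smooth at `(t, p)`, jointly in the parameter and the point. -/
def Form.SmoothFamilyAt {k : ℕ} (α : ℝ → Form M k) (t : ℝ) (p : M) : Prop :=
  ∀ x : M, p ∈ (extChartAt (𝓡 3) x).source →
    ContDiffAt ℝ ∞ (fun w : ℝ × E3 => (α w.1).rep x w.2) (t, extChartAt (𝓡 3) x p)

/-- A form is smooth at a point. -/
def Form.SmoothAt {k : ℕ} (α : Form M k) (p : M) : Prop :=
  ∀ x : M, p ∈ (extChartAt (𝓡 3) x).source →
    ContDiffAt ℝ ∞ (α.rep x) (extChartAt (𝓡 3) x p)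

/-- A family of functions is smooth at `(t, p)`, jointly in the parameter and the point. -/
def FunSmoothFamilyAt (f : ℝ → M → ℂ) (t : ℝ) (p : M) : Prop :=
  ∀ x : M, p ∈ (extChartAt (𝓡 3) x).source →
    ContDiffAt ℝ ∞ (fun w : ℝ × E3 => f w.1 ((extChartAt (𝓡 3) x).symm w.2))
      (t, extChartAt (𝓡 3) x p)

/-- A function is smooth at a point. -/
def FunSmoothAt (f : M → ℂ) (p : M) : Prop :=
  ∀ x : M, p ∈ (extChartAt (𝓡 3) x).source →
    ContDiffAt ℝ ∞ (fun y : E3 => f ((extChartAt (𝓡 3) x).symm y)) (extChartAt (𝓡 3) x p)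

/-- The product of a function and a form. -/
def Form.fmul {k : ℕ} (f : M → ℂ) (α : Form M k) : Form M k := fun p => f p • α p

/-- The 0-form given by a function. -/
def Form.ofFun (f : M → ℂ) : Form M 0 := fun p =>
  (ContinuousAlternatingMap.constOfIsEmpty ℝ E3 (Fin 0) (f p) : Alt 0)

/-- The differential of a function. -/
def dFun (f : M → ℂ) : Form M 1 := (Form.ofFun f).d

section charts

theorem tendsto_chart_symm {x p : M} (hp : p ∈ (extChartAt (𝓡 3) x).source) (t : ℝ) :
    Tendsto (fun w : ℝ × E3 => (w.1, (extChartAt (𝓡 3) x).symm w.2))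
      (𝓝 (t, extChartAt (𝓡 3) x p)) (𝓝 (t, p)) := by
  have h := continuousAt_extChartAt_symm' hp
  have h2 : Tendsto (extChartAt (𝓡 3) x).symm (𝓝 (extChartAt (𝓡 3) x p)) (𝓝 p) := by
    have := h.tendsto
    rwa [(extChartAt (𝓡 3) x).left_inv hp] at this
  rw [nhds_prod_eq, nhds_prod_eq]
  exact tendsto_fst.prodMk (h2.comp tendsto_snd)

theorem eventually_mem_target {x p : M} (hp : p ∈ (extChartAt (𝓡 3) x).source) :
    ∀ᶠ y in 𝓝 (extChartAt (𝓡 3) x p), y ∈ (extChartAt (𝓡 3) x).target :=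
  extChartAt_target_mem_nhds' ((extChartAt (𝓡 3) x).map_source hp)

theorem eventually_mem_target_prod {x p : M} (hp : p ∈ (extChartAt (𝓡 3) x).source) (t : ℝ) :
    ∀ᶠ w : ℝ × E3 in 𝓝 (t, extChartAt (𝓡 3) x p), w.2 ∈ (extChartAt (𝓡 3) x).target :=
  (continuousAt_snd (p := (t, extChartAt (𝓡 3) x p))).eventually (eventually_mem_target hp)

theorem isOpen_chart_domain (x : M) {W : Set (ℝ × M)} (hW : IsOpen W) :
    IsOpen {z : ℝ × E3 | z.2 ∈ (extChartAt (𝓡 3) x).target ∧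
      (z.1, (extChartAt (𝓡 3) x).symm z.2) ∈ W} := by
  rw [isOpen_iff_mem_nhds]
  rintro ⟨t, y⟩ ⟨hy, hz⟩
  have hs := symm_mem_source hy
  have h1 := eventually_mem_target_prod hs t
  have h2 := tendsto_chart_symm hs t
  rw [(extChartAt (𝓡 3) x).right_inv hy] at h1 h2
  exact h1.and (h2.eventually (hW.mem_nhds hz))

end charts

namespace Form
variable {k : ℕ} {α β : ℝ → Form M k} {t : ℝ} {p : M} {f g : ℝ → M → ℂ}

/-- On an open set, smoothness within the chart domains is smoothness at each point. The pointwise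
notion composes better and is used from here on. -/
theorem smoothFamilyOn_iff {W : Set (ℝ × M)} (hW : IsOpen W) :
    SmoothFamilyOn α W ↔ ∀ z ∈ W, SmoothFamilyAt α z.1 z.2 := by
  constructor
  · rintro h ⟨t, p⟩ hz x hx
    refine (h x).contDiffAt ((isOpen_chart_domain x hW).mem_nhds
      ⟨(extChartAt (𝓡 3) x).map_source hx, ?_⟩)
    simpa only [(extChartAt (𝓡 3) x).left_inv hx] using hz
  · rintro h x ⟨t, y⟩ ⟨hy, hz⟩
    have := h _ hz x (symm_mem_source hy)
    simp only [(extChartAt (𝓡 3) x).right_inv hy] at this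
    exact this.contDiffWithinAt

theorem SmoothFamilyAt.slice (h : SmoothFamilyAt α t p) : SmoothAt (α t) p := fun x hx =>
  ContDiffAt.comp (f := fun y : E3 => (t, y)) (extChartAt (𝓡 3) x p) (h x hx)
    (contDiffAt_const.prodMk contDiffAt_id)

theorem SmoothAt.family {α : Form M k} (h : SmoothAt α p) (t : ℝ) :
    SmoothFamilyAt (fun _ => α) t p := fun x hx =>
  ContDiffAt.comp (f := Prod.snd) (t, extChartAt (𝓡 3) x p) (h x hx) contDiffAt_snd

theorem smoothOn_iff {α : Form M k} {U : Set M} (hU : IsOpen U) :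
    α.SmoothOn U ↔ ∀ p ∈ U, SmoothAt α p := by
  have hopen : ∀ x : M, IsOpen {y | y ∈ (extChartAt (𝓡 3) x).target ∧
      (extChartAt (𝓡 3) x).symm y ∈ U} := by
    intro x
    have := (isOpen_chart_domain x (isOpen_univ (X := ℝ) |>.prod hU)).preimage
      (f := fun y : E3 => ((0 : ℝ), y)) (by fun_prop)
    simpa using this
  constructor
  · intro h p hp x hx
    refine (h x).contDiffAt ((hopen x).mem_nhds ⟨(extChartAt (𝓡 3) x).map_source hx, ?_⟩)
    simpa only [(extChartAt (𝓡 3) x).left_inv hx] using hp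
  · rintro h x y ⟨hy, hz⟩
    have := h _ hz x (symm_mem_source hy)
    simp only [(extChartAt (𝓡 3) x).right_inv hy] at this
    exact this.contDiffWithinAt

theorem SmoothFamilyAt.congr (h : SmoothFamilyAt α t p)
    (he : ∀ᶠ z : ℝ × M in 𝓝 (t, p), (β z.1).val z.2 = (α z.1).val z.2) :
    SmoothFamilyAt β t p := fun x hx => by
  refine (h x hx).congr_of_eventuallyEq ?_
  filter_upwards [(tendsto_chart_symm hx t).eventually he] with w hw
  rw [rep_eq, rep_eq, hw]

theorem SmoothFamilyAt.add (h : SmoothFamilyAt α t p) (h' : SmoothFamilyAt β t p) :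
    SmoothFamilyAt (fun t => α t + β t) t p := fun x hx => (h x hx).add (h' x hx)

theorem SmoothFamilyAt.smul (c : ℂ) (h : SmoothFamilyAt α t p) :
    SmoothFamilyAt (fun t => c • α t) t p := fun x hx => (h x hx).const_smul c

theorem SmoothFamilyAt.neg (h : SmoothFamilyAt α t p) :
    SmoothFamilyAt (fun t => -α t) t p := fun x hx => (h x hx).neg

theorem SmoothFamilyAt.sub (h : SmoothFamilyAt α t p) (h' : SmoothFamilyAt β t p) :
    SmoothFamilyAt (fun t => α t - β t) t p := fun x hx => (h x hx).sub (h' x hx)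

theorem smoothFamilyAt_zero : SmoothFamilyAt (fun _ => (0 : Form M k)) t p := fun _ _ =>
  contDiffAt_const (c := (0 : Alt k))

theorem SmoothFamilyAt.sum {ι : Type*} {s : Finset ι} {α : ι → ℝ → Form M k}
    (h : ∀ i ∈ s, SmoothFamilyAt (α i) t p) : SmoothFamilyAt (fun t => ∑ i ∈ s, α i t) t p := by
  classical
  induction s using Finset.induction_on with
  | empty => simpa using smoothFamilyAt_zero
  | insert a s ha ih =>
    simp only [Finset.sum_insert ha]
    exact (h a (by simp)).add (ih fun i hi => h i (by simp [hi]))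

theorem rep_fmul (f : M → ℂ) (α : Form M k) (x : M) (y : E3) :
    (fmul f α).rep x y = f ((extChartAt (𝓡 3) x).symm y) • α.rep x y := rfl

theorem rep_wedge (α : Form M 1) (β : Form M k) (x : M) (y : E3) :
    (α ⋏ β).rep x y = covWedge (α.rep x y) (β.rep x y) := covWedge_comp _ _ _

theorem SmoothFamilyAt.fmul (hf : FunSmoothFamilyAt f t p) (h : SmoothFamilyAt α t p) :
    SmoothFamilyAt (fun t => Form.fmul (f t) (α t)) t p := fun x hx => (hf x hx).smul (h x hx)

theorem SmoothFamilyAt.wedge {α : ℝ → Form M 1} (h : SmoothFamilyAt α t p)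
    (h' : SmoothFamilyAt β t p) : SmoothFamilyAt (fun t => α t ⋏ β t) t p := fun x hx => by
  have := (covWedgeL k).isBoundedBilinearMap.contDiff.contDiffAt.comp _ ((h x hx).prodMk (h' x hx))
  refine this.congr_of_eventuallyEq (Eventually.of_forall fun w => ?_)
  exact rep_wedge _ _ _ _

theorem smoothFamilyAt_ofFun (hf : FunSmoothFamilyAt f t p) :
    SmoothFamilyAt (fun t => ofFun (f t)) t p := fun x hx =>
  (ContinuousAlternatingMap.constOfIsEmptyLIE ℝ E3 ℂ (Fin 0)).contDiff.contDiffAt.comp _ (hf x hx)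

/-- In a chart, the exterior derivative is the alternation of the partial derivative in the point.
That partial derivative is the total derivative restricted to the second factor, so it is smooth in
the parameter as well. -/
theorem SmoothFamilyAt.d (h : SmoothFamilyAt α t p) : SmoothFamilyAt (fun t => (α t).d) t p := by
  intro x hx
  have hG := h x hx
  set G := fun w : ℝ × E3 => (α w.1).rep x w.2 with hGdef
  have h1 : ContDiffAt ℝ ∞ (fun w => ContinuousAlternatingMap.alternatizeUncurryFinCLM ℝ E3 ℂ
      ((fderiv ℝ G w).comp (ContinuousLinearMap.inr ℝ ℝ E3))) (t, extChartAt (𝓡 3) x p) := by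
    have hL : ContDiff ℝ ∞ (ContinuousAlternatingMap.alternatizeUncurryFinCLM (n := k) ℝ E3 ℂ) :=
      by fun_prop
    refine hL.contDiffAt.comp _ ?_
    exact (hG.fderiv_right (m := ∞) (by simp)).clm_comp contDiffAt_const
  refine h1.congr_of_eventuallyEq ?_
  have hev : ∀ᶠ w in 𝓝 (t, extChartAt (𝓡 3) x p), DifferentiableAt ℝ G w := by
    filter_upwards [(hG.of_le (m := 1) (by simp)).eventually (by simp)] with w hw
    exact hw.differentiableAt (by simp)
  filter_upwards [hev, eventually_mem_target_prod hx t] with w hw hwt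
  have hd : HasFDerivAt (fun y => (α w.1).rep x y)
      ((fderiv ℝ G w).comp (ContinuousLinearMap.inr ℝ ℝ E3)) w.2 := by
    have hi : HasFDerivAt (fun y : E3 => (w.1, y)) (ContinuousLinearMap.inr ℝ ℝ E3) w.2 :=
      hasFDerivAt_prodMk_right w.1 w.2
    exact HasFDerivAt.comp w.2 (f := fun y : E3 => (w.1, y)) (g := G) hw.hasFDerivAt hi
  rw [rep_d _ hwt hd.differentiableAt, extDeriv, hd.fderiv]
  rfl

/-! The case of a form that does not depend on the parameter. -/

theorem SmoothAt.d {α : Form M k} (h : SmoothAt α p) : SmoothAt α.d p :=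
  ((h.family 0).d).slice

theorem SmoothAt.add {α β : Form M k} (h : SmoothAt α p) (h' : SmoothAt β p) :
    SmoothAt (α + β) p := ((h.family 0).add (h'.family 0)).slice

theorem SmoothAt.sub {α β : Form M k} (h : SmoothAt α p) (h' : SmoothAt β p) :
    SmoothAt (α - β) p := ((h.family 0).sub (h'.family 0)).slice

theorem SmoothAt.neg {α : Form M k} (h : SmoothAt α p) : SmoothAt (-α) p :=
  ((h.family 0).neg).slice

theorem SmoothAt.smul {α : Form M k} (c : ℂ) (h : SmoothAt α p) : SmoothAt (c • α) p :=
  ((h.family 0).smul c).slice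

theorem SmoothAt.wedge {α : Form M 1} {β : Form M k} (h : SmoothAt α p) (h' : SmoothAt β p) :
    SmoothAt (α ⋏ β) p := ((h.family 0).wedge (h'.family 0)).slice

theorem SmoothAt.differentiableAt {α : Form M k} (h : SmoothAt α p) :
    DifferentiableAt ℝ (α.rep p) (extChartAt (𝓡 3) p p) :=
  (h p (mem_extChartAt_source p)).differentiableAt (by simp)

end Form

/-! ### Functions -/

section functions
variable {k : ℕ} {t : ℝ} {p : M} {f g : ℝ → M → ℂ}

theorem FunSmoothFamilyAt.slice (h : FunSmoothFamilyAt f t p) : FunSmoothAt (f t) p := fun x hx =>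
  ContDiffAt.comp (f := fun y : E3 => (t, y)) (extChartAt (𝓡 3) x p) (h x hx)
    (contDiffAt_const.prodMk contDiffAt_id)

theorem FunSmoothAt.family {f : M → ℂ} (h : FunSmoothAt f p) (t : ℝ) :
    FunSmoothFamilyAt (fun _ => f) t p := fun x hx =>
  ContDiffAt.comp (f := Prod.snd) (t, extChartAt (𝓡 3) x p) (h x hx) contDiffAt_snd

theorem funSmoothFamilyAt_const (c : ℂ) : FunSmoothFamilyAt (fun _ (_ : M) => c) t p :=
  fun _ _ => contDiffAt_const

theorem funSmoothFamilyAt_param {c : ℝ → ℂ} (hc : ContDiff ℝ ∞ c) :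
    FunSmoothFamilyAt (fun t (_ : M) => c t) t p :=
  fun _ _ => hc.contDiffAt.comp _ contDiffAt_fst

theorem FunSmoothFamilyAt.add (h : FunSmoothFamilyAt f t p) (h' : FunSmoothFamilyAt g t p) :
    FunSmoothFamilyAt (fun t q => f t q + g t q) t p := fun x hx => (h x hx).add (h' x hx)

theorem FunSmoothFamilyAt.sub (h : FunSmoothFamilyAt f t p) (h' : FunSmoothFamilyAt g t p) :
    FunSmoothFamilyAt (fun t q => f t q - g t q) t p := fun x hx => (h x hx).sub (h' x hx)

theorem FunSmoothFamilyAt.neg (h : FunSmoothFamilyAt f t p) :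
    FunSmoothFamilyAt (fun t q => -f t q) t p := fun x hx => (h x hx).neg

theorem FunSmoothFamilyAt.mul (h : FunSmoothFamilyAt f t p) (h' : FunSmoothFamilyAt g t p) :
    FunSmoothFamilyAt (fun t q => f t q * g t q) t p := fun x hx => (h x hx).mul (h' x hx)

theorem FunSmoothFamilyAt.inv (h : FunSmoothFamilyAt f t p) (h0 : f t p ≠ 0) :
    FunSmoothFamilyAt (fun t q => (f t q)⁻¹) t p := fun x hx =>
  (h x hx).inv (by simpa only [(extChartAt (𝓡 3) x).left_inv hx] using h0)

theorem FunSmoothFamilyAt.div (h : FunSmoothFamilyAt f t p) (h' : FunSmoothFamilyAt g t p)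
    (h0 : g t p ≠ 0) : FunSmoothFamilyAt (fun t q => f t q / g t q) t p := by
  simpa only [div_eq_mul_inv] using h.mul (h'.inv h0)

theorem FunSmoothFamilyAt.congr (h : FunSmoothFamilyAt f t p)
    (he : ∀ᶠ z : ℝ × M in 𝓝 (t, p), g z.1 z.2 = f z.1 z.2) : FunSmoothFamilyAt g t p :=
  fun x hx => by
  refine (h x hx).congr_of_eventuallyEq ?_
  filter_upwards [(tendsto_chart_symm hx t).eventually he] with w hw
  exact hw

theorem FunSmoothFamilyAt.continuousAt (h : FunSmoothFamilyAt f t p) :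
    ContinuousAt (fun z : ℝ × M => f z.1 z.2) (t, p) := by
  have hp := mem_extChartAt_source (I := 𝓡 3) p
  have h1 := (h p hp).continuousAt
  have h2 : ContinuousAt (fun z : ℝ × M => (z.1, extChartAt (𝓡 3) p z.2)) (t, p) :=
    continuousAt_fst.prodMk ((continuousAt_extChartAt p).comp (x := (t, p)) continuousAt_snd)
  have h3 := ContinuousAt.comp (x := (t, p)) (f := fun z : ℝ × M => (z.1, extChartAt (𝓡 3) p z.2))
    h1 h2
  refine h3.congr ?_
  filter_upwards [(continuousAt_snd (p := (t, p))).eventually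
    ((isOpen_extChartAt_source (I := 𝓡 3) p).mem_nhds hp)] with z hz
  simp only [Function.comp_apply, (extChartAt (𝓡 3) p).left_inv hz]

theorem FunSmoothFamilyAt.dFun (h : FunSmoothFamilyAt f t p) :
    Form.SmoothFamilyAt (fun t => dFun (f t)) t p := (Form.smoothFamilyAt_ofFun h).d

theorem FunSmoothAt.dFun {f : M → ℂ} (h : FunSmoothAt f p) : (dFun f).SmoothAt p :=
  ((h.family 0).dFun).slice

theorem FunSmoothAt.mul {f g : M → ℂ} (h : FunSmoothAt f p) (h' : FunSmoothAt g p) :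
    FunSmoothAt (fun q => f q * g q) p := ((h.family 0).mul (h'.family 0)).slice

theorem FunSmoothAt.add {f g : M → ℂ} (h : FunSmoothAt f p) (h' : FunSmoothAt g p) :
    FunSmoothAt (fun q => f q + g q) p := ((h.family 0).add (h'.family 0)).slice

theorem FunSmoothAt.neg {f : M → ℂ} (h : FunSmoothAt f p) :
    FunSmoothAt (fun q => -f q) p := ((h.family 0).neg).slice

theorem FunSmoothAt.inv {f : M → ℂ} (h : FunSmoothAt f p) (h0 : f p ≠ 0) :
    FunSmoothAt (fun q => (f q)⁻¹) p := ((h.family 0).inv h0).slice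

theorem FunSmoothAt.fmul' {f : M → ℂ} {α : Form M k} (hf : FunSmoothAt f p) (h : α.SmoothAt p) :
    (Form.fmul f α).SmoothAt p := (Form.SmoothFamilyAt.fmul (hf.family 0) (h.family 0)).slice

theorem FunSmoothFamilyAt.fmul' {α : ℝ → Form M k} (hf : FunSmoothFamilyAt f t p)
    (h : Form.SmoothFamilyAt α t p) : Form.SmoothFamilyAt (fun t => Form.fmul (f t) (α t)) t p :=
  Form.SmoothFamilyAt.fmul hf h

end functions

/-! ### Values of forms and rules for the exterior derivative -/

namespace Form
variable {k : ℕ} {p : M}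

@[simp] theorem val_add (α β : Form M k) (p : M) : (α + β).val p = α.val p + β.val p := rfl
@[simp] theorem val_sub (α β : Form M k) (p : M) : (α - β).val p = α.val p - β.val p := rfl
@[simp] theorem val_neg (α : Form M k) (p : M) : (-α).val p = -α.val p := rfl
@[simp] theorem val_zero (p : M) : (0 : Form M k).val p = 0 := rfl
@[simp] theorem val_smul (c : ℂ) (α : Form M k) (p : M) : (c • α).val p = c • α.val p := rfl
@[simp] theorem val_fmul (f : M → ℂ) (α : Form M k) (p : M) :
    (fmul f α).val p = f p • α.val p := rfl
theorem val_sum {ι : Type*} (s : Finset ι) (α : ι → Form M k) (p : M) :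
    (∑ i ∈ s, α i).val p = ∑ i ∈ s, (α i).val p := by
  classical
  induction s using Finset.induction_on with
  | empty => simp
  | insert a s ha ih => simp only [Finset.sum_insert ha, val_add, ih]

theorem d_congr {α β : Form M k} (h : ∀ᶠ q in 𝓝 p, α.val q = β.val q) :
    α.d.val p = β.d.val p := by
  have : α.rep p =ᶠ[𝓝 (extChartAt (𝓡 3) p p)] β.rep p := by
    have hc := (continuousAt_extChartAt_symm (I := 𝓡 3) p).tendsto
    rw [extChartAt_to_inv] at hc
    filter_upwards [hc.eventually h] with y hy
    rw [rep_eq, rep_eq, hy]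
  rw [val_d, val_d, this.extDeriv_eq]

theorem d_add {α β : Form M k} (h : α.SmoothAt p) (h' : β.SmoothAt p) :
    (α + β).d.val p = α.d.val p + β.d.val p := by
  rw [val_d, val_d, val_d]
  have : (α + β).rep p = α.rep p + β.rep p := rfl
  rw [this, extDeriv_add h.differentiableAt h'.differentiableAt]
  rfl

theorem d_smul (c : ℂ) {α : Form M k} (h : α.SmoothAt p) :
    (c • α).d.val p = c • α.d.val p := by
  rw [val_d, val_d]
  have e : (c • α).rep p = fun y => c • α.rep p y := rfl
  rw [e, extDeriv, fderiv_fun_const_smul h.differentiableAt,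
    ContinuousAlternatingMap.alternatizeUncurryFin_smul]
  rfl

theorem d_neg {α : Form M k} (h : α.SmoothAt p) : (-α).d.val p = -α.d.val p := by
  have := d_smul (-1) h
  have e : (-1 : ℂ) • α = -α := ext_val fun q => by rw [val_smul, val_neg]; module
  rw [e] at this
  rw [this]; module

theorem d_sub {α β : Form M k} (h : α.SmoothAt p) (h' : β.SmoothAt p) :
    (α - β).d.val p = α.d.val p - β.d.val p := by
  rw [sub_eq_add_neg, d_add h h'.neg, d_neg h', sub_eq_add_neg]

theorem d_zero : (0 : Form M k).d.val p = 0 := by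
  have := d_smul (p := p) (α := (0 : Form M k)) 0 (smoothFamilyAt_zero (t := 0)).slice
  have e : (0 : ℂ) • (0 : Form M k) = 0 := ext_val fun q => by rw [val_smul, val_zero]; module
  rw [e] at this
  rw [this]; module

theorem val_dFun (f : M → ℂ) (p : M) : (dFun f).val p =
    (altOf (fderiv ℝ (fun y => f ((extChartAt (𝓡 3) p).symm y))
      (extChartAt (𝓡 3) p p))).compContinuousLinearMap (dChart p p) := by
  rw [dFun, val_d]
  have : (ofFun f).rep p = fun y => ContinuousAlternatingMap.constOfIsEmpty ℝ E3 (Fin 0)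
    (f ((extChartAt (𝓡 3) p).symm y)) := rfl
  rw [this, extDeriv_constOfIsEmpty]

theorem d_fmul {f : M → ℂ} {α : Form M k} (hf : FunSmoothAt f p) (h : α.SmoothAt p) :
    (fmul f α).d.val p = covWedge ((dFun f).val p) (α.val p) + f p • α.d.val p := by
  have e : (fmul f α).rep p = fun y => f ((extChartAt (𝓡 3) p).symm y) • α.rep p y := rfl
  have hf' := (hf p (mem_extChartAt_source p)).differentiableAt (by simp)
  have hα := val_eq_rep α (mem_extChartAt_target (I := 𝓡 3) p)
  rw [val_d, e, extDeriv_funSMul hf' h.differentiableAt, val_d, val_dFun]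
  rw [extChartAt_to_inv] at hα ⊢
  rw [hα, ← covWedge_comp]
  rfl

theorem d_wedge {α β : Form M 1} (h : α.SmoothAt p) (h' : β.SmoothAt p) :
    (α ⋏ β).d.val p = covWedge (β.val p) (α.d.val p) - covWedge (α.val p) (β.d.val p) := by
  have e : (α ⋏ β).rep p = fun y => covWedge (α.rep p y) (β.rep p y) :=
    funext fun y => rep_wedge _ _ _ _
  have hα := val_eq_rep α (mem_extChartAt_target (I := 𝓡 3) p)
  have hβ := val_eq_rep β (mem_extChartAt_target (I := 𝓡 3) p)
  rw [val_d, e, extDeriv_covWedge h.differentiableAt h'.differentiableAt, val_d, val_d]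
  rw [extChartAt_to_inv] at hα hβ
  rw [hα, hβ, ← covWedge_comp, ← covWedge_comp]
  rfl

theorem d_d {α : Form M k} (h : α.SmoothAt p) : α.d.d.val p = 0 := by
  have hc := h p (mem_extChartAt_source p)
  -- The second derivative needs the expression of dα near the point in one fixed chart, although dα
  -- at each nearby point is defined in that point's own chart.
  have hev : α.d.rep p =ᶠ[𝓝 (extChartAt (𝓡 3) p p)] extDeriv (α.rep p) := by
    filter_upwards [(hc.of_le (m := 1) (by simp)).eventually (by simp),
      eventually_mem_target (mem_extChartAt_source p)] with y hy hyt
    exact rep_d α hyt (hy.differentiableAt (by simp))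
  rw [val_d, hev.extDeriv_eq, extDeriv_extDeriv_apply hc (by simp [ENat.LEInfty.out])]
  rfl

theorem d_dFun {f : M → ℂ} (hf : FunSmoothAt f p) : (dFun f).d.val p = 0 :=
  d_d (smoothFamilyAt_ofFun (hf.family 0)).slice

end Form

/-! ### Coefficients with respect to a coframe -/

/-- The wedge product of two 1-forms. -/
def w2 (a b : Alt 1) : Alt 2 := covWedge a b

/-- The wedge product of a 1-form and a 2-form. -/
def w3 (a : Alt 1) (b : Alt 2) : Alt 3 := covWedge a b

@[simp] theorem c2_w2 (α β : Alt 1) (i j : Fin 3) :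
    c2 (w2 α β) i j = c1 α i * c1 β j - c1 α j * c1 β i := c2_covWedge α β i j

@[simp] theorem c3_w3 (α : Alt 1) (β : Alt 2) :
    c3 (w3 α β) = c1 α 0 * c2 β 1 2 - c1 α 1 * c2 β 0 2 + c1 α 2 * c2 β 0 1 := c3_covWedge α β

/-- The coordinate of the wedge product of three 1-forms. -/
def tri (a b c : Alt 1) : ℂ := c3 (w3 a (w2 b c))

/-- The value of the exterior derivative of a 1-form. -/
def dv (α : Form M 1) (p : M) : Alt 2 := α.d.val p

/-- The value of the exterior derivative of a 2-form. -/
def dv₂ (α : Form M 2) (p : M) : Alt 3 := α.d.val p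

section
variable {α β : Form M 1} {η ζ : Form M 2} {p : M}

theorem dv_congr (h : ∀ᶠ q in 𝓝 p, α.val q = β.val q) : dv α p = dv β p := Form.d_congr h
theorem dv_add (h : α.SmoothAt p) (h' : β.SmoothAt p) : dv (α + β) p = dv α p + dv β p :=
  Form.d_add h h'
theorem dv_sub (h : α.SmoothAt p) (h' : β.SmoothAt p) : dv (α - β) p = dv α p - dv β p :=
  Form.d_sub h h'
theorem dv_neg (h : α.SmoothAt p) : dv (-α) p = -dv α p := Form.d_neg h
theorem dv_smul (c : ℂ) (h : α.SmoothAt p) : dv (c • α) p = c • dv α p := Form.d_smul c h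
theorem dv_fmul {f : M → ℂ} (hf : FunSmoothAt f p) (h : α.SmoothAt p) :
    dv (Form.fmul f α) p = w2 ((dFun f).val p) (α.val p) + f p • dv α p := Form.d_fmul hf h
theorem dv_dFun {f : M → ℂ} (hf : FunSmoothAt f p) : dv (dFun f) p = 0 := Form.d_dFun hf

theorem dv₂_congr (h : ∀ᶠ q in 𝓝 p, η.val q = ζ.val q) : dv₂ η p = dv₂ ζ p := Form.d_congr h
theorem dv₂_add (h : η.SmoothAt p) (h' : ζ.SmoothAt p) : dv₂ (η + ζ) p = dv₂ η p + dv₂ ζ p :=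
  Form.d_add h h'
theorem dv₂_sub (h : η.SmoothAt p) (h' : ζ.SmoothAt p) : dv₂ (η - ζ) p = dv₂ η p - dv₂ ζ p :=
  Form.d_sub h h'
theorem dv₂_wedge (h : α.SmoothAt p) (h' : β.SmoothAt p) :
    dv₂ (α ⋏ β) p = w3 (β.val p) (dv α p) - w3 (α.val p) (dv β p) := Form.d_wedge h h'
theorem dv₂_d (h : α.SmoothAt p) : dv₂ α.d p = 0 := Form.d_d h

end

/-- Cramer's rule. -/
theorem alt1_decomp {a b c : Alt 1} (h : tri a b c ≠ 0) (α : Alt 1) :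
    α = (tri α b c / tri a b c) • a + (tri a α c / tri a b c) • b +
      (tri a b α / tri a b c) • c := by
  refine alt1_ext fun i => ?_
  simp only [c1_add, c1_smul]
  have : c1 α i * tri a b c = tri α b c * c1 a i + tri a α c * c1 b i + tri a b α * c1 c i := by
    simp only [tri, c3_w3, c2_w2]
    fin_cases i <;> (simp only [Fin.zero_eta, Fin.mk_one, Fin.reduceFinMk]; ring)
  field_simp
  linear_combination this

/-- The wedge products with a, b, c are three linear functionals on 2-forms. They are independent
when a, b, c are, and the 2 × 2 minors below invert the system. -/
theorem alt2_ext_of_tri {a b c : Alt 1} (h : tri a b c ≠ 0) {β γ : Alt 2}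
    (ha : c3 (w3 a β) = c3 (w3 a γ)) (hb : c3 (w3 b β) = c3 (w3 b γ))
    (hc : c3 (w3 c β) = c3 (w3 c γ)) : β = γ := by
  rw [c3_w3, c3_w3] at ha hb hc
  have key : ∀ x : ℂ, tri a b c * x = 0 → x = 0 := fun x hx => (mul_eq_zero.1 hx).resolve_left h
  simp only [tri, c3_w3, c2_w2] at key
  apply alt2_ext
  · refine sub_eq_zero.1 (key _ ?_)
    linear_combination (c1 b 0 * c1 c 1 - c1 b 1 * c1 c 0) * ha -
      (c1 a 0 * c1 c 1 - c1 a 1 * c1 c 0) * hb + (c1 a 0 * c1 b 1 - c1 a 1 * c1 b 0) * hc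
  · refine sub_eq_zero.1 (key _ ?_)
    linear_combination (c1 b 0 * c1 c 2 - c1 b 2 * c1 c 0) * ha -
      (c1 a 0 * c1 c 2 - c1 a 2 * c1 c 0) * hb + (c1 a 0 * c1 b 2 - c1 a 2 * c1 b 0) * hc
  · refine sub_eq_zero.1 (key _ ?_)
    linear_combination (c1 b 1 * c1 c 2 - c1 b 2 * c1 c 1) * ha -
      (c1 a 1 * c1 c 2 - c1 a 2 * c1 c 1) * hb + (c1 a 1 * c1 b 2 - c1 a 2 * c1 b 1) * hc

/-- The quotient of two 3-forms. -/
def formRatio (A B : Form M 3) (p : M) : ℂ := c3 (A.val p) / c3 (B.val p)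

theorem c3_rep (A : Form M 3) (x : M) (y : E3) :
    c3 (A.rep x y) = ((dSymm x y).det : ℂ) * c3 (A.val ((extChartAt (𝓡 3) x).symm y)) :=
  c3_comp _ _

theorem det_dSymm_ne_zero {x : M} {y : E3} (hy : y ∈ (extChartAt (𝓡 3) x).target) :
    (dSymm x y).det ≠ 0 := by
  have h := congrArg ContinuousLinearMap.det (dChart_comp_dSymm hy)
  have h1 : ((dChart x ((extChartAt (𝓡 3) x).symm y)).comp (dSymm x y)).det =
      (dChart x ((extChartAt (𝓡 3) x).symm y)).det * (dSymm x y).det := by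
    simp only [ContinuousLinearMap.det, ContinuousLinearMap.toLinearMap_comp, LinearMap.det_comp]
  have h2 : (ContinuousLinearMap.id ℝ E3).det = 1 := by
    simp [ContinuousLinearMap.det]
  rw [h1, h2] at h
  exact right_ne_zero_of_mul_eq_one h

/-- Taking the coordinate of a 3-form, as a continuous linear map. -/
theorem contDiff_c3 : ContDiff ℝ ∞ (c3 : Alt 3 → ℂ) :=
  (ContinuousAlternatingMap.apply ℝ E3 ℂ (fun i => stdE i)).contDiff

/-- The number `c3 (A.val p)` refers to the identification of the tangent space at p with the model,
which need not vary continuously with p. In a fixed chart the numerator and the denominator acquire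
the same Jacobian factor, so their quotient is the quotient of smooth coordinates. -/
theorem funSmoothFamilyAt_formRatio {A B : ℝ → Form M 3} {t : ℝ} {p : M}
    (hA : Form.SmoothFamilyAt A t p) (hB : Form.SmoothFamilyAt B t p)
    (h0 : c3 ((B t).val p) ≠ 0) :
    FunSmoothFamilyAt (fun t => formRatio (A t) (B t)) t p := fun x hx => by
  have h1 : ContDiffAt ℝ ∞ (fun w : ℝ × E3 => c3 ((A w.1).rep x w.2) / c3 ((B w.1).rep x w.2))
      (t, extChartAt (𝓡 3) x p) := by
    have hA' := contDiff_c3.contDiffAt.comp _ (hA x hx)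
    have hB' := contDiff_c3.contDiffAt.comp _ (hB x hx)
    refine hA'.mul (ContDiffAt.inv hB' ?_) |>.congr_of_eventuallyEq
      (Eventually.of_forall fun w => div_eq_mul_inv _ _)
    simp only [Function.comp_apply]
    rw [c3_rep, (extChartAt (𝓡 3) x).left_inv hx]
    exact mul_ne_zero (by exact_mod_cast det_dSymm_ne_zero ((extChartAt (𝓡 3) x).map_source hx)) h0
  refine h1.congr_of_eventuallyEq ?_
  filter_upwards [eventually_mem_target_prod hx t] with w hw
  rw [c3_rep, c3_rep, formRatio, mul_div_mul_left]
  exact_mod_cast det_dSymm_ne_zero hw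

namespace Coframe

/-- The volume form of a coframe. -/
def vol (s : Coframe M) : Form M 3 := s.θ ⋏ s.θ₁ ⋏ s.θ₂

/-- The coefficient of `θ` in a 1-form. -/
def coef (s : Coframe M) (α : Form M 1) : M → ℂ := formRatio (α ⋏ s.θ₁ ⋏ s.θ₂) s.vol
/-- The coefficient of `θ₁` in a 1-form. -/
def coef₁ (s : Coframe M) (α : Form M 1) : M → ℂ := formRatio (s.θ ⋏ α ⋏ s.θ₂) s.vol
/-- The coefficient of `θ₂` in a 1-form. -/
def coef₂ (s : Coframe M) (α : Form M 1) : M → ℂ := formRatio (s.θ ⋏ s.θ₁ ⋏ α) s.vol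
/-- The coefficient of `θ₁ ∧ θ₂` in a 2-form. -/
def coef₁₂ (s : Coframe M) (β : Form M 2) : M → ℂ := formRatio (s.θ ⋏ β) s.vol
/-- The coefficient of `θ ∧ θ₁` in a 2-form. -/
def coef₀₁ (s : Coframe M) (β : Form M 2) : M → ℂ := formRatio (s.θ₂ ⋏ β) s.vol
/-- The coefficient of `θ ∧ θ₂` in a 2-form. -/
def coef₀₂ (s : Coframe M) (β : Form M 2) : M → ℂ := formRatio (-(s.θ₁ ⋏ β)) s.vol

/-- The forms of a family of coframes are smooth at `(t, p)`. -/
structure SmoothFamilyAt (s : ℝ → Coframe M) (t : ℝ) (p : M) : Prop where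
  θ : Form.SmoothFamilyAt (fun t => (s t).θ) t p
  θ₁ : Form.SmoothFamilyAt (fun t => (s t).θ₁) t p
  θ₂ : Form.SmoothFamilyAt (fun t => (s t).θ₂) t p
  φ : Form.SmoothFamilyAt (fun t => (s t).φ) t p

/-- The forms of a coframe are smooth at `p`. -/
structure SmoothAt (s : Coframe M) (p : M) : Prop where
  θ : s.θ.SmoothAt p
  θ₁ : s.θ₁.SmoothAt p
  θ₂ : s.θ₂.SmoothAt p
  φ : s.φ.SmoothAt p

theorem SmoothFamilyAt.slice {s : ℝ → Coframe M} {t : ℝ} {p : M} (h : SmoothFamilyAt s t p) :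
    SmoothAt (s t) p := ⟨h.θ.slice, h.θ₁.slice, h.θ₂.slice, h.φ.slice⟩

theorem SmoothAt.family {s : Coframe M} {p : M} (h : SmoothAt s p) (t : ℝ) :
    SmoothFamilyAt (fun _ => s) t p := ⟨h.θ.family t, h.θ₁.family t, h.θ₂.family t, h.φ.family t⟩

/-- The three 1-forms of a coframe are independent at `p` and satisfy the structure equation. -/
structure FramedAt (s : Coframe M) (p : M) : Prop where
  vol_ne : tri (s.θ.val p) (s.θ₁.val p) (s.θ₂.val p) ≠ 0
  d_θ : dv s.θ p = w2 (s.θ.val p) (s.φ.val p) + w2 (s.θ₁.val p) (s.θ₂.val p)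

section smooth
variable {s : ℝ → Coframe M} {t : ℝ} {p : M} (hs : SmoothFamilyAt s t p)
  (hv : c3 ((s t).vol.val p) ≠ 0)
include hs

theorem SmoothFamilyAt.vol : Form.SmoothFamilyAt (fun t => (s t).vol) t p :=
  hs.θ.wedge (hs.θ₁.wedge hs.θ₂)

include hv

variable {α : ℝ → Form M 1} {β : ℝ → Form M 2}

theorem SmoothFamilyAt.coef (hα : Form.SmoothFamilyAt α t p) :
    FunSmoothFamilyAt (fun t => (s t).coef (α t)) t p :=
  funSmoothFamilyAt_formRatio (hα.wedge (hs.θ₁.wedge hs.θ₂)) hs.vol hv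

theorem SmoothFamilyAt.coef₁ (hα : Form.SmoothFamilyAt α t p) :
    FunSmoothFamilyAt (fun t => (s t).coef₁ (α t)) t p :=
  funSmoothFamilyAt_formRatio (hs.θ.wedge (hα.wedge hs.θ₂)) hs.vol hv

theorem SmoothFamilyAt.coef₂ (hα : Form.SmoothFamilyAt α t p) :
    FunSmoothFamilyAt (fun t => (s t).coef₂ (α t)) t p :=
  funSmoothFamilyAt_formRatio (hs.θ.wedge (hs.θ₁.wedge hα)) hs.vol hv

theorem SmoothFamilyAt.coef₁₂ (hβ : Form.SmoothFamilyAt β t p) :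
    FunSmoothFamilyAt (fun t => (s t).coef₁₂ (β t)) t p :=
  funSmoothFamilyAt_formRatio (hs.θ.wedge hβ) hs.vol hv

theorem SmoothFamilyAt.coef₀₁ (hβ : Form.SmoothFamilyAt β t p) :
    FunSmoothFamilyAt (fun t => (s t).coef₀₁ (β t)) t p :=
  funSmoothFamilyAt_formRatio (hs.θ₂.wedge hβ) hs.vol hv

theorem SmoothFamilyAt.coef₀₂ (hβ : Form.SmoothFamilyAt β t p) :
    FunSmoothFamilyAt (fun t => (s t).coef₀₂ (β t)) t p :=
  funSmoothFamilyAt_formRatio (hs.θ₁.wedge hβ).neg hs.vol hv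

end smooth

section decomp
variable {s : Coframe M} {p : M}

theorem c3_val_vol : c3 (s.vol.val p) = tri (s.θ.val p) (s.θ₁.val p) (s.θ₂.val p) := rfl

variable (hv : tri (s.θ.val p) (s.θ₁.val p) (s.θ₂.val p) ≠ 0)
include hv

theorem decomp (α : Form M 1) : α.val p = s.coef α p • s.θ.val p + s.coef₁ α p • s.θ₁.val p +
    s.coef₂ α p • s.θ₂.val p := alt1_decomp hv _

theorem coef₁₂_mul (β : Form M 2) : s.coef₁₂ β p * tri (s.θ.val p) (s.θ₁.val p) (s.θ₂.val p) =
    c3 (w3 (s.θ.val p) (β.val p)) := div_mul_cancel₀ _ hv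

theorem coef₀₁_mul (β : Form M 2) : s.coef₀₁ β p * tri (s.θ.val p) (s.θ₁.val p) (s.θ₂.val p) =
    c3 (w3 (s.θ₂.val p) (β.val p)) := div_mul_cancel₀ _ hv

theorem coef₀₂_mul (β : Form M 2) : s.coef₀₂ β p * tri (s.θ.val p) (s.θ₁.val p) (s.θ₂.val p) =
    -c3 (w3 (s.θ₁.val p) (β.val p)) := div_mul_cancel₀ _ hv

/-- Each coefficient is read off by wedging with the complementary 1-form. As θ₂ ∧ θ ∧ θ₁ is the
volume form and θ₁ ∧ θ ∧ θ₂ is its negative, only the coefficient of θ ∧ θ₂ carries a sign. -/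
theorem decomp₂ (β : Form M 2) : β.val p = s.coef₁₂ β p • w2 (s.θ₁.val p) (s.θ₂.val p) +
    s.coef₀₁ β p • w2 (s.θ.val p) (s.θ₁.val p) +
    s.coef₀₂ β p • w2 (s.θ.val p) (s.θ₂.val p) := by
  have h1 := coef₁₂_mul hv β
  have h2 := coef₀₁_mul hv β
  have h3 := coef₀₂_mul hv β
  refine alt2_ext_of_tri hv ?_ ?_ ?_
  · rw [← h1]; simp only [tri, c3_w3, c2_w2, c2_add, c2_smul]; ring
  · rw [← neg_eq_iff_eq_neg.2 h3]; simp only [tri, c3_w3, c2_w2, c2_add, c2_smul]; ring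
  · rw [← h2]; simp only [tri, c3_w3, c2_w2, c2_add, c2_smul]; ring

end decomp

end Coframe

/-! ### Existence of the adapted connection -/

namespace Coframe

/-- The forms of a family of connections are smooth at `(t, p)`. -/
structure _root_.FlagGeometry.ConnectionForms.SmoothFamilyAt
    (c : ℝ → ConnectionForms M) (t : ℝ) (p : M) : Prop where
  ω₁₁ : Form.SmoothFamilyAt (fun t => (c t).ω₁₁) t p
  φ₁ : Form.SmoothFamilyAt (fun t => (c t).φ₁) t p
  φ₂ : Form.SmoothFamilyAt (fun t => (c t).φ₂) t p
  ψ : Form.SmoothFamilyAt (fun t => (c t).ψ) t p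

/-- The forms of a connection are smooth at `p`. -/
structure _root_.FlagGeometry.ConnectionForms.SmoothAt (c : ConnectionForms M) (p : M) : Prop where
  ω₁₁ : c.ω₁₁.SmoothAt p
  φ₁ : c.φ₁.SmoothAt p
  φ₂ : c.φ₂.SmoothAt p
  ψ : c.ψ.SmoothAt p

/-- The structure equations of the adapted connection at a point. -/
structure AdaptedAt (s : Coframe M) (c : ConnectionForms M) (p : M) : Prop where
  d_θ₁ : dv s.θ₁ p = w2 ((1 / 2 : ℂ) • s.θ₁.val p) (s.φ.val p) +
    w2 (s.θ₁.val p) (c.ω₁₁.val p) + w2 (s.θ.val p) (c.φ₁.val p)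
  d_θ₂ : dv s.θ₂ p = w2 ((1 / 2 : ℂ) • s.θ₂.val p) (s.φ.val p) -
    w2 (s.θ₂.val p) (c.ω₁₁.val p) + w2 (s.θ.val p) (c.φ₂.val p)
  d_φ : dv s.φ p = w2 (s.θ₁.val p) (c.φ₂.val p) - w2 (s.θ₂.val p) (c.φ₁.val p) +
    w2 (s.θ.val p) (c.ψ.val p)
  d_ω₁₁ : dv c.ω₁₁ p = w2 ((3 / 2 : ℂ) • s.θ₂.val p) (c.φ₁.val p) +
    w2 ((3 / 2 : ℂ) • s.θ₁.val p) (c.φ₂.val p)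
  d_φ₁ : ∃ q : ℂ, dv c.φ₁ p - w2 (c.φ₁.val p) (c.ω₁₁.val p) -
    w2 ((1 / 2 : ℂ) • s.θ₁.val p) (c.ψ.val p) - w2 ((1 / 2 : ℂ) • s.φ.val p) (c.φ₁.val p) =
      q • w2 (s.θ.val p) (s.θ₂.val p)

theorem _root_.FlagGeometry.ConnectionForms.SmoothFamilyAt.slice {c : ℝ → ConnectionForms M}
    {t : ℝ} {p : M} (h : ConnectionForms.SmoothFamilyAt c t p) : (c t).SmoothAt p :=
  ⟨h.ω₁₁.slice, h.φ₁.slice, h.φ₂.slice, h.ψ.slice⟩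

open Form

/-! ### Explicit formulas for the adapted connection -/

section construction
variable (s : Coframe M)

/-- The torsion of `θ₁`. -/
def tor₁ : Form M 2 := s.θ₁.d - ((1 / 2 : ℂ) • s.θ₁) ⋏ s.φ
/-- The torsion of `θ₂`. -/
def tor₂ : Form M 2 := s.θ₂.d - ((1 / 2 : ℂ) • s.θ₂) ⋏ s.φ
/-- The part of `ω₁¹` in the span of `θ₁` and `θ₂`. -/
def preω : Form M 1 := fmul (s.coef₁₂ s.tor₂) s.θ₁ + fmul (s.coef₁₂ s.tor₁) s.θ₂
/-- The coefficient of `θ` in `ω₁¹`. -/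
def ωcoef : M → ℂ := fun p => (1 / 4) * ((3 / 2) * (s.coef₀₂ s.tor₂ p - s.coef₀₁ s.tor₁ p) -
  s.coef₁₂ s.preω.d p)
/-- The form `ω₁¹` of the adapted connection. -/
def adω : Form M 1 := fmul s.ωcoef s.θ + s.preω
/-- The coefficient of `θ` in `φ¹`. -/
def φ₁coef : M → ℂ := fun p => -(2 / 3) * s.coef₀₂ s.adω.d p
/-- The coefficient of `θ` in `φ²`. -/
def φ₂coef : M → ℂ := fun p => -(2 / 3) * s.coef₀₁ s.adω.d p
/-- The form `φ¹` of the adapted connection. -/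
def adφ₁ : Form M 1 := fmul (fun p => s.coef₀₁ s.tor₁ p + s.ωcoef p) s.θ₁ +
  fmul (s.coef₀₂ s.tor₁) s.θ₂ + fmul s.φ₁coef s.θ
/-- The form `φ²` of the adapted connection. -/
def adφ₂ : Form M 1 := fmul (s.coef₀₁ s.tor₂) s.θ₁ +
  fmul (fun p => s.coef₀₂ s.tor₂ p - s.ωcoef p) s.θ₂ + fmul s.φ₂coef s.θ
/-- The part of `ψ` in the span of `θ₁` and `θ₂`. -/
def preψ : Form M 1 := fmul (fun p => s.coef₀₁ s.φ.d p + s.φ₂coef p) s.θ₁ +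
  fmul (fun p => s.coef₀₂ s.φ.d p - s.φ₁coef p) s.θ₂
/-- The curvature of `φ¹` before normalization. -/
def preΦ₁ : Form M 2 := s.adφ₁.d - s.adφ₁ ⋏ s.adω - ((1 / 2 : ℂ) • s.θ₁) ⋏ s.preψ -
  ((1 / 2 : ℂ) • s.φ) ⋏ s.adφ₁
/-- The form `ψ` of the adapted connection. -/
def adψ : Form M 1 := fmul (fun p => -2 * s.coef₀₁ s.preΦ₁ p) s.θ + s.preψ

/-- The adapted connection of a coframe. -/
def adapted : ConnectionForms M := ⟨s.adω, s.adφ₁, s.adφ₂, s.adψ⟩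

end construction

section smooth
variable {s : ℝ → Coframe M} {t : ℝ} {p : M}

/-- The formulas use only exterior derivatives, wedge products and coefficients with respect to the
coframe, each of which preserves joint smoothness. -/
theorem SmoothFamilyAt.adapted (hs : SmoothFamilyAt s t p) (hv : c3 ((s t).vol.val p) ≠ 0) :
    ConnectionForms.SmoothFamilyAt (fun t => (s t).adapted) t p := by
  have c := fun z : ℂ => funSmoothFamilyAt_const (M := M) (t := t) (p := p) z
  have t₁ : Form.SmoothFamilyAt (fun t => (s t).tor₁) t p :=
    hs.θ₁.d.sub ((hs.θ₁.smul _).wedge hs.φ)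
  have t₂ : Form.SmoothFamilyAt (fun t => (s t).tor₂) t p :=
    hs.θ₂.d.sub ((hs.θ₂.smul _).wedge hs.φ)
  have pω : Form.SmoothFamilyAt (fun t => (s t).preω) t p :=
    ((hs.coef₁₂ hv t₂).fmul' hs.θ₁).add ((hs.coef₁₂ hv t₁).fmul' hs.θ₂)
  have a : FunSmoothFamilyAt (fun t => (s t).ωcoef) t p :=
    (c (1 / 4)).mul (((c (3 / 2)).mul ((hs.coef₀₂ hv t₂).sub (hs.coef₀₁ hv t₁))).sub
      (hs.coef₁₂ hv pω.d))
  have hω : Form.SmoothFamilyAt (fun t => (s t).adω) t p := (a.fmul' hs.θ).add pω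
  have x : FunSmoothFamilyAt (fun t => (s t).φ₁coef) t p :=
    (c (-(2 / 3))).mul (hs.coef₀₂ hv hω.d)
  have y : FunSmoothFamilyAt (fun t => (s t).φ₂coef) t p :=
    (c (-(2 / 3))).mul (hs.coef₀₁ hv hω.d)
  have φ₁ : Form.SmoothFamilyAt (fun t => (s t).adφ₁) t p :=
    ((((hs.coef₀₁ hv t₁).add a).fmul' hs.θ₁).add ((hs.coef₀₂ hv t₁).fmul' hs.θ₂)).add
      (x.fmul' hs.θ)
  have φ₂ : Form.SmoothFamilyAt (fun t => (s t).adφ₂) t p :=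
    (((hs.coef₀₁ hv t₂).fmul' hs.θ₁).add (((hs.coef₀₂ hv t₂).sub a).fmul' hs.θ₂)).add
      (y.fmul' hs.θ)
  have pψ : Form.SmoothFamilyAt (fun t => (s t).preψ) t p :=
    (((hs.coef₀₁ hv hs.φ.d).add y).fmul' hs.θ₁).add
      (((hs.coef₀₂ hv hs.φ.d).sub x).fmul' hs.θ₂)
  have N : Form.SmoothFamilyAt (fun t => (s t).preΦ₁) t p :=
    ((φ₁.d.sub (φ₁.wedge hω)).sub ((hs.θ₁.smul _).wedge pψ)).sub ((hs.φ.smul _).wedge φ₁)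
  exact ⟨hω, φ₁, φ₂, (((c (-2)).mul (hs.coef₀₁ hv N)).fmul' hs.θ).add pψ⟩

end smooth

/-! ### The identities d² = 0 for the forms of the coframe -/

section bianchi
variable {s : Coframe M} {c : ConnectionForms M} {p : M}

/-- This relation supplies the θ₁ ∧ θ₂ component of the equation for dφ, where no unknown is left to
adjust. -/
theorem dd_θ (hs : s.SmoothAt p) (h : ∀ᶠ q in 𝓝 p, s.FramedAt q) :
    w3 (s.φ.val p) (dv s.θ p) - w3 (s.θ.val p) (dv s.φ p) +
      (w3 (s.θ₂.val p) (dv s.θ₁ p) - w3 (s.θ₁.val p) (dv s.θ₂ p)) = 0 := by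
  rw [← dv₂_d hs.θ, ← dv₂_wedge hs.θ hs.φ, ← dv₂_wedge hs.θ₁ hs.θ₂,
    ← dv₂_add (hs.θ.wedge hs.φ) (hs.θ₁.wedge hs.θ₂)]
  exact (dv₂_congr (h.mono fun q hq => hq.d_θ)).symm

theorem dd_θ₁ (hs : s.SmoothAt p) (hc : c.SmoothAt p) (h : ∀ᶠ q in 𝓝 p,
      dv s.θ₁ q = w2 ((1 / 2 : ℂ) • s.θ₁.val q) (s.φ.val q) +
        w2 (s.θ₁.val q) (c.ω₁₁.val q) + w2 (s.θ.val q) (c.φ₁.val q)) :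
    (w3 (s.φ.val p) ((1 / 2 : ℂ) • dv s.θ₁ p) - w3 ((1 / 2 : ℂ) • s.θ₁.val p) (dv s.φ p)) +
      (w3 (c.ω₁₁.val p) (dv s.θ₁ p) - w3 (s.θ₁.val p) (dv c.ω₁₁ p)) +
      (w3 (c.φ₁.val p) (dv s.θ p) - w3 (s.θ.val p) (dv c.φ₁ p)) = 0 := by
  have e := dv₂_wedge (hs.θ₁.smul (1 / 2 : ℂ)) hs.φ
  rw [dv_smul _ hs.θ₁] at e
  rw [← dv₂_d hs.θ₁, ← dv₂_wedge hs.θ hc.φ₁, ← dv₂_wedge hs.θ₁ hc.ω₁₁, ← val_smul, ← e,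
    ← dv₂_add ((hs.θ₁.smul _).wedge hs.φ) (hs.θ₁.wedge hc.ω₁₁),
    ← dv₂_add (((hs.θ₁.smul _).wedge hs.φ).add (hs.θ₁.wedge hc.ω₁₁)) (hs.θ.wedge hc.φ₁)]
  exact (dv₂_congr h).symm

theorem dd_θ₂ (hs : s.SmoothAt p) (hc : c.SmoothAt p) (h : ∀ᶠ q in 𝓝 p,
      dv s.θ₂ q = w2 ((1 / 2 : ℂ) • s.θ₂.val q) (s.φ.val q) -
        w2 (s.θ₂.val q) (c.ω₁₁.val q) + w2 (s.θ.val q) (c.φ₂.val q)) :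
    (w3 (s.φ.val p) ((1 / 2 : ℂ) • dv s.θ₂ p) - w3 ((1 / 2 : ℂ) • s.θ₂.val p) (dv s.φ p)) -
      (w3 (c.ω₁₁.val p) (dv s.θ₂ p) - w3 (s.θ₂.val p) (dv c.ω₁₁ p)) +
      (w3 (c.φ₂.val p) (dv s.θ p) - w3 (s.θ.val p) (dv c.φ₂ p)) = 0 := by
  have e := dv₂_wedge (hs.θ₂.smul (1 / 2 : ℂ)) hs.φ
  rw [dv_smul _ hs.θ₂] at e
  rw [← dv₂_d hs.θ₂, ← dv₂_wedge hs.θ hc.φ₂, ← dv₂_wedge hs.θ₂ hc.ω₁₁, ← val_smul, ← e,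
    ← dv₂_sub ((hs.θ₂.smul _).wedge hs.φ) (hs.θ₂.wedge hc.ω₁₁),
    ← dv₂_add (((hs.θ₂.smul _).wedge hs.φ).sub (hs.θ₂.wedge hc.ω₁₁)) (hs.θ.wedge hc.φ₂)]
  exact (dv₂_congr h).symm

end bianchi

/-! ### Existence of the adapted connection of a framed coframe -/

section existence
variable {s : Coframe M} {p : M}

/-- The θ₁ ∧ θ₂ part of the torsion of `θ₁` is the θ₂ coefficient of ω₁¹, and the parts containing θ
fix φ¹ modulo θ. The coefficient a of θ in ω₁¹ contributes -a θ ∧ θ₁ through θ₁ ∧ ω₁¹, and the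
summand a in the θ₁ coefficient of φ¹ compensates for it. At this stage a is still free. -/
theorem adapted_d_θ₁ (h : s.FramedAt p) :
    dv s.θ₁ p = w2 ((1 / 2 : ℂ) • s.θ₁.val p) (s.φ.val p) +
      w2 (s.θ₁.val p) (s.adω.val p) + w2 (s.θ.val p) (s.adφ₁.val p) := by
  have h1 := decomp₂ h.vol_ne s.tor₁
  have h2 : s.tor₁.val p = dv s.θ₁ p - w2 ((1 / 2 : ℂ) • s.θ₁.val p) (s.φ.val p) := rfl
  rw [sub_eq_iff_eq_add.1 (h2.symm.trans h1)]
  apply alt2_ext <;> simp [adω, preω, adφ₁] <;> ring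

theorem adapted_d_θ₂ (h : s.FramedAt p) :
    dv s.θ₂ p = w2 ((1 / 2 : ℂ) • s.θ₂.val p) (s.φ.val p) -
      w2 (s.θ₂.val p) (s.adω.val p) + w2 (s.θ.val p) (s.adφ₂.val p) := by
  have h1 := decomp₂ h.vol_ne s.tor₂
  have h2 : s.tor₂.val p = dv s.θ₂ p - w2 ((1 / 2 : ℂ) • s.θ₂.val p) (s.φ.val p) := rfl
  rw [sub_eq_iff_eq_add.1 (h2.symm.trans h1)]
  apply alt2_ext <;> simp [adω, preω, adφ₂] <;> ring

/-- The three components of this equation determine the three remaining coefficients: its θ₁ ∧ θ₂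
part determines the coefficient of θ in ω₁¹, and its θ ∧ θ₂ and θ ∧ θ₁ parts determine those of θ in
φ¹ and φ². The factor 2/3 in the latter inverts the 3/2 of the equation. -/
theorem adapted_d_ω (hs : s.SmoothAt p) (h : ∀ᶠ q in 𝓝 p, s.FramedAt q) :
    dv s.adω p = w2 ((3 / 2 : ℂ) • s.θ₂.val p) (s.adφ₁.val p) +
      w2 ((3 / 2 : ℂ) • s.θ₁.val p) (s.adφ₂.val p) := by
  have hp := h.self_of_nhds
  have hv := hp.vol_ne
  have pωs : s.preω.SmoothAt p := by
    have t₁ : s.tor₁.SmoothAt p := hs.θ₁.d.sub ((hs.θ₁.smul _).wedge hs.φ)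
    have t₂ : s.tor₂.SmoothAt p := hs.θ₂.d.sub ((hs.θ₂.smul _).wedge hs.φ)
    exact (((hs.family 0).coef₁₂ hv (t₂.family 0)).slice.fmul' hs.θ₁).add
      (((hs.family 0).coef₁₂ hv (t₁.family 0)).slice.fmul' hs.θ₂)
  have as : FunSmoothAt s.ωcoef p := by
    have t₁ : s.tor₁.SmoothAt p := hs.θ₁.d.sub ((hs.θ₁.smul _).wedge hs.φ)
    have t₂ : s.tor₂.SmoothAt p := hs.θ₂.d.sub ((hs.θ₂.smul _).wedge hs.φ)
    exact ((funSmoothFamilyAt_const (1 / 4)).mul (((funSmoothFamilyAt_const (3 / 2)).mul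
      (((hs.family 0).coef₀₂ hv (t₂.family 0)).sub ((hs.family 0).coef₀₁ hv (t₁.family 0)))).sub
      ((hs.family 0).coef₁₂ hv (pωs.d.family 0)))).slice
  refine alt2_ext_of_tri hv ?_ ?_ ?_
  · have k := coef₁₂_mul hv s.preω.d
    have k' : s.preω.d.val p = dv s.preω p := rfl
    -- If a is the coefficient of θ in ω₁¹, the θ₁ ∧ θ₂ part of dω₁¹ contains a from a dθ. The right
    -- side contains -3a, one half of it from each of φ¹ and φ². Together they give 4a.
    have ka : 4 * s.ωcoef p = (3 / 2) * (s.coef₀₂ s.tor₂ p - s.coef₀₁ s.tor₁ p) -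
      s.coef₁₂ s.preω.d p := by rw [ωcoef]; ring
    rw [k'] at k
    rw [adω, dv_add (as.fmul' hs.θ) pωs, dv_fmul as hs.θ, hp.d_θ]
    simp only [tri, adφ₁, adφ₂, c3_w3, c2_w2, c2_add, c2_smul, val_add, val_fmul, c1_add,
      c1_smul] at k ⊢
    have kT := congrArg (fun z => tri (s.θ.val p) (s.θ₁.val p) (s.θ₂.val p) * z) ka
    simp only [tri, c3_w3, c2_w2] at kT
    linear_combination -k + kT
  · have k := coef₀₂_mul hv s.adω.d
    have k' : s.adω.d.val p = dv s.adω p := rfl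
    rw [k'] at k
    rw [← neg_eq_iff_eq_neg.2 k]
    simp only [tri, adφ₁, adφ₂, φ₁coef, c3_w3, c2_w2, c2_add, c1_smul, val_add, val_fmul, c1_add]
    ring
  · have k := coef₀₁_mul hv s.adω.d
    have k' : s.adω.d.val p = dv s.adω p := rfl
    rw [k'] at k
    rw [← k]
    simp only [tri, adφ₁, adφ₂, φ₂coef, c3_w3, c2_w2, c2_add, c1_smul, val_add, val_fmul, c1_add]
    ring

/-- The components containing θ define the θ₁ and θ₂ coefficients of ψ. The θ₁ ∧ θ₂ component holds
because ddθ = 0. -/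
theorem adapted_d_φ (hs : s.SmoothAt p) (h : ∀ᶠ q in 𝓝 p, s.FramedAt q) :
    dv s.φ p = w2 (s.θ₁.val p) (s.adφ₂.val p) - w2 (s.θ₂.val p) (s.adφ₁.val p) +
      w2 (s.θ.val p) (s.adψ.val p) := by
  have hp := h.self_of_nhds
  have hv := hp.vol_ne
  have e₁ := adapted_d_θ₁ hp
  have e₂ := adapted_d_θ₂ hp
  refine alt2_ext_of_tri hv ?_ ?_ ?_
  · have k := congrArg c3 (dd_θ hs h)
    rw [e₁, e₂, hp.d_θ] at k
    simp only [c3_w3, c3_add, c3_sub, c3_zero, c2_w2, c2_add, c2_sub, c1_smul] at k ⊢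
    linear_combination -k
  · have k := coef₀₂_mul hv s.φ.d
    have k' : s.φ.d.val p = dv s.φ p := rfl
    rw [k'] at k
    rw [← neg_eq_iff_eq_neg.2 k]
    simp only [tri, adφ₁, adφ₂, adψ, preψ, c3_w3, c2_w2, c2_add, c2_sub, c1_smul, val_add,
      val_fmul, c1_add]
    ring
  · have k := coef₀₁_mul hv s.φ.d
    have k' : s.φ.d.val p = dv s.φ p := rfl
    rw [k'] at k
    rw [← k]
    simp only [tri, adφ₁, adφ₂, adψ, preψ, c3_w3, c2_w2, c2_add, c2_sub, c1_smul, val_add,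
      val_fmul, c1_add]
    ring

/-- Every smooth coframe has an adapted connection. -/
theorem adaptedAt_adapted (hs : s.SmoothAt p) (h : ∀ᶠ q in 𝓝 p, s.FramedAt q) :
    s.AdaptedAt s.adapted p := by
  have hp := h.self_of_nhds
  have hv := hp.vol_ne
  have e₁ := adapted_d_θ₁ hp
  have e₂ := adapted_d_θ₂ hp
  have hc : s.adapted.SmoothAt p := ((hs.family 0).adapted hv).slice
  have eω := adapted_d_ω hs h
  have eφ := adapted_d_φ hs h
  refine ⟨e₁, e₂, eφ, eω, s.coef₀₂ s.preΦ₁ p, ?_⟩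
  have kN : s.preΦ₁.val p = dv s.adφ₁ p - w2 (s.adφ₁.val p) (s.adω.val p) -
    w2 ((1 / 2 : ℂ) • s.θ₁.val p) (s.preψ.val p) -
    w2 ((1 / 2 : ℂ) • s.φ.val p) (s.adφ₁.val p) := rfl
  have kψ : s.adψ.val p = (-2 * s.coef₀₁ s.preΦ₁ p) • s.θ.val p + s.preψ.val p := rfl
  change dv s.adφ₁ p - w2 (s.adφ₁.val p) (s.adω.val p) -
    w2 ((1 / 2 : ℂ) • s.θ₁.val p) (s.adψ.val p) -
    w2 ((1 / 2 : ℂ) • s.φ.val p) (s.adφ₁.val p) = _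
  refine alt2_ext_of_tri hv ?_ ?_ ?_
  -- The θ₁ ∧ θ₂ component vanishes because ddθ₁ = 0.
  · have k := congrArg c3 (dd_θ₁ (c := s.adapted) hs hc (h.mono fun q hq => adapted_d_θ₁ hq))
    change c3 ((w3 (s.φ.val p) ((1 / 2 : ℂ) • dv s.θ₁ p) -
        w3 ((1 / 2 : ℂ) • s.θ₁.val p) (dv s.φ p)) +
      (w3 (s.adω.val p) (dv s.θ₁ p) - w3 (s.θ₁.val p) (dv s.adω p)) +
      (w3 (s.adφ₁.val p) (dv s.θ p) - w3 (s.θ.val p) (dv s.adφ₁ p))) = _ at k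
    rw [e₁, eφ, eω, hp.d_θ] at k
    simp only [c3_w3, c3_add, c3_sub, c3_zero, c2_w2, c2_add, c2_sub, c2_smul, c1_smul] at k ⊢
    linear_combination -k
  · have k := coef₀₂_mul hv s.preΦ₁
    rw [kN] at k
    rw [kψ]
    simp only [tri, c3_w3, c2_w2, c2_add, c2_sub, c2_smul, c1_smul, c1_add] at k ⊢
    linear_combination k
  -- The coefficient of θ in ψ enters through -½ θ₁ ∧ ψ, so it contributes half of itself to the θ ∧
  -- θ₁ component. This is why it is -2 times the component to be removed.
  · have k := coef₀₁_mul hv s.preΦ₁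
    rw [kN] at k
    rw [kψ]
    simp only [tri, c3_w3, c2_w2, c2_add, c2_sub, c2_smul, c1_smul, c1_add] at k ⊢
    linear_combination -k

end existence

/-! ### Local uniqueness of the adapted connection -/

section uniqueness
variable {s : Coframe M} {c c' : ConnectionForms M} {U : Set M}

/-- The adapted connection is locally unique. -/
theorem adapted_unique (hU : IsOpen U) (hs : ∀ p ∈ U, s.FramedAt p)
    (hss : ∀ p ∈ U, s.SmoothAt p)
    (hc : ∀ p ∈ U, c.SmoothAt p) (hc' : ∀ p ∈ U, c'.SmoothAt p)
    (h : ∀ p ∈ U, s.AdaptedAt c p) (h' : ∀ p ∈ U, s.AdaptedAt c' p) {p : M} (hp : p ∈ U) :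
    c.ω₁₁.val p = c'.ω₁₁.val p ∧ c.φ₁.val p = c'.φ₁.val p ∧ c.φ₂.val p = c'.φ₂.val p ∧
      c.ψ.val p = c'.ψ.val p := by
  set f : M → ℂ := s.coef (c.ω₁₁ - c'.ω₁₁) with hf
  have fs : ∀ p ∈ U, FunSmoothAt f p := fun p hp =>
    (((hss p hp).family 0).coef (hs p hp).vol_ne
      (((hc p hp).ω₁₁.sub (hc' p hp).ω₁₁).family 0)).slice
  -- Comparing the equations for dθ₁ and dθ₂ component by component leaves a single free function f
  -- in the difference of the ω₁¹, together with multiples of θ in the differences of the φ¹ and φ².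
  have lin : ∀ p ∈ U, (c.ω₁₁.val p = c'.ω₁₁.val p + f p • s.θ.val p) ∧
      (c.φ₁.val p = c'.φ₁.val p + f p • s.θ₁.val p + s.coef (c.φ₁ - c'.φ₁) p • s.θ.val p) ∧
      (c.φ₂.val p = c'.φ₂.val p - f p • s.θ₂.val p + s.coef (c.φ₂ - c'.φ₂) p • s.θ.val p) := by
    intro p hp
    have hv := (hs p hp).vol_ne
    have dω := decomp hv (c.ω₁₁ - c'.ω₁₁)
    have d1 := decomp hv (c.φ₁ - c'.φ₁)
    have d2 := decomp hv (c.φ₂ - c'.φ₂)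
    have k1 := (h p hp).d_θ₁.symm.trans (h' p hp).d_θ₁
    have k2 := (h p hp).d_θ₂.symm.trans (h' p hp).d_θ₂
    rw [val_sub, sub_eq_iff_eq_add] at dω d1 d2
    have key : ∀ x : ℂ, tri (s.θ.val p) (s.θ₁.val p) (s.θ₂.val p) * x = 0 → x = 0 :=
      fun x hx => (mul_eq_zero.1 hx).resolve_left hv
    rw [dω, d1] at k1
    rw [dω, d2] at k2
    have z1 : s.coef₂ (c.ω₁₁ - c'.ω₁₁) p = 0 := by
      apply key
      have := congrArg (fun B => c3 (w3 (s.θ.val p) B)) k1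
      simp only [tri, c3_w3, c2_w2, c2_add, c1_smul, c1_add] at this ⊢
      linear_combination this
    have z2 : s.coef₁ (c.ω₁₁ - c'.ω₁₁) p = 0 := by
      apply key
      have := congrArg (fun B => c3 (w3 (s.θ.val p) B)) k2
      simp only [tri, c3_w3, c2_w2, c2_add, c2_sub, c1_smul, c1_add] at this ⊢
      linear_combination this
    have z3 : s.coef₂ (c.φ₁ - c'.φ₁) p = 0 := by
      apply key
      have := congrArg (fun B => c3 (w3 (s.θ₁.val p) B)) k1
      simp only [tri, c3_w3, c2_w2, c2_add, c1_smul, c1_add] at this ⊢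
      linear_combination -this
    have z4 : s.coef₁ (c.φ₁ - c'.φ₁) p = f p := by
      refine sub_eq_zero.1 (key _ ?_)
      have := congrArg (fun B => c3 (w3 (s.θ₂.val p) B)) k1
      simp only [tri, c3_w3, c2_w2, c2_add, c1_smul, c1_add, hf] at this ⊢
      linear_combination this
    have z5 : s.coef₁ (c.φ₂ - c'.φ₂) p = 0 := by
      apply key
      have := congrArg (fun B => c3 (w3 (s.θ₂.val p) B)) k2
      simp only [tri, c3_w3, c2_w2, c2_add, c2_sub, c1_smul, c1_add] at this ⊢
      linear_combination this
    have z6 : s.coef₂ (c.φ₂ - c'.φ₂) p = -f p := by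
      refine sub_eq_zero.1 (key _ ?_)
      have := congrArg (fun B => c3 (w3 (s.θ₁.val p) B)) k2
      simp only [tri, c3_w3, c2_w2, c2_add, c2_sub, c1_smul, c1_add, hf] at this ⊢
      linear_combination -this
    rw [dω, d1, d2, z1, z2, z3, z4, z5, z6]
    refine ⟨alt1_ext fun i => ?_, alt1_ext fun i => ?_, alt1_ext fun i => ?_⟩ <;>
      simp only [c1_add, c1_sub, c1_smul, hf] <;> ring
  -- The relation ω₁¹ = ω'₁¹ + f θ holds on an open set and may be differentiated. The θ₁ ∧ θ₂
  -- component of the two equations for dω₁¹ then reads f = -3f.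
  have f0 : ∀ p ∈ U, f p = 0 := by
    intro p hp
    have hv := (hs p hp).vol_ne
    have e : dv c.ω₁₁ p = dv (c'.ω₁₁ + fmul f s.θ) p := by
      refine dv_congr ?_
      filter_upwards [hU.mem_nhds hp] with q hq
      exact (lin q hq).1
    rw [dv_add (hc' p hp).ω₁₁ ((fs p hp).fmul' (hss p hp).θ), dv_fmul (fs p hp) (hss p hp).θ,
      (h p hp).d_ω₁₁, (h' p hp).d_ω₁₁, (lin p hp).2.1, (lin p hp).2.2, (hs p hp).d_θ] at e
    refine (mul_eq_zero.1 ?_).resolve_left hv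
    have := congrArg (fun B => c3 (w3 (s.θ.val p) B)) e
    simp only [tri, c3_w3, c2_w2, c2_add, c2_sub, c2_smul, c1_smul, c1_add, c1_sub] at this ⊢
    linear_combination -(1 / 4) * this
  have ωe : ∀ p ∈ U, c.ω₁₁.val p = c'.ω₁₁.val p := fun p hp => by
    have := (lin p hp).1
    rw [f0 p hp] at this
    rw [this]; module
  have φe : ∀ p ∈ U, c.φ₁.val p = c'.φ₁.val p ∧ c.φ₂.val p = c'.φ₂.val p := by
    intro p hp
    have hv := (hs p hp).vol_ne
    have key : ∀ x : ℂ, tri (s.θ.val p) (s.θ₁.val p) (s.θ₂.val p) * x = 0 → x = 0 :=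
      fun x hx => (mul_eq_zero.1 hx).resolve_left hv
    have e : dv c.ω₁₁ p = dv c'.ω₁₁ p := by
      refine dv_congr ?_
      filter_upwards [hU.mem_nhds hp] with q hq
      exact ωe q hq
    have l1 := (lin p hp).2.1
    have l2 := (lin p hp).2.2
    rw [f0 p hp] at l1 l2
    rw [(h p hp).d_ω₁₁, (h' p hp).d_ω₁₁, l1, l2] at e
    -- With equal ω₁¹, the components of dω₁¹ containing θ detect the remaining multiples of θ in φ¹
    -- and φ².
    have z1 : s.coef (c.φ₁ - c'.φ₁) p = 0 := by
      apply key
      have := congrArg (fun B => c3 (w3 (s.θ₁.val p) B)) e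
      simp only [tri, c3_w3, c2_w2, c2_add, c2_sub, c1_smul, c1_add, c1_sub] at this ⊢
      linear_combination (2 / 3) * this
    have z2 : s.coef (c.φ₂ - c'.φ₂) p = 0 := by
      apply key
      have := congrArg (fun B => c3 (w3 (s.θ₂.val p) B)) e
      simp only [tri, c3_w3, c2_w2, c2_add, c2_sub, c1_smul, c1_add, c1_sub] at this ⊢
      linear_combination -(2 / 3) * this
    rw [l1, l2, z1, z2]
    exact ⟨by module, by module⟩
  refine ⟨ωe p hp, (φe p hp).1, (φe p hp).2, ?_⟩
  have hv := (hs p hp).vol_ne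
  have key : ∀ x : ℂ, tri (s.θ.val p) (s.θ₁.val p) (s.θ₂.val p) * x = 0 → x = 0 :=
    fun x hx => (mul_eq_zero.1 hx).resolve_left hv
  have e : dv c.φ₁ p = dv c'.φ₁ p := by
    refine dv_congr ?_
    filter_upwards [hU.mem_nhds hp] with q hq
    exact (φe q hq).1
  have dψ := decomp hv (c.ψ - c'.ψ)
  rw [val_sub, sub_eq_iff_eq_add] at dψ
  have kφ := (h p hp).d_φ.symm.trans (h' p hp).d_φ
  rw [(φe p hp).1, (φe p hp).2, dψ] at kφ
  have z1 : s.coef₁ (c.ψ - c'.ψ) p = 0 := by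
    apply key
    have := congrArg (fun B => c3 (w3 (s.θ₂.val p) B)) kφ
    simp only [tri, c3_w3, c2_w2, c2_add, c2_sub, c1_smul, c1_add] at this ⊢
    linear_combination this
  have z2 : s.coef₂ (c.ψ - c'.ψ) p = 0 := by
    apply key
    have := congrArg (fun B => c3 (w3 (s.θ₁.val p) B)) kφ
    simp only [tri, c3_w3, c2_w2, c2_add, c2_sub, c1_smul, c1_add] at this ⊢
    linear_combination -this
  obtain ⟨q, hq⟩ := (h p hp).d_φ₁
  obtain ⟨q', hq'⟩ := (h' p hp).d_φ₁
  rw [e, ωe p hp, (φe p hp).1, dψ, z1, z2] at hq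
  -- The equation for dφ sees ψ only modulo θ. Its θ coefficient is detected by the normalization
  -- that the last equation has no θ ∧ θ₁ term.
  have z0 : s.coef (c.ψ - c'.ψ) p = 0 := by
    apply key
    have a := congrArg (fun B => c3 (w3 (s.θ₂.val p) B)) hq
    have a' := congrArg (fun B => c3 (w3 (s.θ₂.val p) B)) hq'
    simp only [tri, c3_w3, c2_w2, c2_add, c2_sub, c2_smul, c1_smul, c1_add] at a a' ⊢
    linear_combination 2 * (a - a')
  rw [dψ, z0, z1, z2]
  module

end uniqueness

end Coframe

/-! ### The connection matrix and its curvature -/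

/-- The connection matrix made from a coframe and connection forms. -/
def connMatrix (s : Coframe M) (c : ConnectionForms M) : Matrix (Fin 3) (Fin 3) (Form M 1) :=
  !![-(1 / 2 : ℂ) • s.φ - (1 / 3 : ℂ) • c.ω₁₁, -c.φ₂, -(1 / 4 : ℂ) • c.ψ;
     s.θ₁, (2 / 3 : ℂ) • c.ω₁₁, (1 / 2 : ℂ) • c.φ₁;
     (2 : ℂ) • s.θ, (2 : ℂ) • s.θ₂, (1 / 2 : ℂ) • s.φ - (1 / 3 : ℂ) • c.ω₁₁]

theorem Coframe.connection_eq (s : Coframe M) : s.connection = connMatrix s s.connectionForms := rfl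

section entries
variable (s : Coframe M) (c : ConnectionForms M)
theorem connMatrix_00 : connMatrix s c 0 0 = -(1 / 2 : ℂ) • s.φ - (1 / 3 : ℂ) • c.ω₁₁ := rfl
theorem connMatrix_01 : connMatrix s c 0 1 = -c.φ₂ := rfl
theorem connMatrix_02 : connMatrix s c 0 2 = -(1 / 4 : ℂ) • c.ψ := rfl
theorem connMatrix_10 : connMatrix s c 1 0 = s.θ₁ := rfl
theorem connMatrix_11 : connMatrix s c 1 1 = (2 / 3 : ℂ) • c.ω₁₁ := rfl
theorem connMatrix_12 : connMatrix s c 1 2 = (1 / 2 : ℂ) • c.φ₁ := rfl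
theorem connMatrix_20 : connMatrix s c 2 0 = (2 : ℂ) • s.θ := rfl
theorem connMatrix_21 : connMatrix s c 2 1 = (2 : ℂ) • s.θ₂ := rfl
theorem connMatrix_22 : connMatrix s c 2 2 = (1 / 2 : ℂ) • s.φ - (1 / 3 : ℂ) • c.ω₁₁ := rfl
end entries

/-- The value at a point of the curvature of a matrix of 1-forms. -/
def curvAt (A : Matrix (Fin 3) (Fin 3) (Form M 1)) (p : M) (i j : Fin 3) : Alt 2 :=
  dv (A i j) p + ∑ k, w2 ((A i k).val p) ((A k j).val p)

theorem val_curvature (s : Coframe M) (p : M) (i j : Fin 3) :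
    (s.curvature i j).val p = curvAt s.connection p i j := by
  change ((s.connection i j).d + ∑ k, s.connection i k ⋏ s.connection k j).val p = _
  rw [Form.val_add, Form.val_sum]
  rfl

theorem smoothFamilyAt_connMatrix {s : ℝ → Coframe M} {c : ℝ → ConnectionForms M} {t : ℝ} {p : M}
    (hs : Coframe.SmoothFamilyAt s t p) (hc : ConnectionForms.SmoothFamilyAt c t p) (i j : Fin 3) :
    Form.SmoothFamilyAt (fun t => connMatrix (s t) (c t) i j) t p := by
  fin_cases i <;> fin_cases j
  · exact (hs.φ.smul _).sub (hc.ω₁₁.smul _)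
  · exact hc.φ₂.neg
  · exact hc.ψ.smul _
  · exact hs.θ₁
  · exact hc.ω₁₁.smul _
  · exact hc.φ₁.smul _
  · exact hs.θ.smul _
  · exact hs.θ₂.smul _
  · exact (hs.φ.smul _).sub (hc.ω₁₁.smul _)

theorem ConnectionForms.SmoothAt.family {c : ConnectionForms M} {p : M} (h : c.SmoothAt p)
    (t : ℝ) : ConnectionForms.SmoothFamilyAt (fun _ => c) t p :=
  ⟨h.ω₁₁.family t, h.φ₁.family t, h.φ₂.family t, h.ψ.family t⟩

theorem smoothAt_connMatrix {s : Coframe M} {c : ConnectionForms M} {p : M}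
    (hs : s.SmoothAt p) (hc : c.SmoothAt p) (i j : Fin 3) : (connMatrix s c i j).SmoothAt p :=
  (smoothFamilyAt_connMatrix (hs.family 0) (hc.family 0) i j).slice

/-! ### The shape of the curvature and the Bianchi identity -/

section curvature
variable {s : Coframe M} {c : ConnectionForms M} {p : M}

open Form FlagGeometry.Coframe

section
variable (hs : s.SmoothAt p) (hc : c.SmoothAt p)
include hs hc

theorem dv_connMatrix_00 : dv (connMatrix s c 0 0) p =
    (-(1 / 2 : ℂ)) • dv s.φ p - (1 / 3 : ℂ) • dv c.ω₁₁ p := by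
  rw [connMatrix_00, dv_sub (hs.φ.smul _) (hc.ω₁₁.smul _), dv_smul _ hs.φ, dv_smul _ hc.ω₁₁]

theorem dv_connMatrix_01 : dv (connMatrix s c 0 1) p = -dv c.φ₂ p := by
  rw [connMatrix_01, dv_neg hc.φ₂]

theorem dv_connMatrix_02 : dv (connMatrix s c 0 2) p = (-(1 / 4 : ℂ)) • dv c.ψ p := by
  rw [connMatrix_02, dv_smul _ hc.ψ]

theorem dv_connMatrix_11 : dv (connMatrix s c 1 1) p = (2 / 3 : ℂ) • dv c.ω₁₁ p := by
  rw [connMatrix_11, dv_smul _ hc.ω₁₁]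

theorem dv_connMatrix_12 : dv (connMatrix s c 1 2) p = (1 / 2 : ℂ) • dv c.φ₁ p := by
  rw [connMatrix_12, dv_smul _ hc.φ₁]

theorem dv_connMatrix_20 : dv (connMatrix s c 2 0) p = (2 : ℂ) • dv s.θ p := by
  rw [connMatrix_20, dv_smul _ hs.θ]

theorem dv_connMatrix_21 : dv (connMatrix s c 2 1) p = (2 : ℂ) • dv s.θ₂ p := by
  rw [connMatrix_21, dv_smul _ hs.θ₂]

theorem dv_connMatrix_22 : dv (connMatrix s c 2 2) p =
    (1 / 2 : ℂ) • dv s.φ p - (1 / 3 : ℂ) • dv c.ω₁₁ p := by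
  rw [connMatrix_22, dv_sub (hs.φ.smul _) (hc.ω₁₁.smul _), dv_smul _ hs.φ, dv_smul _ hc.ω₁₁]

/-- The curvature of the adapted connection is strictly upper triangular. -/
theorem curvAt_eq_zero (hf : s.FramedAt p) (h : s.AdaptedAt c p) {i j : Fin 3} (hij : j ≤ i) :
    curvAt (connMatrix s c) p i j = 0 := by
  fin_cases i <;> fin_cases j <;> first | (exact absurd hij (by decide)) | skip
  -- The entries on and below the diagonal contain only dθ, dθ₁, dθ₂, dφ and dω₁¹, so each is a
  -- combination of the structure equations.
  all_goals
    simp only [curvAt, Fin.sum_univ_three, Fin.zero_eta, Fin.mk_one, Fin.reduceFinMk,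
      dv_connMatrix_00 hs hc, dv_connMatrix_11 hs hc, dv_connMatrix_20 hs hc,
      dv_connMatrix_21 hs hc, dv_connMatrix_22 hs hc]
    simp only [connMatrix_00, connMatrix_01, connMatrix_02, connMatrix_10, connMatrix_11,
      connMatrix_12, connMatrix_20, connMatrix_21, connMatrix_22, h.d_θ₁, h.d_θ₂, h.d_φ, h.d_ω₁₁,
      hf.d_θ]
    apply alt2_ext <;>
      (simp only [c2_add, c2_sub, c2_smul, c2_neg, c2_w2, c2_zero, c1_smul, c1_neg, c1_sub,
        val_sub, val_smul, val_neg]; ring)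

/-- This entry is half of the 2-form normalized in the last structure equation, because the
connection matrix contains ½ φ¹. -/
theorem curvAt_12 (h : s.AdaptedAt c p) : ∃ q : ℂ,
    curvAt (connMatrix s c) p 1 2 = q • w2 (s.θ.val p) (s.θ₂.val p) := by
  obtain ⟨q, hq⟩ := h.d_φ₁
  refine ⟨q / 2, ?_⟩
  rw [sub_eq_iff_eq_add, sub_eq_iff_eq_add, sub_eq_iff_eq_add] at hq
  simp only [curvAt, Fin.sum_univ_three, dv_connMatrix_12 hs hc]
  simp only [connMatrix_10, connMatrix_11, connMatrix_12, connMatrix_02, connMatrix_22, hq]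
  apply alt2_ext <;>
    (simp only [c2_add, c2_sub, c2_smul, c2_neg, c2_w2, c2_zero, c1_smul, c1_neg, c1_sub,
      val_sub, val_smul, val_neg]; ring)

theorem dd_ω (h : ∀ᶠ q in 𝓝 p, s.AdaptedAt c q) :
    (w3 (c.φ₁.val p) ((3 / 2 : ℂ) • dv s.θ₂ p) - w3 ((3 / 2 : ℂ) • s.θ₂.val p) (dv c.φ₁ p)) +
    (w3 (c.φ₂.val p) ((3 / 2 : ℂ) • dv s.θ₁ p) - w3 ((3 / 2 : ℂ) • s.θ₁.val p) (dv c.φ₂ p)) =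
      0 := by
  have e₁ := dv₂_wedge (hs.θ₁.smul (3 / 2 : ℂ)) hc.φ₂
  have e₂ := dv₂_wedge (hs.θ₂.smul (3 / 2 : ℂ)) hc.φ₁
  rw [dv_smul _ hs.θ₁] at e₁
  rw [dv_smul _ hs.θ₂] at e₂
  rw [← dv₂_d hc.ω₁₁, ← val_smul, ← val_smul, ← e₁, ← e₂,
    ← dv₂_add ((hs.θ₂.smul _).wedge hc.φ₁) ((hs.θ₁.smul _).wedge hc.φ₂)]
  exact (dv₂_congr (h.mono fun q hq => hq.d_ω₁₁)).symm

theorem dd_φ (h : ∀ᶠ q in 𝓝 p, s.AdaptedAt c q) :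
    (w3 (c.φ₂.val p) (dv s.θ₁ p) - w3 (s.θ₁.val p) (dv c.φ₂ p)) -
    (w3 (c.φ₁.val p) (dv s.θ₂ p) - w3 (s.θ₂.val p) (dv c.φ₁ p)) +
    (w3 (c.ψ.val p) (dv s.θ p) - w3 (s.θ.val p) (dv c.ψ p)) = 0 := by
  rw [← dv₂_d hs.φ, ← dv₂_wedge hs.θ₁ hc.φ₂, ← dv₂_wedge hs.θ₂ hc.φ₁, ← dv₂_wedge hs.θ hc.ψ,
    ← dv₂_sub (hs.θ₁.wedge hc.φ₂) (hs.θ₂.wedge hc.φ₁),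
    ← dv₂_add ((hs.θ₁.wedge hc.φ₂).sub (hs.θ₂.wedge hc.φ₁)) (hs.θ.wedge hc.ψ)]
  exact (dv₂_congr (h.mono fun q hq => hq.d_φ)).symm

/-- Consequences of the Bianchi identity for the adapted connection. -/
theorem bianchi (hf : ∀ᶠ q in 𝓝 p, s.FramedAt q) (h : ∀ᶠ q in 𝓝 p, s.AdaptedAt c q) :
    c3 (w3 (s.θ₁.val p) (curvAt (connMatrix s c) p 0 1)) = 0 ∧
    c3 (w3 (s.θ.val p) (curvAt (connMatrix s c) p 0 1)) = 0 ∧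
    c3 (w3 (s.θ.val p) (curvAt (connMatrix s c) p 0 2)) = 0 := by
  have hp := h.self_of_nhds
  have hfp := hf.self_of_nhds
  have kω := congrArg c3 (dd_ω hs hc h)
  have kφ := congrArg c3 (dd_φ hs hc h)
  have kθ := congrArg c3 (dd_θ₂ hs hc (h.mono fun q hq => hq.d_θ₂))
  obtain ⟨q, hq⟩ := hp.d_φ₁
  rw [sub_eq_iff_eq_add, sub_eq_iff_eq_add, sub_eq_iff_eq_add] at hq
  rw [hp.d_θ₁, hp.d_θ₂, hq] at kω
  rw [hp.d_θ₁, hp.d_θ₂, hq, hfp.d_θ] at kφ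
  rw [hp.d_θ₂, hp.d_φ, hp.d_ω₁₁, hfp.d_θ] at kθ
  simp only [curvAt, Fin.sum_univ_three, dv_connMatrix_01 hs hc, dv_connMatrix_02 hs hc]
  simp only [connMatrix_00, connMatrix_01, connMatrix_02, connMatrix_11, connMatrix_12,
    connMatrix_21, connMatrix_22]
  simp only [c3_add, c3_sub, c3_zero, c3_w3, c2_add, c2_sub, c2_smul, c2_neg, c2_w2, c2_zero,
    c1_smul, c1_neg, c1_sub, val_sub, val_smul, val_neg] at kω kφ kθ ⊢
  -- As θ₂ ∧ Π₁₂ = 0, the identity ddω₁¹ = 0 reads θ₁ ∧ Π₀₁ = 0. Similarly ddθ₂ = 0 reads θ ∧ Π₀₁ =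
  -- 0. In ddφ = 0 a multiple of the first relation has to be subtracted to leave θ ∧ Π₀₂ = 0.
  refine ⟨?_, ?_, ?_⟩
  · linear_combination (2 / 3) * kω
  · linear_combination kθ
  · linear_combination (1 / 4) * kφ - (1 / 6) * kω

end

end curvature

/-! ### Complex tangent vectors -/

/-- The complex tangent space in coordinates. -/
abbrev CE : Type := ℂ ⊗[ℝ] E3

/-- The complex linear extension of a complex valued 1-covector. -/
def cx (a : Alt 1) : CE →ₗ[ℂ] ℂ :=
  LinearMap.liftBaseChange ℂ
    (((ContinuousAlternatingMap.ofSubsingleton ℝ E3 ℂ (0 : Fin 1)).symm a).toLinearMap)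

theorem cx_tmul (a : Alt 1) (z : ℂ) (v : E3) : cx a (z ⊗ₜ v) = z * a (fun _ => v) := by
  rw [cx, LinearMap.liftBaseChange_tmul, smul_eq_mul]
  congr 1

/-- The coordinates of a complex tangent vector. -/
def ccoord (z : CE) (i : Fin 3) : ℂ := (Algebra.TensorProduct.basis ℂ stdB).repr z i

theorem cx_eq_sum (a : Alt 1) (z : CE) : cx a z = ∑ i, c1 a i * ccoord z i := by
  conv_lhs => rw [← (Algebra.TensorProduct.basis ℂ stdB).sum_repr z]
  rw [map_sum]
  refine Finset.sum_congr rfl fun i _ => ?_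
  rw [map_smul, Algebra.TensorProduct.basis_apply, cx_tmul, smul_eq_mul, one_mul, mul_comm,
    stdB_apply]
  rfl

theorem cx_eq_zero_iff {a : Alt 1} : cx a = 0 ↔ a = 0 := by
  constructor
  · intro h
    refine alt1_ext fun i => ?_
    have := congrArg (fun l => l ((1 : ℂ) ⊗ₜ stdE i)) h
    simp only [cx_tmul, one_mul] at this
    exact this
  · rintro rfl
    ext z
    simp [cx_eq_sum, c1]

theorem cx_add (a b : Alt 1) (z : CE) : cx (a + b) z = cx a z + cx b z := by
  simp [cx_eq_sum, c1_add, add_mul, Finset.sum_add_distrib]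

theorem cx_smul (r : ℂ) (a : Alt 1) (z : CE) : cx (r • a) z = r * cx a z := by
  simp [cx_eq_sum, c1_smul, mul_assoc, Finset.mul_sum]

theorem cx_sub (a b : Alt 1) (z : CE) : cx (a - b) z = cx a z - cx b z := by
  simp [cx_eq_sum, c1_sub, sub_mul, Finset.sum_sub_distrib]

theorem ccoord_ext {z w : CE} (h : ∀ i, ccoord z i = ccoord w i) : z = w :=
  (Algebra.TensorProduct.basis ℂ stdB).ext_elem h

/-- The matrix of pairings is a product of the matrices of coordinates, so its determinant is the
product of theirs. -/
theorem det_cx (a b c : Alt 1) (u v w : CE) :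
    cx a u * (cx b v * cx c w - cx b w * cx c v) - cx a v * (cx b u * cx c w - cx b w * cx c u) +
      cx a w * (cx b u * cx c v - cx b v * cx c u) = tri a b c *
    (ccoord u 0 * (ccoord v 1 * ccoord w 2 - ccoord v 2 * ccoord w 1) -
      ccoord u 1 * (ccoord v 0 * ccoord w 2 - ccoord v 2 * ccoord w 0) +
      ccoord u 2 * (ccoord v 0 * ccoord w 1 - ccoord v 1 * ccoord w 0)) := by
  simp only [cx_eq_sum, Fin.sum_univ_three, tri, c3_w3, c2_w2]
  ring

/-- The matrix of pairings is triangular with nonzero diagonal. -/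
theorem tri_ne_zero_of_cx {a b c : Alt 1} {u v w : CE} (hu : cx a u ≠ 0) (hv : cx b v ≠ 0)
    (hw : cx c w ≠ 0) (hav : cx a v = 0) (haw : cx a w = 0) (hbw : cx b w = 0) :
    tri a b c ≠ 0 := by
  intro h
  have := det_cx a b c u v w
  rw [h, zero_mul, hav, haw, hbw] at this
  have h3 : cx a u * cx b v * cx c w = 0 := by linear_combination this
  simp_all

theorem eq_zero_of_cx {a b c : Alt 1} (h : tri a b c ≠ 0) {z : CE} (ha : cx a z = 0)
    (hb : cx b z = 0) (hc : cx c z = 0) : z = 0 := by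
  rw [cx_eq_sum, Fin.sum_univ_three] at ha hb hc
  have k0 : tri a b c * ccoord z 0 = 0 := by
    simp only [tri, c3_w3, c2_w2]
    linear_combination (c1 b 1 * c1 c 2 - c1 b 2 * c1 c 1) * ha -
      (c1 a 1 * c1 c 2 - c1 a 2 * c1 c 1) * hb + (c1 a 1 * c1 b 2 - c1 a 2 * c1 b 1) * hc
  have k1 : tri a b c * ccoord z 1 = 0 := by
    simp only [tri, c3_w3, c2_w2]
    linear_combination -(c1 b 0 * c1 c 2 - c1 b 2 * c1 c 0) * ha +
      (c1 a 0 * c1 c 2 - c1 a 2 * c1 c 0) * hb - (c1 a 0 * c1 b 2 - c1 a 2 * c1 b 0) * hc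
  have k2 : tri a b c * ccoord z 2 = 0 := by
    simp only [tri, c3_w3, c2_w2]
    linear_combination (c1 b 0 * c1 c 1 - c1 b 1 * c1 c 0) * ha -
      (c1 a 0 * c1 c 1 - c1 a 1 * c1 c 0) * hb + (c1 a 0 * c1 b 1 - c1 a 1 * c1 b 0) * hc
  refine ccoord_ext fun i => ?_
  have h0 : ccoord (0 : CE) i = 0 := by simp [ccoord]
  rw [h0]
  fin_cases i
  · exact (mul_eq_zero.1 k0).resolve_left h
  · exact (mul_eq_zero.1 k1).resolve_left h
  · exact (mul_eq_zero.1 k2).resolve_left h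

/-- Given independent `a`, `b`, `c`, lines `ℂ v`, `ℂ w` with `v`, `w` dual to `b`, `c` modulo
the kernel of `a` span that kernel. -/
theorem ker_cx_eq_sup {a b c : Alt 1} (h : tri a b c ≠ 0) {v w : CE} (hv : cx b v ≠ 0)
    (hw : cx c w ≠ 0) (hav : cx a v = 0) (haw : cx a w = 0) (hbw : cx b w = 0) (hcv : cx c v = 0) :
    LinearMap.ker (cx a) = Submodule.span ℂ {v} ⊔ Submodule.span ℂ {w} := by
  apply le_antisymm
  · intro z hz
    rw [LinearMap.mem_ker] at hz
    have : z - ((cx b z / cx b v) • v + (cx c z / cx c w) • w) = 0 := by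
      apply eq_zero_of_cx h <;>
        simp only [map_sub, map_add, map_smul, smul_eq_mul, hz, hav, haw, hbw, hcv, mul_zero,
          add_zero, zero_add, sub_zero] <;> field_simp <;> simp
    rw [sub_eq_zero.1 this]
    exact Submodule.add_mem_sup (Submodule.smul_mem _ _ (Submodule.mem_span_singleton_self v))
      (Submodule.smul_mem _ _ (Submodule.mem_span_singleton_self w))
  · refine sup_le ?_ ?_ <;> rw [Submodule.span_singleton_le_iff_mem] <;> assumption

/-! ### Sections of the coframe bundle and their adapted connections -/

/-- Smooth and framed at every point. -/
def Coframe.IsFramed (s : Coframe M) : Prop := ∀ p, s.SmoothAt p ∧ s.FramedAt p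

/-- A local contact form with θ ∧ dθ ≠ 0 is itself nonzero, so its kernel is a proper subspace. -/
theorem FlagStructure.sup_ne_top (G : FlagStructure M) (p : M) : G.T₁ p ⊔ G.T₂ p ≠ ⊤ := by
  obtain ⟨U, -, hp, θ, -, h⟩ := G.contact p
  obtain ⟨hk, hne⟩ := h p hp
  intro htop
  rw [htop, LinearMap.ker_eq_top] at hk
  replace hk : θ.val p = 0 := cx_eq_zero_iff.1 hk
  apply hne
  change covWedge (θ.val p) (θ.d.val p) = 0
  rw [hk]
  have := covWedge_smul_left 0 (0 : Alt 1) (θ.d.val p)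
  rwa [zero_smul ℂ (0 : Alt 1), zero_smul ℂ (covWedge _ _)] at this

theorem framedAt_d_θ {s : Coframe M} (h : s.θ.d = s.θ ⋏ s.φ + s.θ₁ ⋏ s.θ₂) (p : M) :
    dv s.θ p = w2 (s.θ.val p) (s.φ.val p) + w2 (s.θ₁.val p) (s.θ₂.val p) := congrFun h p

/-- Take u outside ker θ, v in T₁ with θ₁(v) ≠ 0, and w in T₂ with θ₂(w) ≠ 0. The pairings with θ,
θ₁, θ₂ are triangular. After this only the framing is needed until sections of the same structure
are compared. -/
theorem IsSection.isFramed {G : FlagStructure M} {s : Coframe M} (h : IsSection G s) :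
    s.IsFramed := by
  intro p
  have sm : ∀ {α : Form M 1}, α.SmoothOn univ → α.SmoothAt p := fun hα =>
    (Form.smoothOn_iff isOpen_univ).1 hα p (mem_univ p)
  refine ⟨⟨sm h.smooth_θ, sm h.smooth_θ₁, sm h.smooth_θ₂, sm h.smooth_φ⟩, ?_,
    framedAt_d_θ h.d_θ p⟩
  obtain ⟨v, hv, hv'⟩ := SetLike.not_le_iff_exists.1 (h.θ₁_T₁ p)
  obtain ⟨w, hw, hw'⟩ := SetLike.not_le_iff_exists.1 (h.θ₂_T₂ p)
  have hker := h.ker_θ p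
  have htop : LinearMap.ker (s.θ.complexify p) ≠ ⊤ := hker ▸ G.sup_ne_top p
  obtain ⟨u, hu⟩ : ∃ u, s.θ.complexify p u ≠ 0 := by
    by_contra! h0
    exact htop (LinearMap.ker_eq_top.2 (LinearMap.ext h0))
  have hav : v ∈ LinearMap.ker (s.θ.complexify p) := hker ▸ Submodule.mem_sup_left hv
  have haw : w ∈ LinearMap.ker (s.θ.complexify p) := hker ▸ Submodule.mem_sup_right hw
  exact tri_ne_zero_of_cx (u := u) (v := v) (w := w) hu hv' hw' hav haw (h.θ₁_T₂ p hw)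

theorem isAdapted_iff {s : Coframe M} {c : ConnectionForms M} :
    IsAdapted s c ↔ ∀ p, c.SmoothAt p ∧ s.AdaptedAt c p := by
  have sm : ∀ {α : Form M 1}, α.SmoothOn univ ↔ ∀ p, α.SmoothAt p := fun {α} =>
    (Form.smoothOn_iff isOpen_univ).trans ⟨fun h p => h p (mem_univ p), fun h p _ => h p⟩
  constructor
  · intro h p
    obtain ⟨Q, hQ⟩ := h.d_φ₁
    exact ⟨⟨sm.1 h.smooth_ω₁₁ p, sm.1 h.smooth_φ₁ p, sm.1 h.smooth_φ₂ p, sm.1 h.smooth_ψ p⟩,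
      congrFun h.d_θ₁ p, congrFun h.d_θ₂ p, congrFun h.d_φ p, congrFun h.d_ω₁₁ p, Q p,
      congrFun hQ p⟩
  · intro h
    choose Q hQ using fun p => (h p).2.d_φ₁
    exact ⟨sm.2 fun p => (h p).1.ω₁₁, sm.2 fun p => (h p).1.φ₁, sm.2 fun p => (h p).1.φ₂,
      sm.2 fun p => (h p).1.ψ, funext fun p => (h p).2.d_θ₁, funext fun p => (h p).2.d_θ₂,
      funext fun p => (h p).2.d_φ, funext fun p => (h p).2.d_ω₁₁, Q, funext hQ⟩

namespace Coframe
variable {s : Coframe M}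

theorem IsFramed.adapted_smoothAt (h : s.IsFramed) (p : M) : s.adapted.SmoothAt p :=
  (((h p).1.family 0).adapted (h p).2.vol_ne).slice

theorem IsFramed.adaptedAt (h : s.IsFramed) (p : M) : s.AdaptedAt s.adapted p :=
  adaptedAt_adapted (h p).1 (Eventually.of_forall fun q => (h q).2)

theorem IsFramed.isAdapted (h : s.IsFramed) : IsAdapted s s.adapted :=
  isAdapted_iff.2 fun p => ⟨h.adapted_smoothAt p, h.adaptedAt p⟩

theorem IsFramed.eq_adapted (h : s.IsFramed) {c : ConnectionForms M} (hc : IsAdapted s c) :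
    c = s.adapted := by
  rw [isAdapted_iff] at hc
  have key := fun p => adapted_unique isOpen_univ (s := s) (c := c) (c' := s.adapted)
    (fun p _ => (h p).2) (fun p _ => (h p).1) (fun p _ => (hc p).1)
    (fun p _ => h.adapted_smoothAt p) (fun p _ => (hc p).2) (fun p _ => h.adaptedAt p)
    (mem_univ p)
  have e₁ : c.ω₁₁ = s.adapted.ω₁₁ := Form.ext_val fun p => (key p).1
  have e₂ : c.φ₁ = s.adapted.φ₁ := Form.ext_val fun p => (key p).2.1
  have e₃ : c.φ₂ = s.adapted.φ₂ := Form.ext_val fun p => (key p).2.2.1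
  have e₄ : c.ψ = s.adapted.ψ := Form.ext_val fun p => (key p).2.2.2
  cases c
  simp only at e₁ e₂ e₃ e₄
  subst e₁ e₂ e₃ e₄
  rfl

theorem IsFramed.existsUnique (h : s.IsFramed) : ∃! c, IsAdapted s c :=
  ⟨s.adapted, h.isAdapted, fun _ hc => h.eq_adapted hc⟩

/-- The chosen connection forms are identified with the explicit ones. This is what makes their
dependence on a parameter accessible. -/
theorem IsFramed.connectionForms (h : s.IsFramed) : s.connectionForms = s.adapted :=
  h.eq_adapted (Classical.epsilon_spec ⟨s.adapted, h.isAdapted⟩)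

theorem IsFramed.connection (h : s.IsFramed) : s.connection = connMatrix s s.adapted := by
  rw [Coframe.connection_eq, h.connectionForms]

end Coframe

theorem IsSmoothSectionFamily.smoothFamilyAt {F : ℝ → FlagStructure M} {s : ℝ → Coframe M} {δ : ℝ}
    (h : IsSmoothSectionFamily F s δ) {t : ℝ} (ht : t ∈ Ioo (-δ) δ) (p : M) :
    Coframe.SmoothFamilyAt s t p := by
  have hW : IsOpen (Ioo (-δ) δ ×ˢ (univ : Set M)) := isOpen_Ioo.prod isOpen_univ
  exact ⟨(Form.smoothFamilyOn_iff hW).1 h.smooth_θ (t, p) ⟨ht, mem_univ p⟩,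
    (Form.smoothFamilyOn_iff hW).1 h.smooth_θ₁ (t, p) ⟨ht, mem_univ p⟩,
    (Form.smoothFamilyOn_iff hW).1 h.smooth_θ₂ (t, p) ⟨ht, mem_univ p⟩,
    (Form.smoothFamilyOn_iff hW).1 h.smooth_φ (t, p) ⟨ht, mem_univ p⟩⟩

/-- The connection depends smoothly on the parameter, for a smooth family of framed coframes. -/
theorem smoothFamilyAt_connection {s : ℝ → Coframe M} {t : ℝ}
    (h : ∀ᶠ t' in 𝓝 t, (s t').IsFramed) {p : M} (hs : Coframe.SmoothFamilyAt s t p) (i j : Fin 3) :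
    Form.SmoothFamilyAt (fun t => (s t).connection i j) t p := by
  refine (smoothFamilyAt_connMatrix hs (hs.adapted (h.self_of_nhds p).2.vol_ne) i j).congr ?_
  filter_upwards [h.prod_inl_nhds p] with z hz
  rw [hz.connection]

/-! ### Forms with support in a chart -/

namespace Form
variable {k : ℕ}

/-- The coordinate expression of a form in the chart at `x`, extended by zero. -/
def ext (β : Form M k) (x : M) : E3 → Alt k :=
  indicator (extChartAt (𝓡 3) x).target (β.rep x)

theorem ext_apply (β : Form M k) {x : M} {y : E3} (hy : y ∈ (extChartAt (𝓡 3) x).target) :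
    β.ext x y = β.rep x y := indicator_of_mem hy _

/-- The form vanishes outside `K`. -/
def VanishesOff (β : Form M k) (K : Set M) : Prop := ∀ p ∉ K, β.val p = 0

theorem rep_eq_zero {β : Form M k} {x : M} {y : E3}
    (h : β.val ((extChartAt (𝓡 3) x).symm y) = 0) : β.rep x y = 0 := by
  rw [rep_eq, h]
  ext v
  simp

variable {K : Set M} {x : M}

theorem VanishesOff.ext_eq_zero {β : Form M k} (h : β.VanishesOff K) {y : E3}
    (hy : y ∉ extChartAt (𝓡 3) x '' K) : β.ext x y = 0 := by
  by_cases hyt : y ∈ (extChartAt (𝓡 3) x).target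
  · rw [ext_apply β hyt]
    refine rep_eq_zero (h _ fun hK => hy ⟨_, hK, (extChartAt (𝓡 3) x).right_inv hyt⟩)
  · exact indicator_of_notMem hyt _

theorem isCompact_image_chart (hK : IsCompact K) (hKx : K ⊆ (extChartAt (𝓡 3) x).source) :
    IsCompact (extChartAt (𝓡 3) x '' K) :=
  hK.image_of_continuousOn ((continuousOn_extChartAt x).mono hKx)

/-- Over the target of the chart the extension is the coordinate expression. A point outside the
target has a neighbourhood missing the compact image of K, and there the extension is zero for all
parameters. -/
theorem contDiffAt_ext_family {β : ℝ → Form M k} {t : ℝ} (hK : IsCompact K)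
    (hKx : K ⊆ (extChartAt (𝓡 3) x).source) (hβ : ∀ p, SmoothFamilyAt β t p)
    (h : ∀ t, (β t).VanishesOff K) (y : E3) :
    ContDiffAt ℝ ∞ (fun w : ℝ × E3 => (β w.1).ext x w.2) (t, y) := by
  by_cases hyt : y ∈ (extChartAt (𝓡 3) x).target
  · have h1 := hβ _ x (symm_mem_source hyt)
    rw [(extChartAt (𝓡 3) x).right_inv hyt] at h1
    refine h1.congr_of_eventuallyEq ?_
    have := eventually_mem_target_prod (symm_mem_source hyt) t
    rw [(extChartAt (𝓡 3) x).right_inv hyt] at this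
    filter_upwards [this] with w hw
    exact ext_apply _ hw
  · have hc : IsClosed (extChartAt (𝓡 3) x '' K) := (isCompact_image_chart hK hKx).isClosed
    have hyK : y ∈ (extChartAt (𝓡 3) x '' K)ᶜ := by
      rintro ⟨p, hp, rfl⟩
      exact hyt ((extChartAt (𝓡 3) x).map_source (hKx hp))
    refine (contDiffAt_const (c := (0 : Alt k))).congr_of_eventuallyEq ?_
    have : ∀ᶠ w : ℝ × E3 in 𝓝 (t, y), w.2 ∈ (extChartAt (𝓡 3) x '' K)ᶜ :=
      (continuousAt_snd (p := (t, y))).eventually (hc.isOpen_compl.mem_nhds hyK)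
    filter_upwards [this] with w hw
    exact (h w.1).ext_eq_zero hw

theorem contDiff_ext {β : Form M k} (hK : IsCompact K)
    (hKx : K ⊆ (extChartAt (𝓡 3) x).source) (hβ : ∀ p, β.SmoothAt p) (h : β.VanishesOff K) :
    ContDiff ℝ ∞ (β.ext x) := by
  rw [contDiff_iff_contDiffAt]
  intro y
  have := contDiffAt_ext_family (t := 0) hK hKx (fun p => (hβ p).family 0) (fun _ => h) y
  exact this.comp y (contDiffAt_const.prodMk contDiffAt_id)

theorem hasCompactSupport_ext {β : Form M k} (hK : IsCompact K)
    (hKx : K ⊆ (extChartAt (𝓡 3) x).source) (h : β.VanishesOff K) :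
    HasCompactSupport (β.ext x) :=
  HasCompactSupport.intro (isCompact_image_chart hK hKx) fun _ hy => h.ext_eq_zero hy

theorem ext_d {β : Form M k} (hK : IsCompact K)
    (hKx : K ⊆ (extChartAt (𝓡 3) x).source) (hβ : ∀ p, β.SmoothAt p) (h : β.VanishesOff K)
    (y : E3) : β.d.ext x y = extDeriv (β.ext x) y := by
  by_cases hyt : y ∈ (extChartAt (𝓡 3) x).target
  · have hs := hβ _ x (symm_mem_source hyt)
    rw [(extChartAt (𝓡 3) x).right_inv hyt] at hs
    have he : β.ext x =ᶠ[𝓝 y] β.rep x := by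
      filter_upwards [extChartAt_target_mem_nhds' hyt] with y' hy' using ext_apply β hy'
    rw [ext_apply _ hyt, rep_d β hyt (hs.differentiableAt (by simp)), he.extDeriv_eq]
  · have hc : IsClosed (extChartAt (𝓡 3) x '' K) := (isCompact_image_chart hK hKx).isClosed
    have hyK : y ∈ (extChartAt (𝓡 3) x '' K)ᶜ := by
      rintro ⟨p, hp, rfl⟩
      exact hyt ((extChartAt (𝓡 3) x).map_source (hKx hp))
    have he : β.ext x =ᶠ[𝓝 y] fun _ => 0 := by
      filter_upwards [hc.isOpen_compl.mem_nhds hyK] with y' hy' using h.ext_eq_zero hy'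
    rw [he.extDeriv_eq]
    rw [Form.ext, indicator_of_notMem hyt, extDeriv, fderiv_fun_const]
    ext v
    simp [ContinuousAlternatingMap.alternatizeUncurryFin_apply]

/-- The integral, in the chart at `x`, of a 3-form supported in the chart. -/
def chartIntegral (x : M) (β : Form M 3) : ℂ := ∫ y, c3 (β.ext x y)

theorem integrable_c3_ext {β : Form M 3} (hK : IsCompact K)
    (hKx : K ⊆ (extChartAt (𝓡 3) x).source) (hβ : ∀ p, β.SmoothAt p) (h : β.VanishesOff K) :
    Integrable fun y => c3 (β.ext x y) := by
  refine Continuous.integrable_of_hasCompactSupport ?_ ?_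
  · exact contDiff_c3.continuous.comp (contDiff_ext hK hKx hβ h).continuous
  · exact (hasCompactSupport_ext hK hKx h).comp_left (g := c3) c3_zero

/-- Each term of the exterior derivative is a directional derivative of a compactly supported
function, whose integral vanishes. -/
theorem _root_.FlagGeometry.integral_c3_extDeriv {g : E3 → Alt 2} (hg : ContDiff ℝ ∞ g)
    (hc : HasCompactSupport g) : ∫ y, c3 (extDeriv g y) = 0 := by
  have key : ∀ (v : E3) (w : Fin 2 → E3), Integrable (fun y => fderiv ℝ g y v w) ∧
      ∫ y, fderiv ℝ g y v w = 0 := by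
    intro v w
    set L : Alt 2 →L[ℝ] ℂ := ContinuousAlternatingMap.apply ℝ E3 ℂ w with hL
    have hd : ∀ y, fderiv ℝ (fun y => L (g y)) y v = fderiv ℝ g y v w := by
      intro y
      have := (L.hasFDerivAt.comp y (hg.differentiable (by simp) y).hasFDerivAt).fderiv
      change fderiv ℝ (L ∘ g) y v = _
      rw [this]
      rfl
    have hLg : ContDiff ℝ ∞ fun y => L (g y) := L.contDiff.comp hg
    have hLc : HasCompactSupport fun y => L (g y) := hc.comp_left (map_zero L)
    have i1 : Integrable fun y => L (g y) := hLg.continuous.integrable_of_hasCompactSupport hLc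
    have i2 : Integrable fun y => fderiv ℝ (fun y => L (g y)) y v := by
      refine Continuous.integrable_of_hasCompactSupport ?_ ?_
      · exact (hLg.continuous_fderiv (by simp)).clm_apply continuous_const
      · exact (hLc.fderiv ℝ).comp_left (g := fun A : E3 →L[ℝ] ℂ => A v) rfl
    -- Integration by parts against the constant function 1.
    have := integral_mul_fderiv_eq_neg_fderiv_mul_of_integrable (μ := volume) (𝕜 := ℂ)
      (f := fun _ : E3 => (1 : ℂ)) (g := fun y => L (g y)) (v := v) (by simp)
      (by simpa using i2) (by simpa using i1) (fun _ _ => differentiableAt_const _)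
      (fun y _ => hLg.differentiable (by simp) y)
    simp only [hd] at i2 this
    exact ⟨i2, by simpa using this⟩
  have e : ∀ y, c3 (extDeriv g y) = ∑ i : Fin 3, ((-1 : ℤ) ^ (i : ℕ)) •
      fderiv ℝ g y (stdE i) (i.removeNth fun i => stdE i) := by
    intro y
    rw [c3, extDeriv, ContinuousAlternatingMap.alternatizeUncurryFin_apply]
  simp only [e]
  rw [integral_finsetSum]
  · refine Finset.sum_eq_zero fun i _ => ?_
    have := (key (stdE i) (i.removeNth fun i => stdE i)).2
    fin_cases i <;> simp_all [integral_neg]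
  · intro i _
    exact (key _ _).1.smul _

theorem chartIntegral_d {ζ : Form M 2} (hK : IsCompact K)
    (hKx : K ⊆ (extChartAt (𝓡 3) x).source) (hζ : ∀ p, ζ.SmoothAt p) (h : ζ.VanishesOff K) :
    chartIntegral x ζ.d = 0 := by
  unfold chartIntegral
  simp only [ext_d hK hKx hζ h]
  exact integral_c3_extDeriv (contDiff_ext hK hKx hζ h) (hasCompactSupport_ext hK hKx h)

/-- Change of variables. The coordinate of a 3-form is multiplied by the Jacobian determinant of the
coordinate change, and the integral by its absolute value; the two agree because the atlas is
oriented. -/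
theorem chartIntegral_eq (hM : IsOrientedAtlas M) {β : Form M 3} {z : M}
    (hKx : K ⊆ (extChartAt (𝓡 3) x).source) (hKz : K ⊆ (extChartAt (𝓡 3) z).source)
    (h : β.VanishesOff K) : chartIntegral x β = chartIntegral z β := by
  set e := (extChartAt (𝓡 3) x).symm.trans (extChartAt (𝓡 3) z) with he
  have hS : ∀ {y}, y ∈ e.source ↔ y ∈ (extChartAt (𝓡 3) x).target ∧
      (extChartAt (𝓡 3) x).symm y ∈ (extChartAt (𝓡 3) z).source := by
    intro y
    simp [he, PartialEquiv.trans_source]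
  have hT : ∀ {y}, y ∈ e.target ↔ y ∈ (extChartAt (𝓡 3) z).target ∧
      (extChartAt (𝓡 3) z).symm y ∈ (extChartAt (𝓡 3) x).source := by
    intro y
    simp [he, PartialEquiv.trans_target]
  have hef : ∀ y, e y = coordChange x z y := fun y => rfl
  have ho : MeasurableSet e.source := by
    have : IsOpen e.source := by
      rw [isOpen_iff_mem_nhds]
      intro y hy
      have := eventually_symm_mem (hS.1 hy).1
        ((isOpen_extChartAt_source (I := 𝓡 3) z).mem_nhds (hS.1 hy).2)
      filter_upwards [this] with y' hy' using hS.2 hy'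
    exact this.measurableSet
  have hx : chartIntegral x β = ∫ y in e.source, c3 (β.ext x y) := by
    refine (setIntegral_eq_integral_of_forall_compl_eq_zero fun y hy => ?_).symm
    rw [h.ext_eq_zero, c3_zero]
    · rintro ⟨p, hp, rfl⟩
      refine hy (hS.2 ⟨(extChartAt (𝓡 3) x).map_source (hKx hp), ?_⟩)
      rw [(extChartAt (𝓡 3) x).left_inv (hKx hp)]
      exact hKz hp
  have hz : chartIntegral z β = ∫ y in e '' e.source, c3 (β.ext z y) := by
    refine (setIntegral_eq_integral_of_forall_compl_eq_zero fun y hy => ?_).symm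
    rw [h.ext_eq_zero, c3_zero]
    · rintro ⟨p, hp, rfl⟩
      refine hy ?_
      rw [e.image_source_eq_target]
      refine hT.2 ⟨(extChartAt (𝓡 3) z).map_source (hKz hp), ?_⟩
      rw [(extChartAt (𝓡 3) z).left_inv (hKz hp)]
      exact hKx hp
  rw [hx, hz, integral_image_eq_integral_abs_det_fderiv_smul volume ho
    (f' := fderiv ℝ (coordChange x z)) (fun y hy => ?_) e.injOn]
  · refine setIntegral_congr_fun ho fun y hy => ?_
    have h1 := hS.1 hy
    have hey : e y ∈ (extChartAt (𝓡 3) z).target := (hT.1 (e.map_source hy)).1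
    have hdet : 0 < (fderiv ℝ (coordChange x z) y).det := hM x z y hy
    rw [ext_apply _ h1.1, ext_apply _ hey, rep_coordChange β h1.1 h1.2, c3_comp, hef,
      abs_of_pos hdet, Complex.real_smul]
  · have h1 := hS.1 hy
    exact ((contDiffAt_coordChange h1.1 h1.2).differentiableAt (by simp)).hasFDerivAt.hasFDerivWithinAt

end Form

/-! ### The integral of a 3-form -/

section integral
variable [CompactSpace M] [T2Space M]

theorem chartPartition_isSubordinate :
    (chartPartition M).IsSubordinate fun x => (chartAt E3 x).source :=
  Classical.choose_spec (SmoothPartitionOfUnity.exists_isSubordinate_chartAt_source (𝓡 3) M)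

/-- The functions of the partition of unity, with complex values. -/
def cut (x : M) (p : M) : ℂ := ((chartPartition M x p : ℝ) : ℂ)

variable (M) in
/-- The finitely many charts that are used in the partition of unity. -/
def chartIndices : Finset M :=
  ((chartPartition M).locallyFinite.finite_nonempty_of_compact).toFinset

theorem cut_eq_zero {x : M} (hx : x ∉ chartIndices M) (p : M) : cut x p = 0 := by
  by_contra h
  refine hx (((chartPartition M).locallyFinite.finite_nonempty_of_compact).mem_toFinset.2 ⟨p, ?_⟩)
  simpa [cut] using h

theorem sum_cut (p : M) : ∑ x ∈ chartIndices M, cut x p = 1 := by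
  have h := (chartPartition M).sum_eq_one (mem_univ p)
  rw [finsum_eq_sum_of_support_subset (s := chartIndices M)] at h
  · have := congrArg (fun r : ℝ => (r : ℂ)) h
    simpa [cut] using this
  · intro x hx
    by_contra h
    have := cut_eq_zero h p
    exact hx (by simpa [cut] using this)

theorem funSmoothAt_cut (x p : M) : FunSmoothAt (cut x) p := by
  intro z hz
  have h1 : ContMDiffAt 𝓘(ℝ, E3) 𝓘(ℝ, ℝ) ∞ (chartPartition M x ∘ (extChartAt (𝓡 3) z).symm)
      (extChartAt (𝓡 3) z p) := by
    refine ((chartPartition M x).contMDiff _).comp _ ?_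
    exact (contMDiffOn_extChartAt_symm z).contMDiffAt
      (extChartAt_target_mem_nhds' ((extChartAt (𝓡 3) z).map_source hz))
  exact Complex.ofRealCLM.contDiff.contDiffAt.comp _ h1.contDiffAt

/-- The support of a function of the partition of unity. -/
def cutSupport (x : M) : Set M := tsupport (chartPartition M x)

theorem isCompact_cutSupport (x : M) : IsCompact (cutSupport x) := (isClosed_tsupport _).isCompact

theorem cutSupport_subset (x : M) : cutSupport x ⊆ (extChartAt (𝓡 3) x).source := by
  rw [extChartAt_source]
  exact chartPartition_isSubordinate x

theorem cut_eq_zero_of_notMem {x p : M} (hp : p ∉ cutSupport x) : cut x p = 0 := by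
  have := image_eq_zero_of_notMem_tsupport hp
  simp [cut, this]

namespace Form

theorem vanishesOff_cut {k : ℕ} (x : M) (β : Form M k) :
    (fmul (cut x) β).VanishesOff (cutSupport x) := by
  intro p hp
  rw [val_fmul, cut_eq_zero_of_notMem hp]
  exact zero_smul ℂ (β.val p)

theorem integral_eq_sum (α : Form M 3) :
    α.integral = ∑ x ∈ chartIndices M, chartIntegral x (fmul (cut x) α) := by
  have key : ∀ x : M, ∫ y in (extChartAt (𝓡 3) x).target,
      ((chartPartition M x ((extChartAt (𝓡 3) x).symm y) : ℝ) : ℂ) *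
        α.rep x y (fun i => EuclideanSpace.single i (1 : ℝ)) =
      chartIntegral x (fmul (cut x) α) := by
    intro x
    rw [chartIntegral, ← integral_indicator (isOpen_extChartAt_target x).measurableSet]
    refine integral_congr_ae (Eventually.of_forall fun y => ?_)
    beta_reduce
    by_cases hy : y ∈ (extChartAt (𝓡 3) x).target
    · rw [indicator_of_mem hy, ext_apply _ hy, rep_fmul, c3_smul]
      rfl
    · rw [indicator_of_notMem hy, Form.ext, indicator_of_notMem hy, c3_zero]
  rw [Form.integral]
  simp only [key]
  refine finsum_eq_sum_of_support_subset _ fun x hx => ?_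
  by_contra h
  refine hx ?_
  have h0 : (fmul (cut x) α).VanishesOff ∅ := by
    intro p _
    rw [val_fmul, cut_eq_zero (by simpa using h)]
    exact zero_smul ℂ (α.val p)
  simp [chartIntegral, h0.ext_eq_zero, c3_zero]

theorem smoothAt_cut {k : ℕ} {β : Form M k} {p : M} (hβ : β.SmoothAt p) (x : M) :
    (fmul (cut x) β).SmoothAt p := (funSmoothAt_cut x p).fmul' hβ

theorem integrable_cut {α : Form M 3} (hα : ∀ p, α.SmoothAt p) (x : M) :
    Integrable fun y => c3 ((fmul (cut x) α).ext x y) :=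
  integrable_c3_ext (isCompact_cutSupport x) (cutSupport_subset x)
    (fun p => smoothAt_cut (hα p) x) (vanishesOff_cut x α)

theorem integral_add {α β : Form M 3} (hα : ∀ p, α.SmoothAt p) (hβ : ∀ p, β.SmoothAt p) :
    (α + β).integral = α.integral + β.integral := by
  simp only [integral_eq_sum, ← Finset.sum_add_distrib, chartIntegral]
  refine Finset.sum_congr rfl fun x _ => ?_
  rw [← MeasureTheory.integral_add (integrable_cut hα x) (integrable_cut hβ x)]
  refine integral_congr_ae (Eventually.of_forall fun y => ?_)
  beta_reduce
  by_cases hy : y ∈ (extChartAt (𝓡 3) x).target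
  · simp only [ext_apply _ hy, rep_fmul, c3_smul]
    have : (α + β).rep x y = α.rep x y + β.rep x y := rfl
    rw [this, c3_add]
    ring
  · simp only [Form.ext, indicator_of_notMem hy, c3_zero, add_zero]

theorem integral_smul (c : ℂ) (α : Form M 3) : (c • α).integral = c * α.integral := by
  simp only [integral_eq_sum, Finset.mul_sum, chartIntegral]
  refine Finset.sum_congr rfl fun x _ => ?_
  rw [← MeasureTheory.integral_const_mul]
  refine integral_congr_ae (Eventually.of_forall fun y => ?_)
  beta_reduce
  by_cases hy : y ∈ (extChartAt (𝓡 3) x).target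
  · simp only [ext_apply _ hy, rep_fmul, c3_smul]
    have : (c • α).rep x y = c • α.rep x y := rfl
    rw [this, c3_smul]
    ring
  · simp only [Form.ext, indicator_of_notMem hy, c3_zero, mul_zero]

theorem integral_zero : (0 : Form M 3).integral = 0 := by
  have := integral_smul 0 (0 : Form M 3)
  rwa [zero_mul, zero_smul ℂ (0 : Form M 3)] at this

theorem integral_sum {ι : Type*} (s : Finset ι) {α : ι → Form M 3}
    (hα : ∀ i ∈ s, ∀ p, (α i).SmoothAt p) :
    (∑ i ∈ s, α i).integral = ∑ i ∈ s, (α i).integral := by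
  classical
  induction s using Finset.induction_on with
  | empty => simpa using integral_zero
  | insert a s ha ih =>
    rw [Finset.sum_insert ha, Finset.sum_insert ha, integral_add, ih]
    · exact fun i hi => hα i (Finset.mem_insert_of_mem hi)
    · exact hα a (Finset.mem_insert_self a s)
    · intro p
      exact (SmoothFamilyAt.sum (α := fun i _ => α i) (t := 0) fun i hi =>
        (hα i (Finset.mem_insert_of_mem hi) p).family 0).slice

/-- Every cut piece is supported in the chart at z as well, so it can be integrated there, where the
pieces add up to the whole form. -/
theorem integral_eq_chartIntegral (hM : IsOrientedAtlas M) {β : Form M 3} {z : M} {K : Set M}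
    (hK : IsCompact K) (hKz : K ⊆ (extChartAt (𝓡 3) z).source) (hβ : ∀ p, β.SmoothAt p)
    (h : β.VanishesOff K) : β.integral = chartIntegral z β := by
  have hv : ∀ x, (fmul (cut x) β).VanishesOff K := by
    intro x p hp
    rw [val_fmul, h p hp]
    exact smul_zero (A := Alt 3) (cut x p)
  have hc : ∀ x, (fmul (cut x) β).VanishesOff (K ∩ cutSupport x) := by
    intro x p hp
    by_cases hpK : p ∈ K
    · exact vanishesOff_cut x β p fun h => hp ⟨hpK, h⟩
    · exact hv x p hpK
  have e : ∀ x, chartIntegral x (fmul (cut x) β) = chartIntegral z (fmul (cut x) β) := fun x =>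
    chartIntegral_eq hM (inter_subset_right.trans (cutSupport_subset x))
      (inter_subset_left.trans hKz) (hc x)
  rw [integral_eq_sum, Finset.sum_congr rfl fun x _ => e x]
  simp only [chartIntegral]
  rw [← integral_finsetSum _ fun x _ =>
    integrable_c3_ext hK hKz (fun p => smoothAt_cut (hβ p) x) (hv x)]
  refine integral_congr_ae (Eventually.of_forall fun y => ?_)
  beta_reduce
  by_cases hy : y ∈ (extChartAt (𝓡 3) z).target
  · simp only [ext_apply _ hy, rep_fmul, c3_smul, ← Finset.sum_mul, sum_cut, one_mul]
  · simp only [Form.ext, indicator_of_notMem hy, c3_zero, Finset.sum_const_zero]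

/-- **Stokes' theorem** on a closed 3-manifold. -/
theorem integral_d (hM : IsOrientedAtlas M) {η : Form M 2} (hη : ∀ p, η.SmoothAt p) :
    η.d.integral = 0 := by
  have hs : ∀ x p, (fmul (cut x) η).SmoothAt p := fun x p => smoothAt_cut (hη p) x
  have hd : ∀ x, (fmul (cut x) η).d.VanishesOff (cutSupport x) := by
    intro x p hp
    have : ∀ᶠ q in 𝓝 p, (fmul (cut x) η).val q = (0 : Form M 2).val q := by
      filter_upwards [(isClosed_tsupport _).isOpen_compl.mem_nhds hp] with q hq
      exact vanishesOff_cut x η q hq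
    exact (d_congr this).trans d_zero
  -- The form η is cut before it is differentiated, so that each piece is the derivative of a form
  -- supported in one chart. Its integral is then the chart integral of an exact form.
  have e : η.d = ∑ x ∈ chartIndices M, (fmul (cut x) η).d := by
    refine ext_val fun p => ?_
    have h1 : ∀ s : Finset M, (∑ x ∈ s, fmul (cut x) η).d.val p =
        (∑ x ∈ s, (fmul (cut x) η).d).val p := by
      classical
      intro s
      induction s using Finset.induction_on with
      | empty => simpa using d_zero
      | insert a s ha ih =>
        rw [Finset.sum_insert ha, Finset.sum_insert ha, d_add (hs a p) ?_, ih]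
        · rfl
        · exact (SmoothFamilyAt.sum (α := fun i _ => fmul (cut i) η) (t := 0) fun i _ =>
            (hs i p).family 0).slice
    rw [← h1]
    refine d_congr (Eventually.of_forall fun q => ?_)
    rw [val_sum]
    simp only [val_fmul]
    rw [← Finset.sum_smul (M := Alt 2), sum_cut]
    exact (one_smul ℂ _).symm
  rw [e, integral_sum _ fun x _ p => (hs x p).d]
  refine Finset.sum_eq_zero fun x _ => ?_
  rw [integral_eq_chartIntegral hM (isCompact_cutSupport x) (cutSupport_subset x)
    (fun p => (hs x p).d) (hd x)]
  exact chartIntegral_d (isCompact_cutSupport x) (cutSupport_subset x) (hs x) (vanishesOff_cut x η)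

end Form

end integral

/-! ### The derivative of a family of forms with respect to the parameter -/

/-- The pullback of alternating maps, as a continuous linear map. -/
abbrev pullL (k : ℕ) (L : E3 →L[ℝ] E3) : Alt k →L[ℝ] Alt k :=
  ContinuousAlternatingMap.compContinuousLinearMapCLM L

/-- Symmetry of the second derivatives with respect to a parameter and a point. -/
theorem hasDerivAt_fderiv_snd {V : Type*} [NormedAddCommGroup V] [NormedSpace ℝ V]
    {G : ℝ × E3 → V} {t : ℝ} {y : E3} (hs : ContDiffAt ℝ ∞ G (t, y)) :
    HasDerivAt (fun s => fderiv ℝ (fun y => G (s, y)) y)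
      (fderiv ℝ (fun y' => fderiv ℝ G (t, y') (1, 0)) y) t := by
  have hd2 : DifferentiableAt ℝ (fderiv ℝ G) (t, y) :=
    (hs.fderiv_right (m := ∞) (by simp)).differentiableAt (by simp)
  have hsymm : IsSymmSndFDerivAt ℝ G (t, y) := hs.isSymmSndFDerivAt (by simp [ENat.LEInfty.out])
  have hl : HasDerivAt (fun s : ℝ => (s, y)) ((1 : ℝ), (0 : E3)) t :=
    (hasDerivAt_id t).prodMk (hasDerivAt_const _ _)
  have hr : HasFDerivAt (fun y : E3 => (t, y)) (ContinuousLinearMap.inr ℝ ℝ E3) y :=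
    hasFDerivAt_prodMk_right t y
  have f1 : HasFDerivAt (fun y' => fderiv ℝ G (t, y') (1, 0))
      (((fderiv ℝ (fderiv ℝ G) (t, y)).comp (ContinuousLinearMap.inr ℝ ℝ E3)).flip (1, 0)) y := by
    have h1 : HasFDerivAt (fun y' => fderiv ℝ G (t, y'))
      ((fderiv ℝ (fderiv ℝ G) (t, y)).comp (ContinuousLinearMap.inr ℝ ℝ E3)) y :=
      hd2.hasFDerivAt.comp y hr
    refine (h1.clm_apply (hasFDerivAt_const ((1 : ℝ), (0 : E3)) y)).congr_fderiv ?_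
    ext v
    simp
  have hev : ∀ᶠ w in 𝓝 (t, y), DifferentiableAt ℝ G w := by
    filter_upwards [(hs.of_le (m := 1) (by simp [ENat.LEInfty.out])).eventually (by simp)] with w hw
    exact hw.differentiableAt (by simp)
  have e2 : (fun s => fderiv ℝ (fun y => G (s, y)) y) =ᶠ[𝓝 t]
      fun s => (fderiv ℝ G (s, y)).comp (ContinuousLinearMap.inr ℝ ℝ E3) := by
    refine (hl.continuousAt.eventually hev).mono fun s hs => ?_
    have : HasFDerivAt (fun y : E3 => (s, y)) (ContinuousLinearMap.inr ℝ ℝ E3) y :=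
      hasFDerivAt_prodMk_right s y
    exact (hs.hasFDerivAt.comp y this).fderiv
  have f2 : HasDerivAt (fun s => (fderiv ℝ G (s, y)).comp (ContinuousLinearMap.inr ℝ ℝ E3))
      ((fderiv ℝ (fderiv ℝ G) (t, y) (1, 0)).comp (ContinuousLinearMap.inr ℝ ℝ E3)) t :=
    ((ContinuousLinearMap.compL ℝ E3 (ℝ × E3) V).flip
      (ContinuousLinearMap.inr ℝ ℝ E3)).hasFDerivAt.comp_hasDerivAt t
      (hd2.hasFDerivAt.comp_hasDerivAt t hl)
  refine (f2.congr_of_eventuallyEq e2).congr_deriv ?_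
  rw [f1.fderiv]
  ext1 v
  exact (hsymm (0, v) (1, 0)).symm

namespace Form
variable {k : ℕ} {α β : ℝ → Form M k} {t : ℝ} {p : M}

/-- The derivative of a family of forms with respect to the parameter. -/
def dotAt (α : ℝ → Form M k) (t : ℝ) : Form M k := fun p =>
  (deriv (fun t : ℝ => (α t).val p) t : Alt k)

theorem val_dotAt (α : ℝ → Form M k) (t : ℝ) (p : M) :
    (dotAt α t).val p = deriv (fun t : ℝ => (α t).val p) t := rfl

theorem hasDerivAt_val_of_rep {x : M} {y : E3} (hy : y ∈ (extChartAt (𝓡 3) x).target)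
    (h : DifferentiableAt ℝ (fun t => (α t).rep x y) t) :
    HasDerivAt (fun t => (α t).val ((extChartAt (𝓡 3) x).symm y))
      ((dotAt α t).val ((extChartAt (𝓡 3) x).symm y)) t := by
  refine DifferentiableAt.hasDerivAt ?_
  simp only [fun t => val_eq_rep (α t) hy]
  exact (pullL k (dChart x ((extChartAt (𝓡 3) x).symm y))).differentiableAt.comp t h

theorem rep_dotAt {x : M} {y : E3} (hy : y ∈ (extChartAt (𝓡 3) x).target)
    (h : DifferentiableAt ℝ (fun t => (α t).rep x y) t) :
    (dotAt α t).rep x y = deriv (fun t => (α t).rep x y) t := by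
  have h1 := hasDerivAt_val_of_rep hy h
  have h2 := ((pullL k (dSymm x y)).hasFDerivAt.comp_hasDerivAt t h1).deriv
  rw [rep_eq]
  exact h2.symm

theorem SmoothFamilyAt.differentiableAt_rep {x : M}
    (h : SmoothFamilyAt α t p) (hx : p ∈ (extChartAt (𝓡 3) x).source) :
    DifferentiableAt ℝ (fun t => (α t).rep x (extChartAt (𝓡 3) x p)) t := by
  have := (h x hx).differentiableAt (by simp)
  exact this.comp (f := fun t : ℝ => (t, extChartAt (𝓡 3) x p)) t (by fun_prop)

theorem SmoothFamilyAt.hasDerivAt (h : SmoothFamilyAt α t p) :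
    HasDerivAt (fun t => (α t).val p) ((dotAt α t).val p) t := by
  have := hasDerivAt_val_of_rep (mem_extChartAt_target p)
    (h.differentiableAt_rep (mem_extChartAt_source p))
  rwa [extChartAt_to_inv] at this

theorem eventually_rep_dotAt {x : M} (h : SmoothFamilyAt α t p)
    (hx : p ∈ (extChartAt (𝓡 3) x).source) :
    ∀ᶠ w : ℝ × E3 in 𝓝 (t, extChartAt (𝓡 3) x p),
      DifferentiableAt ℝ (fun w : ℝ × E3 => (α w.1).rep x w.2) w ∧
      (dotAt α w.1).rep x w.2 = fderiv ℝ (fun w : ℝ × E3 => (α w.1).rep x w.2) w (1, 0) := by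
  have h1 := ((h x hx).of_le (m := 1) (by simp [ENat.LEInfty.out])).eventually (by simp)
  filter_upwards [h1, eventually_mem_target_prod hx t] with w hw hwt
  have hd := hw.differentiableAt (by simp)
  have hl : HasDerivAt (fun s : ℝ => (s, w.2)) ((1 : ℝ), (0 : E3)) w.1 :=
    (hasDerivAt_id w.1).prodMk (hasDerivAt_const _ _)
  have h2 := hd.hasFDerivAt.comp_hasDerivAt w.1 hl
  refine ⟨hd, ?_⟩
  rw [rep_dotAt hwt h2.differentiableAt]
  exact h2.deriv

theorem SmoothFamilyAt.dotAt (h : SmoothFamilyAt α t p) : SmoothFamilyAt (dotAt α) t p := by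
  intro x hx
  have h1 : ContDiffAt ℝ ∞ (fun w => fderiv ℝ (fun w : ℝ × E3 => (α w.1).rep x w.2) w (1, 0))
      (t, extChartAt (𝓡 3) x p) :=
    ((h x hx).fderiv_right (m := ∞) (by simp)).clm_apply contDiffAt_const
  exact h1.congr_of_eventuallyEq ((eventually_rep_dotAt h hx).mono fun w hw => hw.2)

/-- The exterior derivative commutes with the derivative with respect to the parameter. -/
theorem d_dotAt (h : SmoothFamilyAt α t p) :
    (Form.dotAt α t).d.val p = (Form.dotAt (fun t => (α t).d) t).val p := by
  have hx := mem_extChartAt_source (I := 𝓡 3) p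
  set y := extChartAt (𝓡 3) p p with hy
  have hev := eventually_rep_dotAt h hx
  have tr : Tendsto (fun y : E3 => (t, y)) (𝓝 y) (𝓝 (t, y)) :=
    Continuous.tendsto (f := fun y : E3 => (t, y)) (by fun_prop) y
  have e1 : (Form.dotAt α t).rep p =ᶠ[𝓝 y] fun y' =>
      fderiv ℝ (fun w : ℝ × E3 => (α w.1).rep p w.2) (t, y') (1, 0) :=
    (tr.eventually hev).mono fun y' hy' => hy'.2
  have f3 := hasDerivAt_fderiv_snd (h p hx)
  rw [← e1.fderiv_eq] at f3
  set L : (E3 →L[ℝ] Alt k) →L[ℝ] Alt (k + 1) :=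
    (pullL (k + 1) (dChart p p)).comp
      (ContinuousAlternatingMap.alternatizeUncurryFinCLM ℝ E3 ℂ) with hL
  exact (L.hasFDerivAt.comp_hasDerivAt t f3).deriv.symm

theorem val_dotAt_smul (c : ℂ) (h : SmoothFamilyAt α t p) :
    (Form.dotAt (fun t => c • α t) t).val p = c • (Form.dotAt α t).val p :=
  (h.hasDerivAt.const_smul c).deriv

theorem val_dotAt_const (α : Form M k) (t : ℝ) (p : M) : (Form.dotAt (fun _ => α) t).val p = 0 :=
  (hasDerivAt_const t (α.val p)).deriv

theorem val_dotAt_congr (h : ∀ᶠ s in 𝓝 t, (α s).val p = (β s).val p) :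
    (Form.dotAt α t).val p = (Form.dotAt β t).val p := EventuallyEq.deriv_eq h

theorem val_dotAt_sum {ι : Type*} (s : Finset ι) {α : ι → ℝ → Form M k}
    (h : ∀ i ∈ s, SmoothFamilyAt (α i) t p) :
    (Form.dotAt (fun t => ∑ i ∈ s, α i t) t).val p = ∑ i ∈ s, (Form.dotAt (α i) t).val p := by
  have e : (fun s' : ℝ => (∑ i ∈ s, α i s').val p) = fun s' => ∑ i ∈ s, (α i s').val p :=
    funext fun s' => val_sum s _ p
  rw [val_dotAt, e]
  exact (HasDerivAt.fun_sum fun i hi => (h i hi).hasDerivAt).deriv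

theorem val_dotAt_wedge {α : ℝ → Form M 1} (h : SmoothFamilyAt α t p)
    (h' : SmoothFamilyAt β t p) :
    (Form.dotAt (fun t => α t ⋏ β t) t).val p =
      covWedge ((Form.dotAt α t).val p) ((β t).val p) +
      covWedge ((α t).val p) ((Form.dotAt β t).val p) := by
  exact ((covWedgeL k).hasDerivAt_of_bilinear (fun _ => h.hasDerivAt)
    fun _ => h'.hasDerivAt).deriv.trans
    (add_comm (covWedge ((α t).val p) ((Form.dotAt β t).val p)) _)

end Form

/-! ### Differentiation under the integral sign -/

/-- Smoothness is assumed only at the parameter t₀, but at every point, and the support stays in a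
fixed compact set. This suffices for a bound on the derivative uniform in the parameter, hence for
dominated convergence. -/
theorem hasDerivAt_integral_of_compact {F : ℝ × E3 → ℂ} {t₀ : ℝ} {K : Set E3} (hK : IsCompact K)
    (hF : ∀ y, ContDiffAt ℝ 1 F (t₀, y)) (h0 : ∀ t, ∀ y ∉ K, F (t, y) = 0) :
    HasDerivAt (fun t => ∫ y, F (t, y)) (∫ y, deriv (fun t => F (t, y)) t₀) t₀ := by
  have hWo : IsOpen {w | ContDiffAt ℝ 1 F w} := by
    rw [isOpen_iff_mem_nhds]
    intro w hw
    exact ContDiffAt.eventually (n := 1) hw (by simp)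
  -- The tube lemma produces one neighbourhood of t₀ that works for all points of K.
  obtain ⟨u, v, hu, -, htu, hKv, huv⟩ := generalized_tube_lemma (isCompact_singleton (x := t₀)) hK
    hWo (by rintro ⟨t, y⟩ ⟨rfl, _⟩; exact hF y)
  obtain ⟨ε, hε, hεu⟩ := Metric.isOpen_iff.1 hu t₀ (htu rfl)
  have hs : ∀ t ∈ Metric.closedBall t₀ (ε / 2), ∀ y ∈ K, ContDiffAt ℝ 1 F (t, y) :=
    fun t ht y hy => huv ⟨hεu (Metric.closedBall_subset_ball (by linarith) ht), hKv hy⟩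
  have hl : ∀ (t : ℝ) (y : E3), HasDerivAt (fun s : ℝ => (s, y)) ((1 : ℝ), (0 : E3)) t :=
    fun t y => (hasDerivAt_id t).prodMk (hasDerivAt_const _ _)
  have hd : ∀ t ∈ Metric.closedBall t₀ (ε / 2), ∀ y ∈ K,
      HasDerivAt (fun t => F (t, y)) (fderiv ℝ F (t, y) (1, 0)) t := fun t ht y hy =>
    ((hs t ht y hy).differentiableAt (by simp)).hasFDerivAt.comp_hasDerivAt t (hl t y)
  have hz : ∀ t, ∀ y ∉ K, HasDerivAt (fun t => F (t, y)) 0 t := by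
    intro t y hy
    simp only [fun t => h0 t y hy]
    exact hasDerivAt_const t 0
  have hcont : ContinuousOn (fun w => fderiv ℝ F w (1, 0)) (Metric.closedBall t₀ (ε / 2) ×ˢ K) := by
    rintro ⟨t, y⟩ ⟨ht, hy⟩
    have := ((hs t ht y hy).fderiv_right (m := 0) (by simp)).continuousAt
    exact (this.clm_apply continuousAt_const).continuousWithinAt
  obtain ⟨C, hC⟩ := ((isCompact_closedBall t₀ (ε / 2)).prod hK).exists_bound_of_continuousOn hcont
  have hFm : ∀ t ∈ Metric.closedBall t₀ (ε / 2), ContinuousOn (fun y => F (t, y)) K := by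
    intro t ht y hy
    have : ContinuousAt (fun y => F (t, y)) y :=
      (hs t ht y hy).continuousAt.comp (f := fun y => (t, y)) (by fun_prop)
    exact this.continuousWithinAt
  have hind : ∀ f : E3 → ℂ, (∀ y ∉ K, f y = 0) → K.indicator f = f := by
    intro f hf
    ext y
    by_cases hy : y ∈ K
    · rw [indicator_of_mem hy]
    · rw [indicator_of_notMem hy, hf y hy]
  have hint : ∀ f : E3 → ℂ, ContinuousOn f K → (∀ y ∉ K, f y = 0) → Integrable f := by
    intro f hf hf0
    rw [← hind f hf0, integrable_indicator_iff hK.measurableSet]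
    exact hf.integrableOn_compact hK
  have hmem : t₀ ∈ Metric.closedBall t₀ (ε / 2) := Metric.mem_closedBall_self (by linarith)
  refine (hasDerivAt_integral_of_dominated_loc_of_deriv_le (F := fun t y => F (t, y))
    (F' := fun t y => deriv (fun t => F (t, y)) t) (s := Metric.closedBall t₀ (ε / 2))
    (bound := K.indicator fun _ => C) (Metric.closedBall_mem_nhds _ (by linarith)) ?_ ?_ ?_ ?_ ?_
    ?_).2
  · filter_upwards [Metric.closedBall_mem_nhds t₀ (half_pos hε)] with t ht
    exact (hint _ (hFm t ht) (h0 t)).aestronglyMeasurable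
  · exact hint _ (hFm t₀ hmem) (h0 t₀)
  · refine (hint _ ?_ fun y hy => (hz t₀ y hy).deriv).aestronglyMeasurable
    have : ContinuousOn (fun y => fderiv ℝ F (t₀, y) (1, 0)) K :=
      hcont.comp (f := fun y => (t₀, y)) (by fun_prop) fun y hy => ⟨hmem, hy⟩
    exact this.congr fun y hy => (hd t₀ hmem y hy).deriv
  · refine Eventually.of_forall fun y t ht => ?_
    by_cases hy : y ∈ K
    · rw [indicator_of_mem hy, (hd t ht y hy).deriv]
      exact hC (t, y) ⟨ht, hy⟩
    · rw [indicator_of_notMem hy, (hz t y hy).deriv, norm_zero]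
  · rw [integrable_indicator_iff hK.measurableSet]
    exact integrableOn_const hK.measure_lt_top.ne
  · refine Eventually.of_forall fun y t ht => ?_
    by_cases hy : y ∈ K
    · rw [(hd t ht y hy).deriv]
      exact hd t ht y hy
    · rw [(hz t y hy).deriv]
      exact hz t y hy

theorem Form.hasDerivAt_integral [CompactSpace M] [T2Space M] {α : ℝ → Form M 3} {t : ℝ}
    (hα : ∀ p, Form.SmoothFamilyAt α t p) :
    HasDerivAt (fun t => (α t).integral) (Form.dotAt α t).integral t := by
  simp only [Form.integral_eq_sum]
  refine HasDerivAt.fun_sum fun x _ => ?_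
  have hs : ∀ p, Form.SmoothFamilyAt (fun t => Form.fmul (cut x) (α t)) t p := fun p =>
    ((funSmoothAt_cut x p).family t).fmul' (hα p)
  have hv : ∀ t, (Form.fmul (cut x) (α t)).VanishesOff (cutSupport x) := fun t =>
    Form.vanishesOff_cut x (α t)
  have key := hasDerivAt_integral_of_compact
    (F := fun w : ℝ × E3 => c3 ((Form.fmul (cut x) (α w.1)).ext x w.2)) (t₀ := t)
    (Form.isCompact_image_chart (isCompact_cutSupport x) (cutSupport_subset x))
    (fun y => (contDiff_c3.contDiffAt.comp _ (Form.contDiffAt_ext_family (isCompact_cutSupport x)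
      (cutSupport_subset x) hs hv y)).of_le (by simp [ENat.LEInfty.out]))
    (fun t y hy => by rw [(hv t).ext_eq_zero hy, c3_zero])
  have e : Form.chartIntegral x (Form.fmul (cut x) (Form.dotAt α t)) =
      ∫ y, deriv (fun t => c3 ((Form.fmul (cut x) (α t)).ext x y)) t := by
    refine integral_congr_ae (Eventually.of_forall fun y => ?_)
    beta_reduce
    by_cases hy : y ∈ (extChartAt (𝓡 3) x).target
    · simp only [Form.ext_apply _ hy, Form.rep_fmul, c3_smul]
      have hd := (hα _).differentiableAt_rep (symm_mem_source hy)
      rw [(extChartAt (𝓡 3) x).right_inv hy] at hd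
      rw [Form.rep_dotAt hy hd]
      have h1 := (ContinuousAlternatingMap.apply ℝ E3 ℂ
        (fun i => stdE i)).hasFDerivAt.comp_hasDerivAt t hd.hasDerivAt
      exact (h1.const_mul _).deriv.symm
    · simp only [Form.ext, indicator_of_notMem hy, c3_zero, deriv_const]
  rw [e]
  exact key

/-! ### The first variation formula -/

/-- No sign appears, since moving a 1-form past a 2-form is an even permutation. -/
theorem tri_rot (a b c : Alt 1) : tri a b c = tri b c a := by
  simp only [tri, c3_w3, c2_w2]
  ring

theorem c3_sum {ι : Type*} (S : Finset ι) (f : ι → Alt 3) :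
    c3 (∑ i ∈ S, f i) = ∑ i ∈ S, c3 (f i) :=
  map_sum (ContinuousAlternatingMap.apply ℝ E3 ℂ (fun i => stdE i)) f S

theorem w3_add (a : Alt 1) (B C : Alt 2) : w3 a (B + C) = w3 a B + w3 a C :=
  covWedge_add_right a B C

theorem w3_sum {ι : Type*} (a : Alt 1) (S : Finset ι) (f : ι → Alt 2) :
    w3 a (∑ i ∈ S, f i) = ∑ i ∈ S, w3 a (f i) :=
  map_sum (covWedgeL 2 a) f S

theorem w3_zero (a : Alt 1) : w3 a 0 = 0 := (covWedgeL 2 a).map_zero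

/-- The trace of the product of three matrices of 1-covectors. -/
def tr3 (A B C : Fin 3 → Fin 3 → Alt 1) : ℂ := ∑ i, ∑ j, ∑ k, tri (A i j) (B j k) (C k i)

/-- The trace of the product of a matrix of 1-covectors and a matrix of 2-covectors. -/
def tr2 (A : Fin 3 → Fin 3 → Alt 1) (B : Fin 3 → Fin 3 → Alt 2) : ℂ :=
  ∑ i, ∑ j, c3 (w3 (A i j) (B j i))

theorem tr3_rot (A B C : Fin 3 → Fin 3 → Alt 1) : tr3 A B C = tr3 B C A := by
  unfold tr3
  rw [Finset.sum_comm]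
  refine Finset.sum_congr rfl fun j _ => ?_
  rw [Finset.sum_comm]
  exact Finset.sum_congr rfl fun k _ => Finset.sum_congr rfl fun i _ => tri_rot _ _ _

theorem tr2_add (A : Fin 3 → Fin 3 → Alt 1) (B C : Fin 3 → Fin 3 → Alt 2) :
    tr2 A (fun i j => B i j + C i j) = tr2 A B + tr2 A C := by
  simp only [tr2, w3_add, c3_add, Finset.sum_add_distrib]

theorem tr2_mul (A B C : Fin 3 → Fin 3 → Alt 1) :
    tr2 A (fun i j => ∑ k, w2 (B i k) (C k j)) = tr3 A B C := by
  simp only [tr2, tr3, tri, w3_sum, c3_sum]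

/-- The values of a matrix of 1-forms. -/
def matVal (A : Matrix (Fin 3) (Fin 3) (Form M 1)) (p : M) (i j : Fin 3) : Alt 1 := (A i j).val p

/-- The exterior derivative of a matrix of 1-forms. -/
def matD (A : Matrix (Fin 3) (Fin 3) (Form M 1)) (p : M) (i j : Fin 3) : Alt 2 := dv (A i j) p

/-- The derivative of a family of matrices of 1-forms. -/
def matDot (A : ℝ → Matrix (Fin 3) (Fin 3) (Form M 1)) (t : ℝ) :
    Matrix (Fin 3) (Fin 3) (Form M 1) := Matrix.of fun i j => Form.dotAt (fun t => A t i j) t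

theorem c3_trWedge (A : Matrix (Fin 3) (Fin 3) (Form M 1)) (B : Matrix (Fin 3) (Fin 3) (Form M 2))
    (p : M) : c3 ((trWedge A B).val p) = tr2 (matVal A p) (fun i j => (B i j).val p) := by
  unfold trWedge tr2
  rw [Form.val_sum, c3_sum]
  refine Finset.sum_congr rfl fun i _ => ?_
  rw [Form.val_sum, c3_sum]
  rfl

theorem val_wedgeSq (A : Matrix (Fin 3) (Fin 3) (Form M 1)) (p : M) (i j : Fin 3) :
    (wedgeSq A i j).val p = ∑ k, w2 (matVal A p i k) (matVal A p k j) := by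
  change (∑ k, A i k ⋏ A k j).val p = _
  rw [Form.val_sum]
  rfl

/-- The 3-form whose integral is the invariant. -/
def cubeForm (A : Matrix (Fin 3) (Fin 3) (Form M 1)) : Form M 3 := trWedge A (wedgeSq A)

theorem c3_cubeForm (A : Matrix (Fin 3) (Fin 3) (Form M 1)) (p : M) :
    c3 ((cubeForm A).val p) = tr3 (matVal A p) (matVal A p) (matVal A p) := by
  rw [cubeForm, c3_trWedge, ← tr2_mul]
  simp only [val_wedgeSq]

theorem smoothFamilyAt_trWedge {A : ℝ → Matrix (Fin 3) (Fin 3) (Form M 1)}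
    {B : ℝ → Matrix (Fin 3) (Fin 3) (Form M 2)} {t : ℝ} {p : M}
    (hA : ∀ i j, Form.SmoothFamilyAt (fun t => A t i j) t p)
    (hB : ∀ i j, Form.SmoothFamilyAt (fun t => B t i j) t p) :
    Form.SmoothFamilyAt (fun t => trWedge (A t) (B t)) t p :=
  Form.SmoothFamilyAt.sum (α := fun i t => ∑ j, A t i j ⋏ B t j i) fun i _ =>
    Form.SmoothFamilyAt.sum (α := fun j t => A t i j ⋏ B t j i) fun j _ => (hA i j).wedge (hB j i)

theorem smoothFamilyAt_wedgeSq {A : ℝ → Matrix (Fin 3) (Fin 3) (Form M 1)} {t : ℝ} {p : M}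
    (hA : ∀ i j, Form.SmoothFamilyAt (fun t => A t i j) t p) (i j : Fin 3) :
    Form.SmoothFamilyAt (fun t => wedgeSq (A t) i j) t p :=
  Form.SmoothFamilyAt.sum (s := Finset.univ) (α := fun k t => A t i k ⋏ A t k j) fun k _ =>
    (hA i k).wedge (hA k j)

/-! ### The derivative of tr(π ∧ π ∧ π) -/

section variation
variable {A : ℝ → Matrix (Fin 3) (Fin 3) (Form M 1)} {t : ℝ} {p : M}

theorem c3_dotAt_trWedge {B : ℝ → Matrix (Fin 3) (Fin 3) (Form M 2)}
    (hA : ∀ i j, Form.SmoothFamilyAt (fun t => A t i j) t p)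
    (hB : ∀ i j, Form.SmoothFamilyAt (fun t => B t i j) t p) :
    c3 ((Form.dotAt (fun t => trWedge (A t) (B t)) t).val p) =
      tr2 (matVal (matDot A t) p) (fun i j => (B t i j).val p) +
      tr2 (matVal (A t) p) (fun i j => (Form.dotAt (fun t => B t i j) t).val p) := by
  have e1 : ∀ i, (Form.dotAt (fun t => ∑ j, A t i j ⋏ B t j i) t).val p =
      ∑ j, (w3 (matVal (matDot A t) p i j) ((B t j i).val p) +
        w3 (matVal (A t) p i j) ((Form.dotAt (fun t => B t j i) t).val p)) := by
    intro i
    rw [Form.val_dotAt_sum (α := fun j t => A t i j ⋏ B t j i) _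
      fun j _ => (hA i j).wedge (hB j i)]
    exact Finset.sum_congr rfl fun j _ => Form.val_dotAt_wedge (hA i j) (hB j i)
  have e2 : (Form.dotAt (fun t => trWedge (A t) (B t)) t).val p =
      ∑ i, (Form.dotAt (fun t => ∑ j, A t i j ⋏ B t j i) t).val p :=
    Form.val_dotAt_sum (α := fun i t => ∑ j, A t i j ⋏ B t j i) _ fun i _ =>
      Form.SmoothFamilyAt.sum (α := fun j t => A t i j ⋏ B t j i) fun j _ =>
        (hA i j).wedge (hB j i)
  rw [e2, c3_sum]
  simp only [tr2, ← Finset.sum_add_distrib]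
  refine Finset.sum_congr rfl fun i _ => ?_
  rw [e1, c3_sum]
  exact Finset.sum_congr rfl fun j _ => c3_add _ _

/-- The product rule gives three terms, which agree by cyclicity of the trace. -/
theorem c3_dotAt_cubeForm (hA : ∀ i j, Form.SmoothFamilyAt (fun t => A t i j) t p) :
    c3 ((Form.dotAt (fun t => cubeForm (A t)) t).val p) =
      3 * tr3 (matVal (matDot A t) p) (matVal (A t) p) (matVal (A t) p) := by
  have e : ∀ i j, (Form.dotAt (fun t => wedgeSq (A t) i j) t).val p =
      (∑ k, w2 (matVal (matDot A t) p i k) (matVal (A t) p k j)) +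
        ∑ k, w2 (matVal (A t) p i k) (matVal (matDot A t) p k j) := by
    intro i j
    have := Form.val_dotAt_sum (α := fun k t => A t i k ⋏ A t k j) (p := p) (t := t) Finset.univ
      fun k _ => (hA i k).wedge (hA k j)
    refine this.trans ?_
    rw [← Finset.sum_add_distrib]
    exact Finset.sum_congr rfl fun k _ => Form.val_dotAt_wedge (hA i k) (hA k j)
  have := c3_dotAt_trWedge hA (smoothFamilyAt_wedgeSq hA)
  simp only [val_wedgeSq, e, tr2_add, tr2_mul] at this
  rw [← tr3_rot (matVal (matDot A t) p), tr3_rot (matVal (A t) p) (matVal (matDot A t) p)] at this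
  exact this.trans (by ring)

/-- The boundary term in the variation formula. -/
def traceForm (A B : Matrix (Fin 3) (Fin 3) (Form M 1)) : Form M 2 := ∑ i, ∑ j, A i j ⋏ B j i

theorem dv₂_sum {S : Finset (Fin 3)} {η : Fin 3 → Form M 2} (h : ∀ i, (η i).SmoothAt p) :
    dv₂ (∑ i ∈ S, η i) p = ∑ i ∈ S, dv₂ (η i) p := by
  classical
  induction S using Finset.induction_on with
  | empty => exact Form.d_zero
  | insert a S ha ih =>
    rw [Finset.sum_insert ha, Finset.sum_insert ha, dv₂_add (h a), ih]
    exact (Form.SmoothFamilyAt.sum (α := fun i _ => η i) (t := 0) fun i _ =>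
        (h i).family 0).slice

theorem smoothAt_traceForm {A B : Matrix (Fin 3) (Fin 3) (Form M 1)}
    (hA : ∀ i j, (A i j).SmoothAt p) (hB : ∀ i j, (B i j).SmoothAt p) :
    (traceForm A B).SmoothAt p :=
  (Form.SmoothFamilyAt.sum (α := fun i (_ : ℝ) => ∑ j, A i j ⋏ B j i) (t := 0) fun i _ =>
    Form.SmoothFamilyAt.sum (α := fun j (_ : ℝ) => A i j ⋏ B j i) fun j _ =>
      ((hA i j).wedge (hB j i)).family 0).slice

/-- Applied to π̇ and π, this is d tr(π̇ ∧ π) = tr(π ∧ dπ̇) - tr(π̇ ∧ dπ), which lets the derivative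
be moved from π̇ to π under the integral. -/
theorem c3_d_traceForm {A B : Matrix (Fin 3) (Fin 3) (Form M 1)}
    (hA : ∀ i j, (A i j).SmoothAt p) (hB : ∀ i j, (B i j).SmoothAt p) :
    c3 ((traceForm A B).d.val p) = tr2 (matVal B p) (matD A p) - tr2 (matVal A p) (matD B p) := by
  have e1 : ∀ i, dv₂ (∑ j, A i j ⋏ B j i) p =
      ∑ j, (w3 ((B j i).val p) (dv (A i j) p) - w3 ((A i j).val p) (dv (B j i) p)) := by
    intro i
    rw [dv₂_sum fun j => (hA i j).wedge (hB j i)]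
    exact Finset.sum_congr rfl fun j _ => dv₂_wedge (hA i j) (hB j i)
  have e2 : (traceForm A B).d.val p = ∑ i, dv₂ (∑ j, A i j ⋏ B j i) p :=
    dv₂_sum fun i => (Form.SmoothFamilyAt.sum (α := fun j (_ : ℝ) => A i j ⋏ B j i) (t := 0)
      fun j _ => ((hA i j).wedge (hB j i)).family 0).slice
  rw [e2]
  simp only [e1, c3_sum, c3_sub, Finset.sum_sub_distrib, tr2]
  congr 1
  exact Finset.sum_comm

theorem tr2_curvAt (B : Matrix (Fin 3) (Fin 3) (Form M 1)) (D : Fin 3 → Fin 3 → Alt 1) (p : M) :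
    tr2 D (curvAt B p) = tr2 D (matD B p) + tr3 D (matVal B p) (matVal B p) := by
  rw [← tr2_mul, ← tr2_add]
  rfl

/-- The variation of `tr(π ∧ π ∧ π)` when `tr(π ∧ Π) = 0` all along. -/
theorem c3_dotAt_cubeForm_eq (hA : ∀ i j, Form.SmoothFamilyAt (fun t => A t i j) t p)
    (h0 : ∀ᶠ s in 𝓝 t, tr2 (matVal (A s) p) (curvAt (A s) p) = 0) :
    c3 ((Form.dotAt (fun t => cubeForm (A t)) t).val p) =
      -6 * tr2 (matVal (matDot A t) p) (curvAt (A t) p) -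
        3 * c3 ((traceForm (matDot A t) (A t)).d.val p) := by
  have hD : ∀ i j, (matDot A t i j).SmoothAt p := fun i j => (hA i j).dotAt.slice
  have hP : ∀ i j, (A t i j).SmoothAt p := fun i j => (hA i j).slice
  have h1 := c3_dotAt_cubeForm hA
  have h2 : c3 ((Form.dotAt (fun t => cubeForm (A t)) t).val p) =
      -(tr2 (matVal (matDot A t) p) (matD (A t) p) +
        tr2 (matVal (A t) p) (matD (matDot A t) p)) := by
    have hdA : ∀ i j, Form.SmoothFamilyAt
        (fun t => (Matrix.of fun i j => (A t i j).d : Matrix (Fin 3) (Fin 3) (Form M 2)) i j) t p :=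
      fun i j => (hA i j).d
    have k := c3_dotAt_trWedge hA hdA
    -- For all nearby parameters tr(π ∧ Π) = 0 turns tr π³ into -tr(π ∧ dπ), so the derivative may
    -- be computed from either expression.
    have e : (Form.dotAt (fun t => cubeForm (A t)) t).val p =
        (Form.dotAt (fun t => (-1 : ℂ) • trWedge (A t) (Matrix.of fun i j => (A t i j).d)) t).val
          p := by
      refine Form.val_dotAt_congr ?_
      filter_upwards [h0] with s hs
      apply alt3_ext
      rw [c3_cubeForm, Form.val_smul, c3_smul, c3_trWedge]
      rw [tr2_curvAt] at hs
      have : tr2 (matVal (A s) p) (fun i j => (Matrix.of (fun i j => (A s i j).d) i j).val p) =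
        tr2 (matVal (A s) p) (matD (A s) p) := rfl
      rw [this]
      linear_combination hs
    rw [e, Form.val_dotAt_smul _ (smoothFamilyAt_trWedge hA hdA), c3_smul, k, neg_one_mul]
    congr 2
    have : ∀ i j, (Form.dotAt (fun t =>
        (Matrix.of fun i j => (A t i j).d : Matrix (Fin 3) (Fin 3) (Form M 2)) i j) t).val p =
        matD (matDot A t) p i j := fun i j => (Form.d_dotAt (hA i j)).symm
    simp only [this]
  rw [c3_d_traceForm hD hP, tr2_curvAt]
  -- The two expressions for the derivative are combined with weights 3 and -2. The weights add to
  -- 1, and they make the tr(π̇ ∧ dπ) and tr(π̇ ∧ π ∧ π) terms enter with the same factor -6, once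
  -- the exact form is split off.
  linear_combination 3 * h2 - 2 * h1

end variation

namespace Coframe

/-- The curvature of the adapted connection satisfies `tr(π ∧ Π) = 0`. -/
theorem IsFramed.tr2_curvAt {s : Coframe M} (h : s.IsFramed) (p : M) :
    tr2 (matVal s.connection p) (curvAt s.connection p) = 0 := by
  have hs := (h p).1
  have hc := h.adapted_smoothAt p
  have hf := (h p).2
  have ha := h.adaptedAt p
  obtain ⟨b1, -, b3⟩ := bianchi hs hc (Eventually.of_forall fun q => (h q).2)
    (Eventually.of_forall fun q => h.adaptedAt q)
  obtain ⟨q, hq⟩ := curvAt_12 hs hc ha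
  have z : ∀ {i j : Fin 3}, j ≤ i → curvAt (connMatrix s s.adapted) p i j = 0 := fun hij =>
    curvAt_eq_zero hs hc hf ha hij
  rw [h.connection]
  simp only [tr2, Fin.sum_univ_three, z (show (0 : Fin 3) ≤ 0 by decide),
    z (show (0 : Fin 3) ≤ 1 by decide), z (show (0 : Fin 3) ≤ 2 by decide),
    z (show (1 : Fin 3) ≤ 1 by decide), z (show (1 : Fin 3) ≤ 2 by decide),
    z (show (2 : Fin 3) ≤ 2 by decide), hq, w3_zero, c3_zero, matVal, connMatrix_10, connMatrix_20,
    connMatrix_21, b1, Form.val_smul]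
  -- What remains is θ₁ ∧ Π₀₁ + 2θ ∧ Π₀₂ + 2θ₂ ∧ Π₁₂. The first two terms vanish by Bianchi, and the
  -- last because Π₁₂ is a multiple of θ ∧ θ₂.
  simp only [c3_w3, c1_smul, c2_smul, c2_w2] at b3 ⊢
  linear_combination 2 * b3

theorem IsFramed.smoothAt_connection {s : Coframe M} (h : s.IsFramed) (i j : Fin 3) (p : M) :
    (s.connection i j).SmoothAt p := by
  rw [h.connection]
  exact smoothAt_connMatrix (h p).1 (h.adapted_smoothAt p) i j

variable [CompactSpace M] [T2Space M]

theorem smoothAt_trWedge_curvature {s : Coframe M} (h : s.IsFramed)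
    {D : Matrix (Fin 3) (Fin 3) (Form M 1)} {p : M} (hD : ∀ i j, (D i j).SmoothAt p) :
    (trWedge D s.curvature).SmoothAt p := by
  refine (smoothFamilyAt_trWedge (A := fun _ => D) (B := fun _ => s.curvature) (t := 0)
    (fun i j => (hD i j).family 0) fun i j => ?_).slice
  have hc := fun i j => h.smoothAt_connection i j p
  refine ((hc i j).d.family 0).add ?_
  exact Form.SmoothFamilyAt.sum (α := fun k _ => s.connection i k ⋏ s.connection k j) fun k _ =>
    ((hc i k).wedge (hc k j)).family 0

/-- **First variation formula**, for smooth families of coframes. -/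
theorem hasDerivAt_muIntegral (hM : IsOrientedAtlas M) {s : ℝ → Coframe M} {t : ℝ}
    (hs : ∀ p, SmoothFamilyAt s t p) (h : ∀ᶠ t' in 𝓝 t, (s t').IsFramed) :
    HasDerivAt (fun t => (s t).muIntegral)
      (-(1 / (4 * (Real.pi : ℂ) ^ 2)) *
        (trWedge (matDot (fun t => (s t).connection) t) (s t).curvature).integral) t := by
  have hA : ∀ p i j, Form.SmoothFamilyAt (fun t => (s t).connection i j) t p := fun p =>
    smoothFamilyAt_connection h (hs p)
  have hD : ∀ p i j, (matDot (fun t => (s t).connection) t i j).SmoothAt p := fun p i j =>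
    (hA p i j).dotAt.slice
  have hP : ∀ p i j, ((s t).connection i j).SmoothAt p := fun p i j => (hA p i j).slice
  have hη : ∀ p, (traceForm (matDot (fun t => (s t).connection) t) (s t).connection).SmoothAt p :=
    fun p => smoothAt_traceForm (hD p) (hP p)
  have hst : (s t).IsFramed := h.self_of_nhds
  have hcurv : ∀ p, (trWedge (matDot (fun t => (s t).connection) t) (s t).curvature).SmoothAt p :=
    fun p => smoothAt_trWedge_curvature hst (hD p)
  have key := Form.hasDerivAt_integral (α := fun t => cubeForm (s t).connection) (t := t)
    fun p => smoothFamilyAt_trWedge (hA p) (smoothFamilyAt_wedgeSq (hA p))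
  have e : Form.dotAt (fun t => cubeForm (s t).connection) t =
      (-6 : ℂ) • trWedge (matDot (fun t => (s t).connection) t) (s t).curvature +
      (-3 : ℂ) • (traceForm (matDot (fun t => (s t).connection) t) (s t).connection).d := by
    refine Form.ext_val fun p => alt3_ext ?_
    rw [c3_dotAt_cubeForm_eq (hA p) (h.mono fun t' ht' => ht'.tr2_curvAt p), Form.val_add, c3_add,
      Form.val_smul, Form.val_smul, c3_smul, c3_smul, c3_trWedge]
    simp only [val_curvature]
    ring
  -- The exact term has integral zero by Stokes; the constant is then -6/24 = -1/4.
  rw [e, Form.integral_add (fun p => (hcurv p).smul _) (fun p => (hη p).d.smul _), Form.integral_smul,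
    Form.integral_smul, Form.integral_d hM hη, mul_zero, add_zero] at key
  refine (key.const_mul (1 / (24 * (Real.pi : ℂ) ^ 2))).congr_deriv ?_
  have : (Real.pi : ℂ) ≠ 0 := by exact_mod_cast Real.pi_ne_zero
  field_simp
  ring

end Coframe

/-! ### Independence of the section -/

/-- Cyclicity groups the terms of the trace in threes. Diagonal entries enter only through their
differences, since scalar matrices commute with everything. This keeps the computation for rescaled
coframes manageable. -/
theorem tr3_self (P : Fin 3 → Fin 3 → Alt 1) : tr3 P P P =
    3 * (tri (P 0 1) (P 1 2) (P 2 0) + tri (P 0 2) (P 2 1) (P 1 0) +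
      tri (P 0 0 - P 1 1) (P 0 1) (P 1 0) + tri (P 0 0 - P 2 2) (P 0 2) (P 2 0) +
      tri (P 1 1 - P 2 2) (P 1 2) (P 2 1)) := by
  simp only [tr3, Fin.sum_univ_three, tri, c3_w3, c2_w2, c1_sub]
  ring

namespace Coframe
variable {s s' : Coframe M}

/-- The affine path between two coframes. -/
def segment (s s' : Coframe M) (τ : ℝ) : Coframe M where
  θ := s.θ
  θ₁ := s.θ₁ + (τ : ℂ) • (s'.θ₁ - s.θ₁)
  θ₂ := s.θ₂ + (τ : ℂ) • (s'.θ₂ - s.θ₂)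
  φ := s.φ + (τ : ℂ) • (s'.φ - s.φ)

theorem segment_zero : segment s s' 0 = s := by
  have z : ∀ α : Form M 1, ((0 : ℝ) : ℂ) • α = 0 := fun α => by
    rw [Complex.ofReal_zero]
    exact zero_smul ℂ α
  cases s
  simp only [segment, z, add_zero]

theorem segment_one (h : s'.θ = s.θ) : segment s s' 1 = s' := by
  cases s; cases s'
  simp only at h
  subst h
  simp [segment]

theorem smoothFamilyAt_segment {τ : ℝ} {p : M} (h : s.SmoothAt p) (h' : s'.SmoothAt p) :
    SmoothFamilyAt (segment s s') τ p := by
  have key : ∀ {α β : Form M 1}, α.SmoothAt p → β.SmoothAt p →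
      Form.SmoothFamilyAt (fun τ : ℝ => α + (τ : ℂ) • (β - α)) τ p := by
    intro α β hα hβ
    refine (hα.family τ).add ?_
    exact (funSmoothFamilyAt_param Complex.ofRealCLM.contDiff).fmul' ((hβ.sub hα).family τ)
  exact ⟨h.θ.family τ, key h.θ₁ h'.θ₁, key h.θ₂ h'.θ₂, key h.φ h'.φ⟩

/-- As θ ∧ θ = 0 and θ₁, θ₂ only move by multiples of θ, the product θ₁ ∧ θ₂ is affine along the
segment, as is θ ∧ φ. So the equation for dθ at the two ends implies it in between. -/
theorem isFramed_segment (h : s.IsFramed) (h' : s'.IsFramed) (h0 : s'.θ = s.θ)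
    (h1 : ∀ p, ∃ u : ℂ, s'.θ₁.val p = s.θ₁.val p + u • s.θ.val p)
    (h2 : ∀ p, ∃ v : ℂ, s'.θ₂.val p = s.θ₂.val p + v • s.θ.val p) (τ : ℝ) :
    (segment s s' τ).IsFramed := by
  intro p
  obtain ⟨u, hu⟩ := h1 p
  obtain ⟨v, hv⟩ := h2 p
  have e0 : (segment s s' τ).θ.val p = s.θ.val p := rfl
  have e1 : (segment s s' τ).θ₁.val p =
      s.θ₁.val p + (τ : ℂ) • (s'.θ₁.val p - s.θ₁.val p) := rfl
  have e2 : (segment s s' τ).θ₂.val p =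
      s.θ₂.val p + (τ : ℂ) • (s'.θ₂.val p - s.θ₂.val p) := rfl
  have e3 : (segment s s' τ).φ.val p =
      s.φ.val p + (τ : ℂ) • (s'.φ.val p - s.φ.val p) := rfl
  rw [hu] at e1
  rw [hv] at e2
  refine ⟨(smoothFamilyAt_segment (h p).1 (h' p).1).slice, ?_, ?_⟩
  · rw [e0, e1, e2]
    have : tri (s.θ.val p) (s.θ₁.val p + (τ : ℂ) • (s.θ₁.val p + u • s.θ.val p - s.θ₁.val p))
        (s.θ₂.val p + (τ : ℂ) • (s.θ₂.val p + v • s.θ.val p - s.θ₂.val p)) =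
        tri (s.θ.val p) (s.θ₁.val p) (s.θ₂.val p) := by
      simp only [tri, c3_w3, c2_w2, c1_add, c1_smul, c1_sub]
      ring
    rw [this]
    exact (h p).2.vol_ne
  · have k := (h p).2.d_θ
    have k' := (h' p).2.d_θ
    rw [h0, hu, hv] at k'
    -- The same dθ is written as a weighted sum of two copies, so that the structure equation of `s`
    -- is used for the first and that of `s'` for the second.
    have e4 : dv (segment s s' τ).θ p = (1 - τ : ℂ) • dv s.θ p + (τ : ℂ) • dv s.θ p := by
      change dv s.θ p = _
      module
    rw [e4]
    nth_rewrite 1 [k]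
    rw [k', e0, e1, e2, e3]
    apply alt2_ext <;>
      (simp only [c2_w2, c2_add, c2_smul, c1_add, c1_smul, c1_sub]; ring)

variable [CompactSpace M] [T2Space M]

/-- The invariant does not change under unipotent changes of the coframe. -/
theorem muIntegral_eq_of_unipotent (hM : IsOrientedAtlas M) (h : s.IsFramed) (h' : s'.IsFramed)
    (h0 : s'.θ = s.θ) (h1 : ∀ p, ∃ u : ℂ, s'.θ₁.val p = s.θ₁.val p + u • s.θ.val p)
    (h2 : ∀ p, ∃ v : ℂ, s'.θ₂.val p = s.θ₂.val p + v • s.θ.val p) :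
    s'.muIntegral = s.muIntegral := by
  have hf := isFramed_segment h h' h0 h1 h2
  have hder : ∀ τ, HasDerivAt (fun τ => (segment s s' τ).muIntegral) 0 τ := by
    intro τ
    refine (hasDerivAt_muIntegral hM
      (fun p => smoothFamilyAt_segment (s := s) (s' := s') (h p).1 (h' p).1)
      (Eventually.of_forall hf)).congr_deriv ?_
    have hz : trWedge (matDot (fun τ => (segment s s' τ).connection) τ)
        (segment s s' τ).curvature = 0 := by
      refine Form.ext_val fun p => alt3_ext ?_
      obtain ⟨u, hu⟩ := h1 p
      obtain ⟨v, hv⟩ := h2 p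
      set D := matDot (fun τ => (segment s s' τ).connection) τ with hD
      have key : ∀ (α β : Form M 1), HasDerivAt (fun τ : ℝ => α.val p + (τ : ℂ) • β.val p)
          (β.val p) τ := by
        intro α β
        have h1 : HasDerivAt (fun τ : ℝ => (τ : ℂ)) 1 τ := Complex.ofRealCLM.hasDerivAt
        exact ((h1.smul_const (β.val p)).const_add (α.val p)).congr_deriv (one_smul ℂ (β.val p))
      -- A strictly upper triangular Π meets only the entries of π̇ below the diagonal, and these
      -- involve no derivatives: they are 0, uθ and 2vθ.
      have d0 : matVal D p 2 0 = 0 := Form.val_dotAt_const ((2 : ℂ) • s.θ) τ p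
      have d1 : matVal D p 1 0 = u • s.θ.val p := by
        have := (key s.θ₁ (s'.θ₁ - s.θ₁)).deriv
        refine Eq.trans this ?_
        rw [Form.val_sub, hu]
        abel
      have d2 : matVal D p 2 1 = (2 : ℂ) • v • s.θ.val p := by
        have := ((key s.θ₂ (s'.θ₂ - s.θ₂)).const_smul (2 : ℂ)).deriv
        refine Eq.trans this ?_
        rw [Form.val_sub, hv]
        congr 1
        abel
      have hs := (hf τ p).1
      have hc := (hf τ).adapted_smoothAt p
      have ha := (hf τ).adaptedAt p
      obtain ⟨-, b2, -⟩ := bianchi hs hc (Eventually.of_forall fun q => (hf τ q).2)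
        (Eventually.of_forall fun q => (hf τ).adaptedAt q)
      obtain ⟨q, hq⟩ := curvAt_12 hs hc ha
      have z : ∀ {i j : Fin 3}, j ≤ i → curvAt (connMatrix (segment s s' τ)
          (segment s s' τ).adapted) p i j = 0 := fun hij =>
        curvAt_eq_zero hs hc (hf τ p).2 ha hij
      rw [c3_trWedge]
      simp only [val_curvature, (hf τ).connection]
      simp only [tr2, Fin.sum_univ_three, z (show (0 : Fin 3) ≤ 0 by decide),
        z (show (0 : Fin 3) ≤ 1 by decide), z (show (0 : Fin 3) ≤ 2 by decide),
        z (show (1 : Fin 3) ≤ 1 by decide), z (show (1 : Fin 3) ≤ 2 by decide),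
        z (show (2 : Fin 3) ≤ 2 by decide), hq, w3_zero, c3_zero, d0, d1, d2, Form.val_zero]
      have e0 : (segment s s' τ).θ.val p = s.θ.val p := rfl
      rw [e0] at b2 ⊢
      simp only [c3_w3, c1_smul, c2_smul, c2_w2, c1_zero] at b2 ⊢
      -- The trace is uθ ∧ Π₀₁ plus a multiple of θ ∧ θ ∧ θ₂. The first term vanishes by Bianchi.
      linear_combination u * b2
    rw [hz, Form.integral_zero, mul_zero]
  have := is_const_of_deriv_eq_zero (f := fun τ => (segment s s' τ).muIntegral)
    (fun τ => (hder τ).differentiableAt) (fun τ => (hder τ).deriv) 1 0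
  simpa only [segment_zero, segment_one h0] using this

end Coframe

/-! ### Rescaling of a section -/

/-- The logarithmic differential of a function. -/
def dLog (f : M → ℂ) : Form M 1 := Form.fmul (fun p => (f p)⁻¹) (dFun f)

section dLog
variable {f : M → ℂ} {p : M}

theorem smoothAt_dLog (hf : FunSmoothAt f p) (h0 : f p ≠ 0) : (dLog f).SmoothAt p :=
  (hf.inv h0).fmul' hf.dFun

theorem val_dFun_eq (h0 : f p ≠ 0) : (dFun f).val p = f p • (dLog f).val p :=
  (smul_inv_smul₀ (β := Alt 1) h0 ((dFun f).val p)).symm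

/-- Differentiating df = f · (df/f) gives 0 = df ∧ (df/f) + f d(df/f), and the first term is zero.
No branch of the logarithm is needed. -/
theorem dv_dLog (hf : ∀ p, FunSmoothAt f p) (h0 : ∀ p, f p ≠ 0) : dv (dLog f) p = 0 := by
  have h1 : dv (dFun f) p = dv (Form.fmul f (dLog f)) p :=
    dv_congr (Eventually.of_forall fun q => val_dFun_eq (h0 q))
  rw [dv_dFun (hf p), dv_fmul (hf p) (smoothAt_dLog (hf p) (h0 p)), val_dFun_eq (h0 p)] at h1
  have h2 : f p • dv (dLog f) p = 0 := by
    have h3 : w2 (f p • (dLog f).val p) ((dLog f).val p) = 0 := by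
      apply alt2_ext <;> (simp only [c2_w2, c1_smul, c2_zero]; ring)
    rw [h3, zero_add] at h1
    exact h1.symm
  exact (smul_eq_zero (M := Alt 2).1 h2).resolve_left (h0 p)

theorem dv_fmul_dLog {α : Form M 1} (hf : FunSmoothAt f p) (h0 : f p ≠ 0) (h : α.SmoothAt p) :
    dv (Form.fmul f α) p = f p • (w2 ((dLog f).val p) (α.val p) + dv α p) := by
  rw [dv_fmul hf h, val_dFun_eq h0]
  apply alt2_ext <;> (simp only [c2_w2, c1_smul, c2_add, c2_smul]; ring)

/-- Apply the product rule to α = f · (f⁻¹ α), which avoids differentiating the inverse function. -/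
theorem dv_fmul_inv {α : Form M 1} (hf : ∀ p, FunSmoothAt f p) (h0 : ∀ p, f p ≠ 0)
    (h : α.SmoothAt p) : dv (Form.fmul (fun p => (f p)⁻¹) α) p =
      (f p)⁻¹ • (dv α p - w2 ((dLog f).val p) (α.val p)) := by
  have hs : (Form.fmul (fun p => (f p)⁻¹) α).SmoothAt p := ((hf p).inv (h0 p)).fmul' h
  have h1 : dv α p = dv (Form.fmul f (Form.fmul (fun p => (f p)⁻¹) α)) p :=
    dv_congr (Eventually.of_forall fun q => (smul_inv_smul₀ (β := Alt 1) (h0 q) (α.val q)).symm)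
  rw [h1, dv_fmul_dLog (hf p) (h0 p) hs, Form.val_fmul]
  have := h0 p
  apply alt2_ext <;> (simp only [c2_w2, c1_smul, c2_add, c2_sub, c2_smul]; field_simp; ring)

end dLog

namespace Coframe

/-- The coframe rescaled by `μ₁` and `μ₂`. -/
def scale (μ₁ μ₂ : M → ℂ) (s : Coframe M) : Coframe M where
  θ := Form.fmul μ₁ (Form.fmul μ₂ s.θ)
  θ₁ := Form.fmul μ₁ s.θ₁
  θ₂ := Form.fmul μ₂ s.θ₂
  φ := s.φ - dLog μ₁ - dLog μ₂

/-- The connection forms of a rescaled coframe. -/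
def _root_.FlagGeometry.ConnectionForms.scale (μ₁ μ₂ : M → ℂ) (c : ConnectionForms M) :
    ConnectionForms M where
  ω₁₁ := c.ω₁₁ - (1 / 2 : ℂ) • dLog μ₁ + (1 / 2 : ℂ) • dLog μ₂
  φ₁ := Form.fmul (fun p => (μ₂ p)⁻¹) c.φ₁
  φ₂ := Form.fmul (fun p => (μ₁ p)⁻¹) c.φ₂
  ψ := Form.fmul (fun p => (μ₁ p)⁻¹) (Form.fmul (fun p => (μ₂ p)⁻¹) c.ψ)

section scale
variable {s : Coframe M} {c : ConnectionForms M} {μ₁ μ₂ : M → ℂ} {p : M}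
  (hμ₁ : ∀ p, FunSmoothAt μ₁ p) (hμ₂ : ∀ p, FunSmoothAt μ₂ p) (h₁ : ∀ p, μ₁ p ≠ 0)
  (h₂ : ∀ p, μ₂ p ≠ 0)
include hμ₁ hμ₂ h₁ h₂

theorem SmoothAt.scale (hs : s.SmoothAt p) : (scale μ₁ μ₂ s).SmoothAt p :=
  ⟨(hμ₁ p).fmul' ((hμ₂ p).fmul' hs.θ), (hμ₁ p).fmul' hs.θ₁, (hμ₂ p).fmul' hs.θ₂,
    (hs.φ.sub (smoothAt_dLog (hμ₁ p) (h₁ p))).sub (smoothAt_dLog (hμ₂ p) (h₂ p))⟩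

theorem smoothAt_scale_connectionForms (hc : c.SmoothAt p) : (c.scale μ₁ μ₂).SmoothAt p :=
  ⟨(hc.ω₁₁.sub ((smoothAt_dLog (hμ₁ p) (h₁ p)).smul _)).add
      ((smoothAt_dLog (hμ₂ p) (h₂ p)).smul _),
    ((hμ₂ p).inv (h₂ p)).fmul' hc.φ₁, ((hμ₁ p).inv (h₁ p)).fmul' hc.φ₂,
    ((hμ₁ p).inv (h₁ p)).fmul' (((hμ₂ p).inv (h₂ p)).fmul' hc.ψ)⟩

/-- The factor μ₁μ₂ of θ is forced by θ₁ ∧ θ₂, and the logarithmic differentials in φ absorb the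
derivative of that factor. -/
theorem IsFramed.scale (hs : s.IsFramed) : (scale μ₁ μ₂ s).IsFramed := by
  intro p
  have hp := (hs p).1
  have n₁ := h₁ p
  have n₂ := h₂ p
  refine ⟨(hs p).1.scale hμ₁ hμ₂ h₁ h₂, ?_, ?_⟩
  · have : tri ((Coframe.scale μ₁ μ₂ s).θ.val p) ((Coframe.scale μ₁ μ₂ s).θ₁.val p)
        ((Coframe.scale μ₁ μ₂ s).θ₂.val p) =
        (μ₁ p * μ₂ p) ^ 2 * tri (s.θ.val p) (s.θ₁.val p) (s.θ₂.val p) := by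
      simp only [Coframe.scale, Form.val_fmul, tri, c3_w3, c2_w2, c1_smul]
      ring
    rw [this]
    exact mul_ne_zero (pow_ne_zero _ (mul_ne_zero n₁ n₂)) (hs p).2.vol_ne
  · change dv (Form.fmul μ₁ (Form.fmul μ₂ s.θ)) p = _
    rw [dv_fmul_dLog (hμ₁ p) n₁ ((hμ₂ p).fmul' hp.θ), dv_fmul_dLog (hμ₂ p) n₂ hp.θ, (hs p).2.d_θ]
    apply alt2_ext <;>
      (simp only [Coframe.scale, Form.val_fmul, Form.val_sub, c2_w2, c2_add, c2_smul, c1_smul,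
        c1_sub]; ring)

theorem AdaptedAt.scale (hs : s.SmoothAt p) (hc : c.SmoothAt p) (h : s.AdaptedAt c p) :
    (scale μ₁ μ₂ s).AdaptedAt (c.scale μ₁ μ₂) p := by
  have n₁ := h₁ p
  have n₂ := h₂ p
  have l₁ := smoothAt_dLog (hμ₁ p) n₁
  have l₂ := smoothAt_dLog (hμ₂ p) n₂
  obtain ⟨q, hq⟩ := h.d_φ₁
  rw [sub_eq_iff_eq_add, sub_eq_iff_eq_add, sub_eq_iff_eq_add] at hq
  -- The last structure equation is multiplied by μ₂⁻¹ while θ ∧ θ₂ is multiplied by μ₁μ₂², so the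
  -- coefficient acquires μ₁⁻¹μ₂⁻³.
  refine ⟨?_, ?_, ?_, ?_, q * (μ₁ p)⁻¹ * (μ₂ p)⁻¹ ^ 3, ?_⟩
  · change dv (Form.fmul μ₁ s.θ₁) p = _
    rw [dv_fmul_dLog (hμ₁ p) n₁ hs.θ₁, h.d_θ₁]
    apply alt2_ext <;>
      (simp only [Coframe.scale, ConnectionForms.scale, Form.val_fmul, Form.val_sub, Form.val_add,
        Form.val_smul, c2_w2, c2_add, c2_sub, c2_smul, c1_smul, c1_sub, c1_add]; field_simp; ring)
  · change dv (Form.fmul μ₂ s.θ₂) p = _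
    rw [dv_fmul_dLog (hμ₂ p) n₂ hs.θ₂, h.d_θ₂]
    apply alt2_ext <;>
      (simp only [Coframe.scale, ConnectionForms.scale, Form.val_fmul, Form.val_sub, Form.val_add,
        Form.val_smul, c2_w2, c2_add, c2_sub, c2_smul, c1_smul, c1_sub, c1_add]; field_simp; ring)
  · change dv (s.φ - dLog μ₁ - dLog μ₂) p = _
    rw [dv_sub (hs.φ.sub l₁) l₂, dv_sub hs.φ l₁, dv_dLog hμ₁ h₁, dv_dLog hμ₂ h₂, h.d_φ]
    apply alt2_ext <;>
      (simp only [Coframe.scale, ConnectionForms.scale, Form.val_fmul, Form.val_sub, Form.val_add,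
        Form.val_smul, c2_w2, c2_add, c2_sub, c2_smul, c1_smul, c1_sub, c1_add, c2_zero]
       field_simp; ring)
  · change dv (c.ω₁₁ - (1 / 2 : ℂ) • dLog μ₁ + (1 / 2 : ℂ) • dLog μ₂) p = _
    rw [dv_add (hc.ω₁₁.sub (l₁.smul _)) (l₂.smul _), dv_sub hc.ω₁₁ (l₁.smul _), dv_smul _ l₁,
      dv_smul _ l₂, dv_dLog hμ₁ h₁, dv_dLog hμ₂ h₂, h.d_ω₁₁]
    apply alt2_ext <;>
      (simp only [Coframe.scale, ConnectionForms.scale, Form.val_fmul, Form.val_sub, Form.val_add,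
        Form.val_smul, c2_w2, c2_add, c2_sub, c2_smul, c1_smul, c1_sub, c1_add, c2_zero]
       field_simp; ring)
  · rw [sub_eq_iff_eq_add, sub_eq_iff_eq_add, sub_eq_iff_eq_add]
    change dv (Form.fmul (fun p => (μ₂ p)⁻¹) c.φ₁) p = _
    rw [dv_fmul_inv hμ₂ h₂ hc.φ₁, hq]
    apply alt2_ext <;>
      (simp only [Coframe.scale, ConnectionForms.scale, Form.val_fmul, Form.val_sub, Form.val_add,
        Form.val_smul, c2_w2, c2_add, c2_sub, c2_smul, c1_smul, c1_sub, c1_add]; field_simp; ring)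

theorem IsFramed.adapted_scale (hs : s.IsFramed) :
    (Coframe.scale μ₁ μ₂ s).adapted = s.adapted.scale μ₁ μ₂ :=
  ((hs.scale hμ₁ hμ₂ h₁ h₂).eq_adapted (isAdapted_iff.2 fun p =>
    ⟨smoothAt_scale_connectionForms hμ₁ hμ₂ h₁ h₂ (hs.adapted_smoothAt p),
      (hs.adaptedAt p).scale hμ₁ hμ₂ h₁ h₂ (hs p).1 (hs.adapted_smoothAt p)⟩)).symm

/-- The 2-form that relates the integrands of the invariant for rescaled coframes. -/
def scaleForm (μ₁ μ₂ : M → ℂ) (s : Coframe M) : Form M 2 :=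
  dLog μ₁ ⋏ ((1 / 2 : ℂ) • s.φ + (1 / 3 : ℂ) • s.adapted.ω₁₁) +
    dLog μ₂ ⋏ ((1 / 2 : ℂ) • s.φ - (1 / 3 : ℂ) • s.adapted.ω₁₁)

/-- A rescaling acts on π as a gauge transformation by a diagonal matrix h with h₀/h₁ = μ₁ and h₁/h₂
= μ₂; only its logarithmic differential occurs. The Chern–Simons form changes by an exact form and
by a multiple of tr (h⁻¹ dh)³, which is zero for diagonal h. The 2-form `scaleForm` is -tr(h⁻¹ dh ∧
π), that is, -(dμ₁/μ₁ ∧ π₀₀ - dμ₂/μ₂ ∧ π₂₂). -/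
theorem cubeForm_scale (hs : s.IsFramed) : cubeForm (Coframe.scale μ₁ μ₂ s).connection =
    cubeForm s.connection + (-3 : ℂ) • (scaleForm μ₁ μ₂ s).d := by
  have hs' := hs.scale hμ₁ hμ₂ h₁ h₂
  refine Form.ext_val fun p => alt3_ext ?_
  have hp := (hs p).1
  have hc := hs.adapted_smoothAt p
  have ha := hs.adaptedAt p
  have n₁ := h₁ p
  have n₂ := h₂ p
  have l₁ := smoothAt_dLog (hμ₁ p) n₁
  have l₂ := smoothAt_dLog (hμ₂ p) n₂
  have e : (scaleForm μ₁ μ₂ s).d.val p =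
      (w3 ((1 / 2 : ℂ) • s.φ.val p + (1 / 3 : ℂ) • s.adapted.ω₁₁.val p) (dv (dLog μ₁) p) -
        w3 ((dLog μ₁).val p) ((1 / 2 : ℂ) • dv s.φ p + (1 / 3 : ℂ) • dv s.adapted.ω₁₁ p)) +
      (w3 ((1 / 2 : ℂ) • s.φ.val p - (1 / 3 : ℂ) • s.adapted.ω₁₁.val p) (dv (dLog μ₂) p) -
        w3 ((dLog μ₂).val p) ((1 / 2 : ℂ) • dv s.φ p - (1 / 3 : ℂ) • dv s.adapted.ω₁₁ p)) := by
    have s1 := (hp.φ.smul (1 / 2 : ℂ)).add (hc.ω₁₁.smul (1 / 3 : ℂ))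
    have s2 := (hp.φ.smul (1 / 2 : ℂ)).sub (hc.ω₁₁.smul (1 / 3 : ℂ))
    refine (dv₂_add (l₁.wedge s1) (l₂.wedge s2)).trans ?_
    rw [dv₂_wedge l₁ s1, dv₂_wedge l₂ s2, dv_add (hp.φ.smul _) (hc.ω₁₁.smul _),
      dv_sub (hp.φ.smul _) (hc.ω₁₁.smul _), dv_smul _ hp.φ, dv_smul _ hc.ω₁₁]
    rfl
  rw [Form.val_add, c3_add, Form.val_smul, c3_smul, e, c3_cubeForm, c3_cubeForm, tr3_self,
    tr3_self, hs.connection, hs'.connection, hs.adapted_scale hμ₁ hμ₂ h₁ h₂, dv_dLog hμ₁ h₁,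
    dv_dLog hμ₂ h₂, ha.d_φ, ha.d_ω₁₁]
  simp only [matVal, connMatrix_00, connMatrix_01, connMatrix_02, connMatrix_10, connMatrix_11,
    connMatrix_12, connMatrix_20, connMatrix_21, connMatrix_22, Coframe.scale,
    ConnectionForms.scale, Form.val_fmul, Form.val_sub, Form.val_add, Form.val_smul, Form.val_neg]
  simp only [tri, c3_add, c3_sub, c3_w3, c2_w2, c2_add, c2_sub, c2_smul, c1_smul, c1_sub, c1_add,
    c1_neg, c2_zero]
  field_simp
  ring

/-- No deformation argument is available here, since μ₁ and μ₂ may wind around zero. The exactness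
of the change of the integrand replaces it. -/
theorem muIntegral_scale [CompactSpace M] [T2Space M] (hM : IsOrientedAtlas M) (hs : s.IsFramed) :
    (Coframe.scale μ₁ μ₂ s).muIntegral = s.muIntegral := by
  have hsm : ∀ p, (scaleForm μ₁ μ₂ s).SmoothAt p := by
    intro p
    have hp := (hs p).1
    have hc := hs.adapted_smoothAt p
    exact ((smoothAt_dLog (hμ₁ p) (h₁ p)).wedge ((hp.φ.smul _).add (hc.ω₁₁.smul _))).add
      ((smoothAt_dLog (hμ₂ p) (h₂ p)).wedge ((hp.φ.smul _).sub (hc.ω₁₁.smul _)))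
  have hcs : ∀ p, (cubeForm s.connection).SmoothAt p := fun p =>
    (smoothFamilyAt_trWedge (A := fun _ => s.connection) (B := fun _ => wedgeSq s.connection)
      (t := 0) (fun i j => (hs.smoothAt_connection i j p).family 0)
      (smoothFamilyAt_wedgeSq fun i j => (hs.smoothAt_connection i j p).family 0)).slice
  have e : (cubeForm (Coframe.scale μ₁ μ₂ s).connection).integral =
      (cubeForm s.connection).integral := by
    rw [cubeForm_scale hμ₁ hμ₂ h₁ h₂ hs, Form.integral_add hcs fun p => (hsm p).d.smul _,
      Form.integral_smul, Form.integral_d hM hsm, mul_zero, add_zero]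
  exact congrArg (fun z => 1 / (24 * (Real.pi : ℂ) ^ 2) * z) e

end scale

end Coframe

/-- Two sections of the coframe bundle of a flag structure differ by a rescaling and a unipotent
change. -/
theorem IsSection.exists_scale {G : FlagStructure M} {s s' : Coframe M} (h : IsSection G s)
    (h' : IsSection G s') : ∃ μ₁ μ₂ : M → ℂ, (∀ p, FunSmoothAt μ₁ p) ∧ (∀ p, FunSmoothAt μ₂ p) ∧
      (∀ p, μ₁ p ≠ 0) ∧ (∀ p, μ₂ p ≠ 0) ∧ s'.θ = (Coframe.scale μ₁ μ₂ s).θ ∧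
      (∀ p, ∃ u : ℂ, s'.θ₁.val p = (Coframe.scale μ₁ μ₂ s).θ₁.val p +
        u • (Coframe.scale μ₁ μ₂ s).θ.val p) ∧
      (∀ p, ∃ u : ℂ, s'.θ₂.val p = (Coframe.scale μ₁ μ₂ s).θ₂.val p +
        u • (Coframe.scale μ₁ μ₂ s).θ.val p) := by
  have hf := h.isFramed
  have hf' := h'.isFramed
  -- Evaluation on vectors of T₁ and T₂ kills the components of the new forms that would not respect
  -- the flag.
  have key : ∀ p, s.coef₁ s'.θ p = 0 ∧ s.coef₂ s'.θ p = 0 ∧ s.coef₂ s'.θ₁ p = 0 ∧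
      s.coef₁ s'.θ₂ p = 0 := by
    intro p
    obtain ⟨v, hv, hv1⟩ := SetLike.not_le_iff_exists.1 (h.θ₁_T₁ p)
    obtain ⟨w, hw, hw2⟩ := SetLike.not_le_iff_exists.1 (h.θ₂_T₂ p)
    have hsup : LinearMap.ker (s'.θ.complexify p) = LinearMap.ker (s.θ.complexify p) :=
      (h'.ker_θ p).trans (h.ker_θ p).symm
    have v0 : v ∈ LinearMap.ker (s.θ.complexify p) := h.ker_θ p ▸ Submodule.mem_sup_left hv
    have w0 : w ∈ LinearMap.ker (s.θ.complexify p) := h.ker_θ p ▸ Submodule.mem_sup_right hw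
    have v0' : v ∈ LinearMap.ker (s'.θ.complexify p) := hsup ▸ v0
    have w0' : w ∈ LinearMap.ker (s'.θ.complexify p) := hsup ▸ w0
    obtain ⟨v, w, a1, a2, a3, a4, a5, a6, a7, a8, n1, n2⟩ : ∃ v w : CE,
        cx (s.θ.val p) v = 0 ∧ cx (s.θ.val p) w = 0 ∧ cx (s'.θ.val p) v = 0 ∧
        cx (s'.θ.val p) w = 0 ∧ cx (s.θ₁.val p) w = 0 ∧ cx (s.θ₂.val p) v = 0 ∧
        cx (s'.θ₁.val p) w = 0 ∧ cx (s'.θ₂.val p) v = 0 ∧ cx (s.θ₁.val p) v ≠ 0 ∧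
        cx (s.θ₂.val p) w ≠ 0 :=
      ⟨v, w, v0, w0, v0', w0', h.θ₁_T₂ p hw, h.θ₂_T₁ p hv, h'.θ₁_T₂ p hw, h'.θ₂_T₁ p hv, hv1, hw2⟩
    have hvol := (hf p).2.vol_ne
    rw [Coframe.decomp hvol s'.θ, cx_add, cx_add, cx_smul, cx_smul, cx_smul] at a3 a4
    rw [Coframe.decomp hvol s'.θ₁, cx_add, cx_add, cx_smul, cx_smul, cx_smul] at a7
    rw [Coframe.decomp hvol s'.θ₂, cx_add, cx_add, cx_smul, cx_smul, cx_smul] at a8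
    rw [a1, a6] at a3 a8
    rw [a2, a5] at a4 a7
    simp only [mul_zero, zero_add, add_zero, mul_eq_zero] at a3 a4 a7 a8
    exact ⟨a3.resolve_right n1, a4.resolve_right n2, a7.resolve_right n2, a8.resolve_right n1⟩
  have e0 : ∀ p, s'.θ.val p = s.coef s'.θ p • s.θ.val p := by
    intro p
    have := Coframe.decomp (hf p).2.vol_ne s'.θ
    rw [(key p).1, (key p).2.1] at this
    rw [this]
    module
  have e1 : ∀ p, s'.θ₁.val p = s.coef s'.θ₁ p • s.θ.val p + s.coef₁ s'.θ₁ p • s.θ₁.val p := by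
    intro p
    have := Coframe.decomp (hf p).2.vol_ne s'.θ₁
    rw [(key p).2.2.1] at this
    rw [this]
    module
  have e2 : ∀ p, s'.θ₂.val p = s.coef s'.θ₂ p • s.θ.val p + s.coef₂ s'.θ₂ p • s.θ₂.val p := by
    intro p
    have := Coframe.decomp (hf p).2.vol_ne s'.θ₂
    rw [(key p).2.2.2] at this
    rw [this]
    module
  have sm : ∀ p, FunSmoothAt (s.coef s'.θ) p := fun p =>
    (((hf p).1.family 0).coef (hf p).2.vol_ne ((hf' p).1.θ.family 0)).slice
  have sm1 : ∀ p, FunSmoothAt (s.coef₁ s'.θ₁) p := fun p =>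
    (((hf p).1.family 0).coef₁ (hf p).2.vol_ne ((hf' p).1.θ₁.family 0)).slice
  have sm2 : ∀ p, FunSmoothAt (s.coef₂ s'.θ₂) p := fun p =>
    (((hf p).1.family 0).coef₂ (hf p).2.vol_ne ((hf' p).1.θ₂.family 0)).slice
  -- Both structure equations compute the θ₁ ∧ θ₂ component of the differential of the new θ. Hence
  -- its scale factor is the product of the other two.
  have hprod : ∀ p, s.coef s'.θ p = s.coef₁ s'.θ₁ p * s.coef₂ s'.θ₂ p := by
    intro p
    have h1 : dv s'.θ p = dv (Form.fmul (s.coef s'.θ) s.θ) p :=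
      dv_congr (Eventually.of_forall e0)
    rw [dv_fmul (sm p) (hf p).1.θ, (hf p).2.d_θ, (hf' p).2.d_θ, e0 p, e1 p, e2 p] at h1
    have h2 := congrArg (fun B => c3 (w3 (s.θ.val p) B)) h1
    have h3 : s.coef s'.θ p * tri (s.θ.val p) (s.θ₁.val p) (s.θ₂.val p) =
        s.coef₁ s'.θ₁ p * s.coef₂ s'.θ₂ p * tri (s.θ.val p) (s.θ₁.val p) (s.θ₂.val p) := by
      simp only [tri, c3_w3, c2_w2, c2_add, c2_smul, c1_add, c1_smul] at h2 ⊢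
      linear_combination -h2
    exact mul_right_cancel₀ (hf p).2.vol_ne h3
  have ne : ∀ p, s.coef s'.θ p ≠ 0 := by
    intro p h0
    have := (hf' p).2.vol_ne
    rw [e0 p, h0] at this
    apply this
    simp only [tri, c3_w3, c1_smul]
    ring
  have ne12 : ∀ p, s.coef₁ s'.θ₁ p ≠ 0 ∧ s.coef₂ s'.θ₂ p ≠ 0 := fun p =>
    mul_ne_zero_iff.1 (hprod p ▸ ne p)
  have eθ : ∀ p, (Coframe.scale (s.coef₁ s'.θ₁) (s.coef₂ s'.θ₂) s).θ.val p =
      s.coef s'.θ p • s.θ.val p := by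
    intro p
    rw [hprod]
    simp only [Coframe.scale, Form.val_fmul]
    module
  refine ⟨s.coef₁ s'.θ₁, s.coef₂ s'.θ₂, sm1, sm2, fun p => (ne12 p).1, fun p => (ne12 p).2,
    Form.ext_val fun p => (e0 p).trans (eθ p).symm,
    fun p => ⟨s.coef s'.θ₁ p / s.coef s'.θ p, ?_⟩, fun p => ⟨s.coef s'.θ₂ p / s.coef s'.θ p, ?_⟩⟩
  · rw [e1 p, eθ p]
    refine alt1_ext fun i => ?_
    have := ne p
    simp only [Coframe.scale, Form.val_fmul, c1_add, c1_smul]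
    field_simp
    ring
  · rw [e2 p, eθ p]
    refine alt1_ext fun i => ?_
    have := ne p
    simp only [Coframe.scale, Form.val_fmul, c1_add, c1_smul]
    field_simp
    ring

section
variable [CompactSpace M] [T2Space M]

/-- The invariant does not depend on the section. -/
theorem IsSection.muIntegral_eq (hM : IsOrientedAtlas M) {G : FlagStructure M} {s s' : Coframe M}
    (h : IsSection G s) (h' : IsSection G s') : s'.muIntegral = s.muIntegral := by
  obtain ⟨μ₁, μ₂, hμ₁, hμ₂, h₁, h₂, e0, e1, e2⟩ := h.exists_scale h'
  rw [← Coframe.muIntegral_scale hμ₁ hμ₂ h₁ h₂ hM h.isFramed]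
  exact Coframe.muIntegral_eq_of_unipotent hM (h.isFramed.scale hμ₁ hμ₂ h₁ h₂) h'.isFramed e0 e1 e2

theorem IsSection.muIntegral_eq_mu (hM : IsOrientedAtlas M) {G : FlagStructure M} {s : Coframe M}
    (h : IsSection G s) : s.muIntegral = G.mu := by
  have hex : ∃ s, IsSection G s := ⟨s, h⟩
  rw [FlagStructure.mu, dif_pos hex]
  exact IsSection.muIntegral_eq hM (Classical.choose_spec hex) h

end

/-! ### Smooth families of vector fields and lines -/

section fields
variable {t : ℝ} {p : M}

theorem contDiffAt_of_contMDiffAt {V : Type*} [NormedAddCommGroup V] [NormedSpace ℝ V]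
    {f : ℝ × M → V} (hf : ContMDiffAt (𝓘(ℝ, ℝ).prod (𝓡 3)) 𝓘(ℝ, V) ∞ f (t, p)) {x : M}
    (hx : p ∈ (extChartAt (𝓡 3) x).source) :
    ContDiffAt ℝ ∞ (fun w : ℝ × E3 => f (w.1, (extChartAt (𝓡 3) x).symm w.2))
      (t, extChartAt (𝓡 3) x p) := by
  have hm : ContMDiffAt 𝓘(ℝ, ℝ × E3) (𝓘(ℝ, ℝ).prod (𝓡 3)) ∞
      (fun w : ℝ × E3 => (w.1, (extChartAt (𝓡 3) x).symm w.2)) (t, extChartAt (𝓡 3) x p) := by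
    refine ContMDiffAt.prodMk ?_ ?_
    · exact contDiffAt_fst.contMDiffAt
    · have h1 : ContMDiffAt 𝓘(ℝ, E3) (𝓡 3) ∞ (extChartAt (𝓡 3) x).symm
          (extChartAt (𝓡 3) x p) :=
        (contMDiffOn_extChartAt_symm x).contMDiffAt
          (extChartAt_target_mem_nhds' ((extChartAt (𝓡 3) x).map_source hx))
      exact ContMDiffAt.comp (t, extChartAt (𝓡 3) x p) (g := (extChartAt (𝓡 3) x).symm)
        (f := Prod.snd) h1 contDiffAt_snd.contMDiffAt
  have e : (t, (extChartAt (𝓡 3) x).symm (extChartAt (𝓡 3) x p)) = (t, p) := by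
    rw [(extChartAt (𝓡 3) x).left_inv hx]
  have := ContMDiffAt.comp (t, extChartAt (𝓡 3) x p) (g := f)
    (f := fun w : ℝ × E3 => (w.1, (extChartAt (𝓡 3) x).symm w.2)) (by rwa [e]) hm
  exact this.contDiffAt

/-- The trivialization of the tangent bundle at x is the derivative of the chart at x. So smoothness
as a map to the bundle is smoothness of the coordinates of the field. -/
theorem contDiffAt_field {u : ℝ → (p : M) → TangentSpace (𝓡 3) p} {W : Set (ℝ × M)}
    (hW : W ∈ 𝓝 (t, p)) (hu : SmoothFieldFamilyOn u W) {x : M}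
    (hx : p ∈ (extChartAt (𝓡 3) x).source) :
    ContDiffAt ℝ ∞ (fun w : ℝ × E3 => dChart x ((extChartAt (𝓡 3) x).symm w.2)
      (u w.1 ((extChartAt (𝓡 3) x).symm w.2))) (t, extChartAt (𝓡 3) x p) := by
  have h1 := hu.contMDiffAt hW
  have hxc : p ∈ (chartAt E3 x).source := by rwa [extChartAt_source] at hx
  have h2 := ((trivializationAt E3 (TangentSpace (𝓡 3)) x).contMDiffAt_iff (IB := 𝓡 3) (n := ∞)
    (f := fun z : ℝ × M => (⟨z.2, u z.1 z.2⟩ : TangentBundle (𝓡 3) M)) (x₀ := (t, p))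
    (by
      rw [Bundle.Trivialization.mem_source, TangentBundle.trivializationAt_baseSet]
      exact hxc)).1 h1
  have h3 := contDiffAt_of_contMDiffAt h2.2 hx
  refine h3.congr_of_eventuallyEq ?_
  filter_upwards [eventually_mem_target_prod hx t] with w hw
  have hb : (extChartAt (𝓡 3) x).symm w.2 ∈ (chartAt E3 x).source := by
    rw [← extChartAt_source (𝓡 3)]
    exact symm_mem_source hw
  have h4 := TangentBundle.continuousLinearMapAt_trivializationAt (I := 𝓡 3) hb
  have h5 := congrArg (fun L : E3 →L[ℝ] E3 => L (u w.1 ((extChartAt (𝓡 3) x).symm w.2))) h4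
  refine h5.symm.trans ?_
  have hb' : (extChartAt (𝓡 3) x).symm w.2 ∈
      (trivializationAt E3 (TangentSpace (𝓡 3)) x).baseSet := by
    rwa [TangentBundle.trivializationAt_baseSet]
  exact (trivializationAt E3 (TangentSpace (𝓡 3)) x).continuousLinearMapAt_apply_of_mem ℝ hb' _

theorem funSmoothFamilyAt_apply {u : ℝ → (p : M) → TangentSpace (𝓡 3) p} {W : Set (ℝ × M)}
    (hW : W ∈ 𝓝 (t, p)) (hu : SmoothFieldFamilyOn u W) {α : Form M 1} (hα : α.SmoothAt p) :
    FunSmoothFamilyAt (fun t q => α.val q (fun _ => u t q)) t p := by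
  intro x hx
  have h1 := contDiffAt_field hW hu hx
  have h2 := (hα.family t) x hx
  have hev : ContDiff ℝ ∞ fun z : Alt 1 × E3 => z.1 (fun _ => z.2) := by
    have : ContDiff ℝ ∞ fun z : Alt 1 × E3 =>
        (ContinuousAlternatingMap.ofSubsingletonLIE (𝕜 := ℝ) (E := E3) (F := ℂ) (0 : Fin 1)).symm
          z.1 z.2 := by fun_prop
    exact this
  refine (hev.contDiffAt.comp _ (h2.prodMk h1)).congr_of_eventuallyEq ?_
  filter_upwards [eventually_mem_target_prod hx t] with w hw
  rw [Form.val_eq_rep α hw]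
  rfl

theorem cx_cvec (a : Alt 1) {q : M} (u v : TangentSpace (𝓡 3) q) :
    cx a (cvec u v : CE) = a (fun _ => (u : E3)) + Complex.I * a (fun _ => (v : E3)) := by
  have : cx a (cvec u v : CE) = cx a ((1 : ℂ) ⊗ₜ[ℝ] (u : E3)) + cx a (Complex.I ⊗ₜ[ℝ] (v : E3)) :=
    map_add (cx a) _ _
  exact this.trans (congrArg₂ (· + ·) ((cx_tmul a 1 u).trans (one_mul _)) (cx_tmul a Complex.I v))

theorem funSmoothFamilyAt_cx {u v : ℝ → (p : M) → TangentSpace (𝓡 3) p} {W : Set (ℝ × M)}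
    (hW : W ∈ 𝓝 (t, p)) (hu : SmoothFieldFamilyOn u W) (hv : SmoothFieldFamilyOn v W)
    {α : Form M 1} (hα : α.SmoothAt p) :
    FunSmoothFamilyAt (fun t q => cx (α.val q) (cvec (u t q) (v t q) : CE)) t p := by
  simp only [cx_cvec]
  exact (funSmoothFamilyAt_apply hW hu hα).add
    ((funSmoothFamilyAt_const Complex.I).mul (funSmoothFamilyAt_apply hW hv hα))

/-- The value of `a` on the vector of the line `L` on which `b` has the value `1`. -/
def lineRatio (L : Submodule ℂ CE) (a b : Alt 1) : ℂ :=
  cx a (Classical.epsilon fun X => L = Submodule.span ℂ {X}) /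
    cx b (Classical.epsilon fun X => L = Submodule.span ℂ {X})

/-- Spanning vectors differ by a scalar, which cancels in the quotient. If the scalar is zero, both
vectors vanish and both sides are 0/0 = 0. -/
theorem lineRatio_eq {L : Submodule ℂ CE} {X : CE} (h : L = Submodule.span ℂ {X}) (a b : Alt 1) :
    lineRatio L a b = cx a X / cx b X := by
  have hg : L = Submodule.span ℂ {Classical.epsilon fun X => L = Submodule.span ℂ {X}} :=
    Classical.epsilon_spec (p := fun X => L = Submodule.span ℂ {X}) ⟨X, h⟩
  unfold lineRatio
  generalize (Classical.epsilon fun X => L = Submodule.span ℂ {X}) = Y at hg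
  obtain ⟨r, rfl⟩ := Submodule.mem_span_singleton.1 (h ▸ hg ▸ Submodule.mem_span_singleton_self Y)
  rw [map_smul, map_smul, smul_eq_mul, smul_eq_mul]
  by_cases hr : r = 0
  · have hX : X ∈ Submodule.span ℂ {r • X} := hg ▸ h ▸ Submodule.mem_span_singleton_self X
    rw [hr, zero_smul, Submodule.span_zero_singleton, Submodule.mem_bot] at hX
    rw [hX, map_zero]
    simp
  · exact mul_div_mul_left _ _ hr

theorem exists_normalized {L : Submodule ℂ CE} {X : CE} (h : L = Submodule.span ℂ {X}) {b : Alt 1}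
    (hb : ¬ L ≤ LinearMap.ker (cx b)) : ∃ Y, L = Submodule.span ℂ {Y} ∧ cx b Y = 1 ∧
      ∀ a, cx a Y = lineRatio L a b := by
  have hX : cx b X ≠ 0 := by
    intro h0
    apply hb
    rw [h, Submodule.span_singleton_le_iff_mem]
    exact h0
  refine ⟨(cx b X)⁻¹ • X, ?_, ?_, fun a => ?_⟩
  · rw [h]
    exact (Submodule.span_singleton_smul_eq (inv_ne_zero hX).isUnit X).symm
  · rw [map_smul, smul_eq_mul, inv_mul_cancel₀ hX]
  · rw [lineRatio_eq h, map_smul, smul_eq_mul, div_eq_inv_mul]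

section line
variable {L : ℝ → (p : M) → Submodule ℂ (CTangent p)}

theorem SmoothLineFamilyAt.exists_span (h : SmoothLineFamilyAt L t p) :
    ∃ X : CE, (L t p : Submodule ℂ CE) = Submodule.span ℂ {X} := by
  obtain ⟨W, hW, u, v, -, -, hs⟩ := h
  exact ⟨cvec (u t p) (v t p), (hs (t, p) (mem_of_mem_nhds hW)).2⟩

/-- The ratio does not depend on the spanning vector, so near (t, p) it may be computed with a
smooth spanning field. -/
theorem SmoothLineFamilyAt.funSmoothFamilyAt_lineRatio (h : SmoothLineFamilyAt L t p)
    {α β : Form M 1} (hα : α.SmoothAt p) (hβ : β.SmoothAt p)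
    (hb : ¬ (L t p : Submodule ℂ CE) ≤ LinearMap.ker (cx (β.val p))) :
    FunSmoothFamilyAt (fun t q => lineRatio (L t q) (α.val q) (β.val q)) t p := by
  obtain ⟨W, hW, u, v, hu, hv, hs⟩ := h
  have h0 : cx (β.val p) (cvec (u t p) (v t p) : CE) ≠ 0 := by
    intro h0
    apply hb
    have := (hs (t, p) (mem_of_mem_nhds hW)).2
    simp only at this
    rw [this]
    exact (Submodule.span_singleton_le_iff_mem _ _).2 h0
  refine ((funSmoothFamilyAt_cx hW hu hv hα).div (funSmoothFamilyAt_cx hW hu hv hβ) h0).congr ?_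
  filter_upwards [hW] with z hz
  exact lineRatio_eq (hs z hz).2 _ _

theorem SmoothLineFamilyAt.eventually_not_le (h : SmoothLineFamilyAt L t p) {β : Form M 1}
    (hβ : β.SmoothAt p) (hb : ¬ (L t p : Submodule ℂ CE) ≤ LinearMap.ker (cx (β.val p))) :
    ∀ᶠ z : ℝ × M in 𝓝 (t, p),
      ¬ (L z.1 z.2 : Submodule ℂ CE) ≤ LinearMap.ker (cx (β.val z.2)) := by
  obtain ⟨W, hW, u, v, hu, hv, hs⟩ := h
  have h0 : cx (β.val p) (cvec (u t p) (v t p) : CE) ≠ 0 := by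
    intro h0
    apply hb
    have := (hs (t, p) (mem_of_mem_nhds hW)).2
    simp only at this
    rw [this]
    exact (Submodule.span_singleton_le_iff_mem _ _).2 h0
  have hc := (funSmoothFamilyAt_cx hW hu hv hβ).continuousAt
  filter_upwards [hc.eventually_ne h0, hW] with z hz hzW hle
  have := (hs z hzW).2
  rw [this] at hle
  exact hz ((Submodule.span_singleton_le_iff_mem _ _).1 hle)

end line

end fields

/-! ### Sections of the coframe bundles along a deformation -/

theorem Coframe.ext_forms {s s' : Coframe M} (h : s.θ = s'.θ) (h₁ : s.θ₁ = s'.θ₁)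
    (h₂ : s.θ₂ = s'.θ₂) (h₃ : s.φ = s'.φ) : s = s' := by
  cases s
  cases s'
  subst h h₁ h₂ h₃
  rfl

namespace Deformation
variable (F : ℝ → FlagStructure M) (s : Coframe M)

/-- The slope of `T₁` in the direction of `θ`. -/
def slope₁₀ (t : ℝ) (q : M) : ℂ := lineRatio ((F t).T₁ q) (s.θ.val q) (s.θ₁.val q)
/-- The slope of `T₁` in the direction of `θ₂`. -/
def slope₁₂ (t : ℝ) (q : M) : ℂ := lineRatio ((F t).T₁ q) (s.θ₂.val q) (s.θ₁.val q)
/-- The slope of `T₂` in the direction of `θ`. -/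
def slope₂₀ (t : ℝ) (q : M) : ℂ := lineRatio ((F t).T₂ q) (s.θ.val q) (s.θ₂.val q)
/-- The slope of `T₂` in the direction of `θ₁`. -/
def slope₂₁ (t : ℝ) (q : M) : ℂ := lineRatio ((F t).T₂ q) (s.θ₁.val q) (s.θ₂.val q)

/-- Forms which vanish on `T₁ ⊕ T₂`, on `T₂` and on `T₁`. -/
def pre (t : ℝ) : Coframe M where
  θ := Form.fmul (fun q => 1 - slope₁₂ F s t q * slope₂₁ F s t q) s.θ +
    Form.fmul (fun q => slope₂₀ F s t q * slope₁₂ F s t q - slope₁₀ F s t q) s.θ₁ +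
    Form.fmul (fun q => slope₁₀ F s t q * slope₂₁ F s t q - slope₂₀ F s t q) s.θ₂
  θ₁ := s.θ₁ - Form.fmul (slope₂₁ F s t) s.θ₂
  θ₂ := s.θ₂ - Form.fmul (slope₁₂ F s t) s.θ₁
  φ := 0

/-- The deformed coframe. -/
def deform (t : ℝ) : Coframe M where
  θ := (pre F s t).θ
  θ₁ := Form.fmul ((pre F s t).coef₁₂ (pre F s t).θ.d) (pre F s t).θ₁
  θ₂ := (pre F s t).θ₂
  φ := Form.fmul ((pre F s t).coef₀₁ (pre F s t).θ.d) (pre F s t).θ₁ +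
    Form.fmul ((pre F s t).coef₀₂ (pre F s t).θ.d) (pre F s t).θ₂ +
    Form.fmul (s.coef s.φ) (pre F s t).θ

/-- `T₁` and `T₂` are transverse to the kernels of `θ₁` and `θ₂`. -/
structure Transverse (t : ℝ) (q : M) : Prop where
  n₁ : ¬ ((F t).T₁ q : Submodule ℂ CE) ≤ LinearMap.ker (cx (s.θ₁.val q))
  n₂ : ¬ ((F t).T₂ q : Submodule ℂ CE) ≤ LinearMap.ker (cx (s.θ₂.val q))

/-- The deformed coframe is nondegenerate at a point. -/
structure Good (t : ℝ) (q : M) : Prop extends Transverse F s t q where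
  det_ne : 1 - slope₁₂ F s t q * slope₂₁ F s t q ≠ 0
  coef_ne : (pre F s t).coef₁₂ (pre F s t).θ.d q ≠ 0

variable {F s} {t : ℝ} {p : M}

/-- The new θ₁, θ₂ are combinations of the old θ₁, θ₂ with determinant 1 - `slope₁₂` · `slope₂₁`,
and the same number is the coefficient of the old θ in the new θ. -/
theorem tri_pre (t : ℝ) (p : M) :
    tri ((pre F s t).θ.val p) ((pre F s t).θ₁.val p) ((pre F s t).θ₂.val p) =
      (1 - slope₁₂ F s t p * slope₂₁ F s t p) ^ 2 *
        tri (s.θ.val p) (s.θ₁.val p) (s.θ₂.val p) := by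
  simp only [pre, Form.val_add, Form.val_sub, Form.val_fmul, tri, c3_w3, c2_w2, c1_add, c1_sub,
    c1_smul]
  ring

section smooth
variable (h₁ : SmoothLineFamilyAt (fun t => (F t).T₁) t p)
  (h₂ : SmoothLineFamilyAt (fun t => (F t).T₂) t p) (hs : s.SmoothAt p)
  (hn : Transverse F s t p)
include h₁ h₂ hs hn

theorem smooth_slopes : FunSmoothFamilyAt (slope₁₀ F s) t p ∧ FunSmoothFamilyAt (slope₁₂ F s) t p ∧
    FunSmoothFamilyAt (slope₂₀ F s) t p ∧ FunSmoothFamilyAt (slope₂₁ F s) t p :=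
  ⟨h₁.funSmoothFamilyAt_lineRatio hs.θ hs.θ₁ hn.n₁, h₁.funSmoothFamilyAt_lineRatio hs.θ₂ hs.θ₁ hn.n₁,
    h₂.funSmoothFamilyAt_lineRatio hs.θ hs.θ₂ hn.n₂, h₂.funSmoothFamilyAt_lineRatio hs.θ₁ hs.θ₂ hn.n₂⟩

theorem smooth_pre : Coframe.SmoothFamilyAt (pre F s) t p := by
  obtain ⟨x, y, z, w⟩ := smooth_slopes h₁ h₂ hs hn
  exact ⟨(((((funSmoothFamilyAt_const 1).sub (y.mul w)).fmul' (hs.θ.family t)).add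
      (((z.mul y).sub x).fmul' (hs.θ₁.family t))).add (((x.mul w).sub z).fmul' (hs.θ₂.family t))),
    (hs.θ₁.family t).sub (w.fmul' (hs.θ₂.family t)),
    (hs.θ₂.family t).sub (y.fmul' (hs.θ₁.family t)), Form.smoothFamilyAt_zero⟩

theorem smooth_deform (hv : tri (s.θ.val p) (s.θ₁.val p) (s.θ₂.val p) ≠ 0)
    (hd : 1 - slope₁₂ F s t p * slope₂₁ F s t p ≠ 0) :
    Coframe.SmoothFamilyAt (deform F s) t p ∧
      FunSmoothFamilyAt (fun t => (pre F s t).coef₁₂ (pre F s t).θ.d) t p := by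
  have hp := smooth_pre h₁ h₂ hs hn
  have hpv : c3 ((pre F s t).vol.val p) ≠ 0 := by
    rw [Coframe.c3_val_vol, tri_pre]
    exact mul_ne_zero (pow_ne_zero _ hd) hv
  have g := hp.coef₁₂ hpv hp.θ.d
  have k : FunSmoothFamilyAt (fun _ => s.coef s.φ) t p :=
    (hs.family t).coef hv (hs.φ.family t)
  exact ⟨⟨hp.θ, g.fmul' hp.θ₁, hp.θ₂, (((hp.coef₀₁ hpv hp.θ.d).fmul' hp.θ₁).add
    ((hp.coef₀₂ hpv hp.θ.d).fmul' hp.θ₂)).add (k.fmul' hp.θ)⟩, g⟩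

end smooth

/-- The preliminary θ is the cross product of the directions of T₁ and T₂, so it annihilates both.
Rescaling θ₁ corrects the θ₁ ∧ θ₂ component of dθ, and the other two components define φ modulo θ.
The coefficient of θ in φ is arbitrary; it is taken from the given section so that the family passes
through that section at t = 0. -/
theorem isSection_deform (hs : s.IsFramed)
    (h₁ : ∀ p, SmoothLineFamilyAt (fun t => (F t).T₁) t p)
    (h₂ : ∀ p, SmoothLineFamilyAt (fun t => (F t).T₂) t p) (hg : ∀ p, Good F s t p) :
    IsSection (F t) (deform F s t) := by
  have hsm : ∀ p, (deform F s t).SmoothAt p := fun p =>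
    ((smooth_deform (h₁ p) (h₂ p) (hs p).1 (hg p).toTransverse (hs p).2.vol_ne
      (hg p).det_ne).1).slice
  have sm : ∀ {α : Form M 1}, (∀ p, α.SmoothAt p) → α.SmoothOn univ := fun hα =>
    (Form.smoothOn_iff isOpen_univ).2 fun p _ => hα p
  have lines : ∀ p, ∃ X Y : CE, ((F t).T₁ p : Submodule ℂ CE) = Submodule.span ℂ {X} ∧
      ((F t).T₂ p : Submodule ℂ CE) = Submodule.span ℂ {Y} ∧
      cx ((deform F s t).θ.val p) X = 0 ∧ cx ((deform F s t).θ.val p) Y = 0 ∧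
      cx ((deform F s t).θ₁.val p) X ≠ 0 ∧ cx ((deform F s t).θ₁.val p) Y = 0 ∧
      cx ((deform F s t).θ₂.val p) X = 0 ∧ cx ((deform F s t).θ₂.val p) Y ≠ 0 := by
    intro p
    obtain ⟨X, hX⟩ := (h₁ p).exists_span
    obtain ⟨Y, hY⟩ := (h₂ p).exists_span
    -- In the given coframe X has coordinates (`slope₁₀`, 1, `slope₁₂`) and Y has coordinates
    -- (`slope₂₀`, `slope₂₁`, 1).
    obtain ⟨X, hX, hX1, hXa⟩ := exists_normalized hX (hg p).n₁
    obtain ⟨Y, hY, hY1, hYa⟩ := exists_normalized hY (hg p).n₂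
    have x : cx (s.θ.val p) X = slope₁₀ F s t p := hXa _
    have y : cx (s.θ₂.val p) X = slope₁₂ F s t p := hXa _
    have z : cx (s.θ.val p) Y = slope₂₀ F s t p := hYa _
    have w : cx (s.θ₁.val p) Y = slope₂₁ F s t p := hYa _
    have hd := (hg p).det_ne
    have hc := (hg p).coef_ne
    refine ⟨X, Y, hX, hY, ?_, ?_, ?_, ?_, ?_, ?_⟩
    · simp only [deform, pre, Form.val_add, Form.val_fmul, cx_add, cx_smul, x, y, hX1]
      ring
    · simp only [deform, pre, Form.val_add, Form.val_fmul, cx_add, cx_smul, z, w, hY1]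
      ring
    · have : cx ((deform F s t).θ₁.val p) X = (pre F s t).coef₁₂ (pre F s t).θ.d p *
          (1 - slope₁₂ F s t p * slope₂₁ F s t p) := by
        simp only [deform, Form.val_fmul, cx_smul]
        simp only [pre, Form.val_sub, Form.val_fmul, cx_sub, cx_smul, y, hX1]
        ring
      rw [this]
      exact mul_ne_zero hc hd
    · simp only [deform, Form.val_fmul, cx_smul]
      simp only [pre, Form.val_sub, Form.val_fmul, cx_sub, cx_smul, w, hY1]
      ring
    · simp only [deform, pre, Form.val_sub, Form.val_fmul, cx_sub, cx_smul, y, hX1]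
      ring
    · have : cx ((deform F s t).θ₂.val p) Y = 1 - slope₁₂ F s t p * slope₂₁ F s t p := by
        simp only [deform, pre, Form.val_sub, Form.val_fmul, cx_sub, cx_smul, w, hY1]
      rw [this]
      exact hd
  have hpv : ∀ p, tri ((pre F s t).θ.val p) ((pre F s t).θ₁.val p) ((pre F s t).θ₂.val p) ≠ 0 := by
    intro p
    rw [tri_pre]
    exact mul_ne_zero (pow_ne_zero _ (hg p).det_ne) (hs p).2.vol_ne
  have hdv : ∀ p, tri ((deform F s t).θ.val p) ((deform F s t).θ₁.val p)
      ((deform F s t).θ₂.val p) ≠ 0 := by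
    intro p
    have : tri ((deform F s t).θ.val p) ((deform F s t).θ₁.val p) ((deform F s t).θ₂.val p) =
        (pre F s t).coef₁₂ (pre F s t).θ.d p *
        tri ((pre F s t).θ.val p) ((pre F s t).θ₁.val p) ((pre F s t).θ₂.val p) := by
      simp only [deform, Form.val_fmul, tri, c3_w3, c2_w2, c1_smul]
      ring
    rw [this]
    exact mul_ne_zero (hg p).coef_ne (hpv p)
  refine ⟨sm fun p => (hsm p).θ, sm fun p => (hsm p).θ₁, sm fun p => (hsm p).θ₂,
    sm fun p => (hsm p).φ, fun p => ?_, fun p => ?_, fun p => ?_, fun p => ?_, fun p => ?_, ?_⟩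
  · obtain ⟨X, Y, hX, hY, e1, e2, e3, e4, e5, e6⟩ := lines p
    have := ker_cx_eq_sup (hdv p) e3 e6 e1 e2 e4 e5
    rw [← hX, ← hY] at this
    exact this
  · obtain ⟨X, Y, hX, hY, e1, e2, e3, e4, e5, e6⟩ := lines p
    exact hY.le.trans ((Submodule.span_singleton_le_iff_mem _ _).2 e4)
  · obtain ⟨X, Y, hX, hY, e1, e2, e3, e4, e5, e6⟩ := lines p
    exact fun h => e3 ((Submodule.span_singleton_le_iff_mem _ _).1 (hX.ge.trans h))
  · obtain ⟨X, Y, hX, hY, e1, e2, e3, e4, e5, e6⟩ := lines p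
    exact hX.le.trans ((Submodule.span_singleton_le_iff_mem _ _).2 e5)
  · obtain ⟨X, Y, hX, hY, e1, e2, e3, e4, e5, e6⟩ := lines p
    exact fun h => e6 ((Submodule.span_singleton_le_iff_mem _ _).1 (hY.ge.trans h))
  · refine Form.ext_val fun p => ?_
    have := Coframe.decomp₂ (hpv p) (pre F s t).θ.d
    refine this.trans ?_
    change _ = w2 ((deform F s t).θ.val p) ((deform F s t).φ.val p) +
      w2 ((deform F s t).θ₁.val p) ((deform F s t).θ₂.val p)
    simp only [deform, Form.val_fmul, Form.val_add]
    apply alt2_ext <;> (simp only [c2_add, c2_smul, c2_w2, c1_add, c1_smul]; ring)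

/-! ### The deformed coframe at and near the parameter zero -/

section zero
variable (h : IsSection (F 0) s)
include h

theorem transverse_zero (p : M) : Transverse F s 0 p := ⟨h.θ₁_T₁ p, h.θ₂_T₂ p⟩

theorem lineRatio_eq_zero {L : Submodule ℂ CE} {a : Alt 1} (hL : ∃ X, L = Submodule.span ℂ {X})
    (ha : L ≤ LinearMap.ker (cx a)) (b : Alt 1) : lineRatio L a b = 0 := by
  obtain ⟨X, hX⟩ := hL
  have : cx a X = 0 := ha (hX ▸ Submodule.mem_span_singleton_self X)
  rw [lineRatio_eq hX, this, zero_div]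

variable (h₁ : ∀ p, SmoothLineFamilyAt (fun t => (F t).T₁) 0 p)
  (h₂ : ∀ p, SmoothLineFamilyAt (fun t => (F t).T₂) 0 p)
include h₁ h₂

theorem slopes_zero (p : M) : slope₁₀ F s 0 p = 0 ∧ slope₁₂ F s 0 p = 0 ∧ slope₂₀ F s 0 p = 0 ∧
    slope₂₁ F s 0 p = 0 := by
  have k := h.ker_θ p
  have k1 : (F 0).T₁ p ≤ LinearMap.ker (s.θ.complexify p) := k ▸ le_sup_left
  have k2 : (F 0).T₂ p ≤ LinearMap.ker (s.θ.complexify p) := k ▸ le_sup_right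
  exact ⟨lineRatio_eq_zero h (h₁ p).exists_span k1 _,
    lineRatio_eq_zero h (h₁ p).exists_span (h.θ₂_T₁ p) _,
    lineRatio_eq_zero h (h₂ p).exists_span k2 _,
    lineRatio_eq_zero h (h₂ p).exists_span (h.θ₁_T₂ p) _⟩

theorem pre_zero : pre F s 0 = ⟨s.θ, s.θ₁, s.θ₂, 0⟩ := by
  have e0 : (pre F s 0).θ = s.θ := by
    refine Form.ext_val fun p => ?_
    obtain ⟨x, y, z, w⟩ := slopes_zero h h₁ h₂ p
    simp only [pre, Form.val_add, Form.val_fmul, x, y, z, w]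
    module
  have e1 : (pre F s 0).θ₁ = s.θ₁ := by
    refine Form.ext_val fun p => ?_
    obtain ⟨x, y, z, w⟩ := slopes_zero h h₁ h₂ p
    simp only [pre, Form.val_sub, Form.val_fmul, x, y, z, w]
    module
  have e2 : (pre F s 0).θ₂ = s.θ₂ := by
    refine Form.ext_val fun p => ?_
    obtain ⟨x, y, z, w⟩ := slopes_zero h h₁ h₂ p
    simp only [pre, Form.val_sub, Form.val_fmul, x, y, z, w]
    module
  rw [← e0, ← e1, ← e2]
  rfl

theorem coef_zero (p : M) : (pre F s 0).coef₁₂ (pre F s 0).θ.d p = 1 ∧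
    (pre F s 0).coef₀₁ (pre F s 0).θ.d p = s.coef₁ s.φ p ∧
    (pre F s 0).coef₀₂ (pre F s 0).θ.d p = s.coef₂ s.φ p := by
  have hv := (h.isFramed p).2.vol_ne
  have hd := (h.isFramed p).2.d_θ
  have c1 : s.coef₁ s.φ p * tri (s.θ.val p) (s.θ₁.val p) (s.θ₂.val p) =
    tri (s.θ.val p) (s.φ.val p) (s.θ₂.val p) := div_mul_cancel₀ _ hv
  have c2 : s.coef₂ s.φ p * tri (s.θ.val p) (s.θ₁.val p) (s.θ₂.val p) =
    tri (s.θ.val p) (s.θ₁.val p) (s.φ.val p) := div_mul_cancel₀ _ hv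
  have k := Coframe.coef₁₂_mul hv s.θ.d
  have k1 := Coframe.coef₀₁_mul hv s.θ.d
  have k2 := Coframe.coef₀₂_mul hv s.θ.d
  have e : s.θ.d.val p = w2 (s.θ.val p) (s.φ.val p) + w2 (s.θ₁.val p) (s.θ₂.val p) := hd
  rw [e] at k k1 k2
  rw [pre_zero h h₁ h₂]
  change s.coef₁₂ s.θ.d p = 1 ∧ s.coef₀₁ s.θ.d p = s.coef₁ s.φ p ∧
    s.coef₀₂ s.θ.d p = s.coef₂ s.φ p
  refine ⟨mul_right_cancel₀ hv (k.trans ?_), mul_right_cancel₀ hv (k1.trans (Eq.trans ?_ c1.symm)),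
    mul_right_cancel₀ hv (k2.trans (Eq.trans ?_ c2.symm))⟩ <;>
  · simp only [tri, c3_w3, c2_w2, c2_add]
    ring

theorem deform_zero : deform F s 0 = s := by
  have hc := coef_zero h h₁ h₂
  have e0 : (deform F s 0).θ = s.θ := by rw [deform, pre_zero h h₁ h₂]
  have e1 : (deform F s 0).θ₁ = s.θ₁ := by
    refine Form.ext_val fun p => ?_
    simp only [deform, Form.val_fmul, (hc p).1]
    rw [pre_zero h h₁ h₂]
    exact one_smul ℂ (s.θ₁.val p)
  have e2 : (deform F s 0).θ₂ = s.θ₂ := by rw [deform, pre_zero h h₁ h₂]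
  have e3 : (deform F s 0).φ = s.φ := by
    refine Form.ext_val fun p => ?_
    simp only [deform, Form.val_fmul, Form.val_add, (hc p).2.1, (hc p).2.2]
    rw [pre_zero h h₁ h₂, Coframe.decomp (h.isFramed p).2.vol_ne s.φ]
    simp only
    module
  exact Coframe.ext_forms e0 e1 e2 e3

/-- At t = 0 the slopes vanish and the correction factor is 1, so the nondegeneracy conditions hold
there. They are open in (t, p). -/
theorem eventually_good (p : M) : ∀ᶠ z : ℝ × M in 𝓝 (0, p), Good F s z.1 z.2 := by
  have hs := (h.isFramed p).1
  have hn := transverse_zero h p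
  obtain ⟨-, y, -, w⟩ := smooth_slopes (h₁ p) (h₂ p) hs hn
  obtain ⟨-, y0, -, w0⟩ := slopes_zero h h₁ h₂ p
  have hd0 : 1 - slope₁₂ F s 0 p * slope₂₁ F s 0 p ≠ 0 := by
    rw [y0, w0]
    simp
  have hd := (((funSmoothFamilyAt_const 1).sub (y.mul w)).continuousAt).eventually_ne hd0
  have hg := (smooth_deform (h₁ p) (h₂ p) hs hn (h.isFramed p).2.vol_ne hd0).2.continuousAt
  have hg0 : (pre F s 0).coef₁₂ (pre F s 0).θ.d p ≠ 0 := by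
    rw [(coef_zero h h₁ h₂ p).1]
    exact one_ne_zero
  filter_upwards [hd, hg.eventually_ne hg0, (h₁ p).eventually_not_le hs.θ₁ hn.n₁,
    (h₂ p).eventually_not_le hs.θ₂ hn.n₂] with z z1 z2 z3 z4
  exact ⟨⟨z3, z4⟩, z1, z2⟩

end zero

end Deformation

/-- A section of the coframe bundle of `F 0` extends to a smooth family of sections of the coframe
bundles of the `F t`. -/
theorem IsSmoothDeformation.exists_sections [CompactSpace M] {F : ℝ → FlagStructure M}
    (hF : IsSmoothDeformation F) {s : Coframe M} (h : IsSection (F 0) s) :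
    ∃ S : ℝ → Coframe M, S 0 = s ∧ ∃ δ > 0, IsSmoothSectionFamily F S δ := by
  obtain ⟨ε, hε, hl⟩ := hF
  have h0 : (0 : ℝ) ∈ Ioo (-ε) ε := ⟨by linarith, hε⟩
  have h₁ := fun p => (hl 0 h0 p).1
  have h₂ := fun p => (hl 0 h0 p).2
  have hs := h.isFramed
  -- Compactness of M turns the neighbourhoods of the points (0, p) into one interval of parameters
  -- valid for all p.
  have hev : ∀ᶠ t : ℝ in 𝓝 0, ∀ p ∈ (univ : Set M), Deformation.Good F s t p :=
    isCompact_univ.eventually_forall_of_forall_eventually fun p _ =>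
      Deformation.eventually_good h h₁ h₂ p
  obtain ⟨δ', hδ', hball⟩ := Metric.eventually_nhds_iff_ball.1 hev
  have hmem : ∀ t ∈ Ioo (-min ε δ') (min ε δ'), t ∈ Ioo (-ε) ε ∧ ∀ p, Deformation.Good F s t p := by
    rintro t ⟨ht1, ht2⟩
    have a1 := min_le_left ε δ'
    have a2 := min_le_right ε δ'
    refine ⟨⟨by linarith, by linarith⟩, fun p => hball t ?_ p (mem_univ p)⟩
    rw [Metric.mem_ball, Real.dist_eq, sub_zero, abs_lt]
    exact ⟨by linarith, by linarith⟩
  have hsm : ∀ z ∈ Ioo (-min ε δ') (min ε δ') ×ˢ (univ : Set M),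
      Coframe.SmoothFamilyAt (Deformation.deform F s) z.1 z.2 := by
    rintro ⟨t, p⟩ ⟨ht, -⟩
    obtain ⟨hte, hg⟩ := hmem t ht
    exact (Deformation.smooth_deform (hl t hte p).1 (hl t hte p).2 (hs p).1 (hg p).toTransverse
      (hs p).2.vol_ne (hg p).det_ne).1
  have hW : IsOpen (Ioo (-min ε δ') (min ε δ') ×ˢ (univ : Set M)) := isOpen_Ioo.prod isOpen_univ
  refine ⟨Deformation.deform F s, Deformation.deform_zero h h₁ h₂, min ε δ', lt_min hε hδ',
    fun t ht => ?_, ?_, ?_, ?_, ?_⟩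
  · obtain ⟨hte, hg⟩ := hmem t ht
    exact Deformation.isSection_deform hs (fun p => (hl t hte p).1) (fun p => (hl t hte p).2) hg
  · exact (Form.smoothFamilyOn_iff hW).2 fun z hz => (hsm z hz).θ
  · exact (Form.smoothFamilyOn_iff hW).2 fun z hz => (hsm z hz).θ₁
  · exact (Form.smoothFamilyOn_iff hW).2 fun z hz => (hsm z hz).θ₂
  · exact (Form.smoothFamilyOn_iff hW).2 fun z hz => (hsm z hz).φ

/-! ### Maurer-Cartan forms -/

theorem dFun_mul {f g : M → ℂ} {p : M} (hf : FunSmoothAt f p) (hg : FunSmoothAt g p) :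
    (dFun fun q => f q * g q).val p = g p • (dFun f).val p + f p • (dFun g).val p := by
  have e : Form.ofFun (fun q => f q * g q) = Form.fmul f (Form.ofFun g) := by
    refine Form.ext_val fun q => ?_
    apply ContinuousAlternatingMap.ext
    intro v
    rfl
  have h := Form.d_fmul hf (Form.smoothFamilyAt_ofFun (hg.family 0)).slice
  rw [← e] at h
  refine h.trans (congrArg (· + f p • (dFun g).val p) ?_)
  refine alt1_ext fun i => ?_
  change covWedge ((dFun f).val p) ((Form.ofFun g).val p) _ = _
  rw [covWedge_apply, Fin.sum_univ_one]
  have h2 : ∀ v, (Form.ofFun g).val p v = g p := fun v => rfl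
  rw [h2]
  simp [c1, mul_comm]

theorem dFun_add {f g : M → ℂ} {p : M} (hf : FunSmoothAt f p) (hg : FunSmoothAt g p) :
    (dFun fun q => f q + g q).val p = (dFun f).val p + (dFun g).val p :=
  Form.d_add (Form.smoothFamilyAt_ofFun (hf.family 0)).slice
    (Form.smoothFamilyAt_ofFun (hg.family 0)).slice

/-- A matrix valued function is smooth and invertible at a point. -/
structure SmoothInvertibleAt (g : M → Matrix (Fin 3) (Fin 3) ℂ) (p : M) : Prop where
  smooth : ∀ i j, FunSmoothAt (fun q => g q i j) p
  det_ne : (g p).det ≠ 0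

/-- The entries of `g⁻¹ dg`. -/
def mc (g : M → Matrix (Fin 3) (Fin 3) ℂ) (i j : Fin 3) : Form M 1 :=
  ∑ k, Form.fmul (fun q => (g q)⁻¹ i k) (dFun fun q => g q k j)

namespace SmoothInvertibleAt
variable {g g₀ b : M → Matrix (Fin 3) (Fin 3) ℂ} {p : M}

/-- The entries of the inverse are 2 × 2 minors, up to sign, divided by the determinant. -/
theorem inv (h : SmoothInvertibleAt g p) (i j : Fin 3) : FunSmoothAt (fun q => (g q)⁻¹ i j) p := by
  have minor : ∀ a b c d e f k l, FunSmoothAt (fun q => g q a b * g q c d - g q e f * g q k l) p :=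
    fun a b c d e f k l => by
      simpa only [sub_eq_add_neg] using ((h.smooth a b).mul (h.smooth c d)).add
        ((h.smooth e f).mul (h.smooth k l)).neg
  have hdet : FunSmoothAt (fun q => (g q).det) p := by
    have := ((h.smooth 0 0).mul (minor 1 1 2 2 1 2 2 1)).add
      ((((h.smooth 0 1).mul (minor 1 0 2 2 1 2 2 0)).neg).add
        ((h.smooth 0 2).mul (minor 1 0 2 1 1 1 2 0)))
    refine cast ?_ this
    congr 1
    funext q
    rw [Matrix.det_fin_three]
    ring
  have hadj : FunSmoothAt (fun q => (g q).adjugate i j) p := by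
    fin_cases i <;> fin_cases j
    · simpa [Matrix.adjugate_fin_three] using minor 1 1 2 2 1 2 2 1
    · simpa [Matrix.adjugate_fin_three, neg_add_eq_sub] using minor 0 2 2 1 0 1 2 2
    · simpa [Matrix.adjugate_fin_three] using minor 0 1 1 2 0 2 1 1
    · simpa [Matrix.adjugate_fin_three, neg_add_eq_sub] using minor 1 2 2 0 1 0 2 2
    · simpa [Matrix.adjugate_fin_three] using minor 0 0 2 2 0 2 2 0
    · simpa [Matrix.adjugate_fin_three, neg_add_eq_sub] using minor 0 2 1 0 0 0 1 2
    · simpa [Matrix.adjugate_fin_three] using minor 1 0 2 1 1 1 2 0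
    · simpa [Matrix.adjugate_fin_three, neg_add_eq_sub] using minor 0 1 2 0 0 0 2 1
    · simpa [Matrix.adjugate_fin_three] using minor 0 0 1 1 0 1 1 0
  have := (hdet.inv h.det_ne).mul hadj
  simpa only [Matrix.inv_def, Ring.inverse_eq_inv', Matrix.smul_apply, smul_eq_mul] using this

theorem smoothAt_mc (h : SmoothInvertibleAt g p) (i j : Fin 3) : (mc g i j).SmoothAt p :=
  (Form.SmoothFamilyAt.sum (s := Finset.univ)
    (α := fun k (_ : ℝ) => Form.fmul (fun q => (g q)⁻¹ i k) (dFun fun q => g q k j)) (t := 0)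
    fun k _ => ((h.inv i k).fmul' (h.smooth k j).dFun).family 0).slice

/-- Cancelling an invertible matrix allows identities for g⁻¹ dg to be checked after multiplication
by g, so the inverse is never differentiated. -/
theorem eq_of_mul_eq {k : ℕ} {A : Matrix (Fin 3) (Fin 3) ℂ} (hA : A.det ≠ 0) {a a' : Fin 3 → Alt k}
    (h : ∀ i, ∑ j, A i j • a j = ∑ j, A i j • a' j) (i : Fin 3) : a i = a' i := by
  have key : ∀ c : Fin 3 → Alt k, ∑ l, A⁻¹ i l • ∑ j, A l j • c j = c i := by
    intro c
    have h1 : A⁻¹ * A = 1 := Matrix.nonsing_inv_mul A (isUnit_iff_ne_zero.2 hA)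
    simp only [Finset.smul_sum, smul_smul]
    rw [Finset.sum_comm]
    have h2 : ∀ j, ∑ l, (A⁻¹ i l * A l j) • c j = (1 : Matrix (Fin 3) (Fin 3) ℂ) i j • c j := by
      intro j
      rw [← Finset.sum_smul, ← h1, Matrix.mul_apply]
    simp only [h2, Matrix.one_apply, ite_smul]
    have z : ∀ x : Alt k, (0 : ℂ) • x = 0 := fun x => zero_smul ℂ x
    have o : ∀ x : Alt k, (1 : ℂ) • x = x := fun x => one_smul ℂ x
    simp only [z, o, Finset.sum_ite_eq, Finset.mem_univ, if_true]
  rw [← key a, ← key a']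
  simp only [h]

theorem sum_mc (h : (g p).det ≠ 0) (i j : Fin 3) :
    ∑ k, g p i k • (mc g k j).val p = (dFun fun q => g q i j).val p := by
  have h1 : g p * (g p)⁻¹ = 1 := Matrix.mul_nonsing_inv _ (isUnit_iff_ne_zero.2 h)
  simp only [mc, Form.val_sum, Form.val_fmul, Finset.smul_sum, smul_smul]
  rw [Finset.sum_comm]
  have h2 : ∀ l, ∑ k, (g p i k * (g p)⁻¹ k l) • (dFun fun q => g q l j).val p =
      (1 : Matrix (Fin 3) (Fin 3) ℂ) i l • (dFun fun q => g q l j).val p := by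
    intro l
    rw [← Finset.sum_smul, ← h1, Matrix.mul_apply]
  simp only [h2, Matrix.one_apply, ite_smul]
  have z : ∀ x : Alt 1, (0 : ℂ) • x = 0 := fun x => zero_smul ℂ x
  have o : ∀ x : Alt 1, (1 : ℂ) • x = x := fun x => one_smul ℂ x
  simp only [z, o, Finset.sum_ite_eq, Finset.mem_univ, if_true]

/-- The Maurer-Cartan equation. -/
theorem dv_mc (h : ∀ᶠ q in 𝓝 p, SmoothInvertibleAt g q) (i j : Fin 3) :
    dv (mc g i j) p = -∑ k, w2 ((mc g i k).val p) ((mc g k j).val p) := by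
  have hp : SmoothInvertibleAt g p := h.self_of_nhds
  have ext := fun i => (eq_of_mul_eq hp.det_ne (a := fun i => dv (mc g i j) p)
    (a' := fun i => -∑ k, w2 ((mc g i k).val p) ((mc g k j).val p)) · i)
  refine ext i fun l => ?_
  -- Differentiate dg = g · (g⁻¹ dg), whose left side is closed.
  have e1 : dv (∑ k, Form.fmul (fun q => g q l k) (mc g k j)) p = 0 := by
    rw [← dv_dFun (hp.smooth l j)]
    refine dv_congr (h.mono fun q hq => ?_)
    rw [← sum_mc hq.det_ne, Form.val_sum]
    rfl
  have sm : ∀ k, (Form.fmul (fun q => g q l k) (mc g k j)).SmoothAt p := fun k =>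
    (hp.smooth l k).fmul' (hp.smoothAt_mc k j)
  rw [Fin.sum_univ_three, dv_add ((sm 0).add (sm 1)) (sm 2), dv_add (sm 0) (sm 1),
    dv_fmul (hp.smooth l 0) (hp.smoothAt_mc 0 j), dv_fmul (hp.smooth l 1) (hp.smoothAt_mc 1 j),
    dv_fmul (hp.smooth l 2) (hp.smoothAt_mc 2 j)] at e1
  simp only [← sum_mc hp.det_ne, Fin.sum_univ_three] at e1 ⊢
  have c := fun a b => congrArg (fun x => c2 x a b) e1
  apply alt2_ext
  · have := c 0 1
    simp only [c2_add, c2_smul, c2_neg, c2_w2, c1_add, c1_smul, c2_zero] at this ⊢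
    linear_combination this
  · have := c 0 2
    simp only [c2_add, c2_smul, c2_neg, c2_w2, c1_add, c1_smul, c2_zero] at this ⊢
    linear_combination this
  · have := c 1 2
    simp only [c2_add, c2_smul, c2_neg, c2_w2, c1_add, c1_smul, c2_zero] at this ⊢
    linear_combination this

theorem mul (h : SmoothInvertibleAt g p) (h' : SmoothInvertibleAt b p) :
    SmoothInvertibleAt (fun q => g q * b q) p := by
  refine ⟨fun i j => ?_, ?_⟩
  · simp only [Matrix.mul_apply, Fin.sum_univ_three]
    exact (((h.smooth i 0).mul (h'.smooth 0 j)).add ((h.smooth i 1).mul (h'.smooth 1 j))).add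
      ((h.smooth i 2).mul (h'.smooth 2 j))
  · rw [Matrix.det_mul]
    exact mul_ne_zero h.det_ne h'.det_ne

/-- The behaviour of Maurer-Cartan forms under a change of gauge. -/
theorem mc_mul (h : SmoothInvertibleAt g p) (h' : SmoothInvertibleAt b p) (i j : Fin 3) :
    ∑ k, b p i k • (mc (fun q => g q * b q) k j).val p =
      ∑ k, b p k j • (mc g i k).val p + (dFun fun q => b q i j).val p := by
  have ext := fun i => (eq_of_mul_eq h.det_ne
    (a := fun i => ∑ k, b p i k • (mc (fun q => g q * b q) k j).val p)
    (a' := fun i => ∑ k, b p k j • (mc g i k).val p + (dFun fun q => b q i j).val p) · i)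
  refine ext i fun l => ?_
  -- After multiplication by g, the claim is the product rule d(gb) = dg · b + g · db.
  have e := sum_mc (g := fun q => g q * b q) (h.mul h').det_ne l j
  have sm : ∀ k, FunSmoothAt (fun q => g q l k * b q k j) p := fun k =>
    (h.smooth l k).mul (h'.smooth k j)
  simp only [Matrix.mul_apply, Fin.sum_univ_three] at e
  rw [dFun_add ((sm 0).add (sm 1)) (sm 2), dFun_add (sm 0) (sm 1),
    dFun_mul (h.smooth l 0) (h'.smooth 0 j), dFun_mul (h.smooth l 1) (h'.smooth 1 j),
    dFun_mul (h.smooth l 2) (h'.smooth 2 j)] at e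
  simp only [← sum_mc h.det_ne, Fin.sum_univ_three] at e ⊢
  have e' : ∀ x, c1 _ x = c1 _ x := fun x => congrArg (fun y => c1 y x) e
  refine alt1_ext fun x => ?_
  have := e' x
  simp only [c1_add, c1_smul] at this ⊢
  linear_combination this

end SmoothInvertibleAt

/-! ### Lifts to `SL(3, ℂ)` -/

theorem funSmoothAt_of_contMDiffAt {f : M → ℂ} {p : M} (hf : ContMDiffAt (𝓡 3) 𝓘(ℝ, ℂ) ∞ f p) :
    FunSmoothAt f p := by
  have h : FunSmoothFamilyAt (fun _ => f) 0 p := fun x hx =>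
    contDiffAt_of_contMDiffAt (f := fun z : ℝ × M => f z.2) (t := 0) (p := p)
      (ContMDiffAt.comp (0, p) (f := Prod.snd) hf contMDiffAt_snd) hx
  exact h.slice

theorem dFun_apply {f : M → ℂ} {p : M} (hf : ContMDiffAt (𝓡 3) 𝓘(ℝ, ℂ) ∞ f p) (v : E3) :
    (dFun f).val p (fun _ => v) = (mfderiv (𝓡 3) 𝓘(ℝ, ℂ) f p : E3 →L[ℝ] ℂ) v := by
  have hs := funSmoothAt_of_contMDiffAt hf p (mem_extChartAt_source p)
  have hd : DifferentiableAt ℝ (fun y => f ((extChartAt (𝓡 3) p).symm y))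
      (extChartAt (𝓡 3) p p) := hs.differentiableAt (by simp)
  have he : f =ᶠ[𝓝 p] (fun y => f ((extChartAt (𝓡 3) p).symm y)) ∘ extChartAt (𝓡 3) p := by
    filter_upwards [(isOpen_extChartAt_source (I := 𝓡 3) p).mem_nhds
      (mem_extChartAt_source p)] with q hq
    simp only [Function.comp_apply, (extChartAt (𝓡 3) p).left_inv hq]
  rw [he.mfderiv_eq, mfderiv_comp p hd.mdifferentiableAt
    (mdifferentiableAt_extChartAt (mem_chart_source E3 p)), mfderiv_eq_fderiv, Form.val_dFun]
  rfl

/-- The map `g⁻¹ dg` on complex tangent vectors in coordinates. -/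
def maurerCartanCE (g : M → SL3) (p : M) : CE →ₗ[ℂ] Matrix (Fin 3) (Fin 3) ℂ := maurerCartan g p

section lift
variable {f : M → FlagSpace} {g : M → SL3} {U : Set M} {p : M}

theorem IsSmoothLiftOn.contMDiffAt (h : IsSmoothLiftOn f g U) (hp : p ∈ U) (i j : Fin 3) :
    ContMDiffAt (𝓡 3) 𝓘(ℝ, ℂ) ∞ (fun q => (g q).1 i j) p :=
  (h.smooth i j).contMDiffAt (h.isOpen.mem_nhds hp)

theorem IsSmoothLiftOn.smoothInvertibleAt (h : IsSmoothLiftOn f g U) (hp : p ∈ U) :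
    SmoothInvertibleAt (fun q => (g q).1) p :=
  ⟨fun i j => funSmoothAt_of_contMDiffAt (h.contMDiffAt hp i j), by
    rw [(g p).2]
    exact one_ne_zero⟩

/-- This translates g⁻¹ dg, given by manifold derivatives on complexified vectors, into the matrix
of 1-forms to which the exterior calculus applies. Determinant one makes the inverse in SL(3, ℂ) the
matrix inverse. -/
theorem IsSmoothLiftOn.maurerCartan_apply (h : IsSmoothLiftOn f g U) (hp : p ∈ U) (z : CE)
    (i j : Fin 3) :
    maurerCartanCE g p z i j =
      cx ((mc (fun q => (g q).1) i j).val p) z := by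
  have hinv : ((g p)⁻¹ : SL3).1 = (g p).1⁻¹ := by
    rw [Matrix.SpecialLinearGroup.coe_inv, Matrix.inv_def, (g p).2]
    simp
  induction z using TensorProduct.induction_on with
  | zero => rw [map_zero, map_zero, Matrix.zero_apply]
  | add x y hx hy => rw [map_add, map_add, Matrix.add_apply, hx, hy]
  | tmul c v =>
    have h1 : maurerCartanCE g p (c ⊗ₜ[ℝ] v) =
        c • (((g p)⁻¹ : SL3).1 * Matrix.of fun i j =>
          (mfderiv (𝓡 3) 𝓘(ℝ, ℂ) (fun q => (g q).1 i j) p : E3 →L[ℝ] ℂ) v) :=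
      LinearMap.liftBaseChange_tmul _ _ _ _
    rw [h1, cx_tmul, Matrix.smul_apply, smul_eq_mul, Matrix.mul_apply, hinv]
    congr 1
    rw [mc, Form.val_sum]
    simp only [Matrix.of_apply, ← dFun_apply (h.contMDiffAt hp _ _), Fin.sum_univ_three]
    rfl

end lift

/-! ### Structures with a flat frame -/

theorem curvAt_congr {A B : Matrix (Fin 3) (Fin 3) (Form M 1)} {p : M}
    (h : ∀ i j, ∀ᶠ q in 𝓝 p, (A i j).val q = (B i j).val q) (i j : Fin 3) :
    curvAt A p i j = curvAt B p i j := by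
  simp only [curvAt, dv_congr (h i j), fun i j => (h i j).self_of_nhds]

/-- The matrix of 1-forms `E` is flat and normalized with respect to the coframe `s`. -/
structure IsFlatFrameAt (s : Coframe M) (E : Fin 3 → Fin 3 → Form M 1) (p : M) : Prop where
  smooth : ∀ i j, (E i j).SmoothAt p
  flat : ∀ i j, dv (E i j) p = -∑ k, w2 ((E i k).val p) ((E k j).val p)
  θ : (E 2 0).val p = (-2 : ℂ) • s.θ.val p
  θ₁ : (E 2 1).val p = -s.θ₁.val p
  θ₂ : (E 1 0).val p = (-2 : ℂ) • s.θ₂.val p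
  φ : (E 2 2).val p - (E 0 0).val p = s.φ.val p

/-- The connection forms determined by a flat frame. -/
def flatForms (E : Fin 3 → Fin 3 → Form M 1) : ConnectionForms M where
  ω₁₁ := (1 / 2 : ℂ) • (E 0 0 + E 2 2) - E 1 1
  φ₁ := (-2 : ℂ) • E 0 1
  φ₂ := E 1 2
  ψ := (4 : ℂ) • E 0 2

section flat
variable {s : Coframe M} {E : Fin 3 → Fin 3 → Form M 1} {p : M}

theorem smoothAt_flatForms (h : ∀ i j, (E i j).SmoothAt p) : (flatForms E).SmoothAt p :=
  ⟨(((h 0 0).add (h 2 2)).smul _).sub (h 1 1), (h 0 1).smul _, h 1 2, (h 0 2).smul _⟩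

theorem dv_flatForms (h : ∀ i j, (E i j).SmoothAt p) :
    dv (flatForms E).ω₁₁ p = (1 / 2 : ℂ) • (dv (E 0 0) p + dv (E 2 2) p) - dv (E 1 1) p ∧
    dv (flatForms E).φ₁ p = (-2 : ℂ) • dv (E 0 1) p ∧ dv (flatForms E).φ₂ p = dv (E 1 2) p ∧
    dv (flatForms E).ψ p = (4 : ℂ) • dv (E 0 2) p := by
  refine ⟨?_, dv_smul _ (h 0 1), rfl, dv_smul _ (h 0 2)⟩
  change dv ((1 / 2 : ℂ) • (E 0 0 + E 2 2) - E 1 1) p = _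
  rw [dv_sub (((h 0 0).add (h 2 2)).smul _) (h 1 1), dv_smul _ ((h 0 0).add (h 2 2)),
    dv_add (h 0 0) (h 2 2)]

theorem val_flatForms : (flatForms E).ω₁₁.val p =
      (1 / 2 : ℂ) • ((E 0 0).val p + (E 2 2).val p) - (E 1 1).val p ∧
    (flatForms E).φ₁.val p = (-2 : ℂ) • (E 0 1).val p ∧ (flatForms E).φ₂.val p = (E 1 2).val p ∧
    (flatForms E).ψ.val p = (4 : ℂ) • (E 0 2).val p := ⟨rfl, rfl, rfl, rfl⟩

theorem dv_coframe_of_flat (h : ∀ᶠ q in 𝓝 p, IsFlatFrameAt s E q) :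
    dv s.θ₁ p = -dv (E 2 1) p ∧ dv s.θ₂ p = (-(1 / 2 : ℂ)) • dv (E 1 0) p ∧
      dv s.φ p = dv (E 2 2) p - dv (E 0 0) p := by
  have hp : IsFlatFrameAt s E p := h.self_of_nhds
  refine ⟨?_, ?_, ?_⟩
  · rw [← dv_neg (hp.smooth 2 1)]
    refine dv_congr (h.mono fun q hq => ?_)
    rw [Form.val_neg, hq.θ₁, neg_neg]
  · rw [← dv_smul _ (hp.smooth 1 0)]
    refine dv_congr (h.mono fun q hq => ?_)
    rw [Form.val_smul, hq.θ₂]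
    module
  · rw [← dv_sub (hp.smooth 2 2) (hp.smooth 0 0)]
    refine dv_congr (h.mono fun q hq => ?_)
    rw [Form.val_sub, hq.φ]

/-- Up to adding a multiple of the identity, the connection matrix formed from `flatForms E` is the
negative of the reflection of E in the antidiagonal: the (i, j) entry is -E₍₂₋ⱼ,₂₋ᵢ₎ plus tr E / 3
on the diagonal. This operation is a Lie algebra homomorphism, so the Maurer–Cartan equation for E
gives the structure equations with vanishing curvature term. -/
theorem adaptedAt_flatForms (h : ∀ᶠ q in 𝓝 p, IsFlatFrameAt s E q) :
    s.AdaptedAt (flatForms E) p := by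
  have hp : IsFlatFrameAt s E p := h.self_of_nhds
  obtain ⟨a1, a2, a3⟩ := dv_coframe_of_flat h
  obtain ⟨b1, b2, b3, b4⟩ := dv_flatForms hp.smooth
  obtain ⟨c1', c2', c3', c4'⟩ := val_flatForms (E := E) (p := p)
  have f := hp.flat
  simp only [Fin.sum_univ_three] at f
  refine ⟨?_, ?_, ?_, ?_, 0, ?_⟩
  all_goals
    simp only [a1, a2, a3, b1, b2, c1', c2', c3', c4', f, hp.θ, hp.θ₁, hp.θ₂, ← hp.φ]
    apply alt2_ext <;>
      (simp only [c2_add, c2_sub, c2_smul, c2_neg, c2_w2, c2_zero, c1_smul, c1_neg, c1_sub,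
        c1_add]; ring)

/-- The reflected matrix is flat because E is. The scalar part tr E / 3 does not interfere, being
central and closed. -/
theorem curvAt_flatForms (hs : s.SmoothAt p) (h : ∀ᶠ q in 𝓝 p, IsFlatFrameAt s E q) (i j : Fin 3) :
    curvAt (connMatrix s (flatForms E)) p i j = 0 := by
  have hp : IsFlatFrameAt s E p := h.self_of_nhds
  have hc := smoothAt_flatForms hp.smooth
  obtain ⟨a1, a2, a3⟩ := dv_coframe_of_flat h
  obtain ⟨b1, b2, b3, b4⟩ := dv_flatForms hp.smooth
  obtain ⟨c1', c2', c3', c4'⟩ := val_flatForms (E := E) (p := p)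
  have f := hp.flat
  have hθ : dv s.θ p = (-(1 / 2 : ℂ)) • dv (E 2 0) p := by
    rw [← dv_smul _ (hp.smooth 2 0)]
    refine dv_congr (h.mono fun q hq => ?_)
    rw [Form.val_smul, hq.θ]
    module
  have t0 : s.θ.val p = (-(1 / 2 : ℂ)) • (E 2 0).val p := by rw [hp.θ]; module
  have t1 : s.θ₁.val p = -(E 2 1).val p := by rw [hp.θ₁, neg_neg]
  have t2 : s.θ₂.val p = (-(1 / 2 : ℂ)) • (E 1 0).val p := by rw [hp.θ₂]; module
  simp only [Fin.sum_univ_three] at f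
  have e10 : dv (connMatrix s (flatForms E) 1 0) p = dv s.θ₁ p := rfl
  fin_cases i <;> fin_cases j
  all_goals
    simp only [curvAt, Fin.sum_univ_three, Fin.zero_eta, Fin.mk_one, Fin.reduceFinMk, e10,
      dv_connMatrix_00 hs hc, dv_connMatrix_11 hs hc, dv_connMatrix_20 hs hc,
      dv_connMatrix_21 hs hc, dv_connMatrix_22 hs hc, dv_connMatrix_01 hs hc,
      dv_connMatrix_02 hs hc, dv_connMatrix_12 hs hc]
    simp only [connMatrix_00, connMatrix_01, connMatrix_02, connMatrix_10, connMatrix_11,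
      connMatrix_12, connMatrix_20, connMatrix_21, connMatrix_22, Form.val_sub, Form.val_smul,
      Form.val_neg, a1, a2, a3, b1, b2, b3, b4, c1', c2', c3', c4', hθ, f, t0, t1, t2, ← hp.φ]
    apply alt2_ext <;>
      (simp only [c2_add, c2_sub, c2_smul, c2_neg, c2_w2, c2_zero, c1_smul, c1_neg, c1_sub,
        c1_add]; ring)

/-- A coframe with a flat frame near `p` has zero curvature at `p`. -/
theorem curvAt_eq_zero_of_flat (hs : s.IsFramed) {U : Set M} (hU : IsOpen U)
    (h : ∀ q ∈ U, IsFlatFrameAt s E q) (hp : p ∈ U) (i j : Fin 3) :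
    curvAt (connMatrix s s.adapted) p i j = 0 := by
  have hev : ∀ q ∈ U, ∀ᶠ q' in 𝓝 q, IsFlatFrameAt s E q' := fun q hq =>
    Filter.mem_of_superset (hU.mem_nhds hq) h
  -- The flat connection exists only over U, so local uniqueness is needed to identify it with the
  -- global one there. Equality on an open set then gives equality of curvatures.
  have key : ∀ q ∈ U, _ := fun q hq => Coframe.adapted_unique hU (s := s) (c := s.adapted)
    (c' := flatForms E) (fun p _ => (hs p).2) (fun p _ => (hs p).1)
    (fun p _ => hs.adapted_smoothAt p) (fun p hp => smoothAt_flatForms (h p hp).smooth)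
    (fun p _ => hs.adaptedAt p) (fun p hp => adaptedAt_flatForms (hev p hp)) hq
  rw [← curvAt_flatForms (hs p).1 (hev p hp) i j]
  refine curvAt_congr (fun i j => ?_) i j
  filter_upwards [hU.mem_nhds hp] with q hq
  obtain ⟨k1, k2, k3, k4⟩ := key q hq
  fin_cases i <;> fin_cases j <;>
    simp [connMatrix_00, connMatrix_01, connMatrix_02, connMatrix_10, connMatrix_11,
      connMatrix_12, connMatrix_20, connMatrix_21, connMatrix_22, k1, k2, k3, k4]

end flat

/-! ### Structures induced by totally real immersions -/

/-- The entries of `g⁻¹ dg` below the diagonal in terms of a coframe. -/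
structure IsAlignedAt (s : Coframe M) (g : M → Matrix (Fin 3) (Fin 3) ℂ) (u x y z w : M → ℂ)
    (p : M) : Prop where
  inv : SmoothInvertibleAt g p
  smooth_u : FunSmoothAt u p
  smooth_x : FunSmoothAt x p
  smooth_y : FunSmoothAt y p
  smooth_w : FunSmoothAt w p
  mc₂₀ : (mc g 2 0).val p = u p • s.θ.val p
  mc₂₁ : (mc g 2 1).val p = x p • s.θ₁.val p + y p • s.θ.val p
  mc₁₀ : (mc g 1 0).val p = z p • s.θ₂.val p + w p • s.θ.val p
  x_ne : x p ≠ 0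
  z_ne : z p ≠ 0

section gauge
variable {s : Coframe M} {g : M → Matrix (Fin 3) (Fin 3) ℂ} {u x y z w : M → ℂ} {p : M}

/-- Compare the θ₁ ∧ θ₂ components of the Maurer–Cartan equation for the lower left entry and of
d(uθ), where uθ is that entry. In particular u cannot vanish. -/
theorem IsAlignedAt.u_eq (hs : s.IsFramed) (h : ∀ᶠ q in 𝓝 p, IsAlignedAt s g u x y z w q) :
    u p = -(x p * z p) := by
  have hp : IsAlignedAt s g u x y z w p := h.self_of_nhds
  have hv := (hs p).2.vol_ne
  have e1 := SmoothInvertibleAt.dv_mc (h.mono fun q hq => hq.inv) 2 0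
  have e2 : dv (mc g 2 0) p = dv (Form.fmul u s.θ) p := dv_congr (h.mono fun q hq => hq.mc₂₀)
  rw [dv_fmul hp.smooth_u (hs p).1.θ, (hs p).2.d_θ, e1, Fin.sum_univ_three, hp.mc₂₀, hp.mc₂₁,
    hp.mc₁₀] at e2
  have e3 := congrArg (fun β => c3 (w3 (s.θ.val p) β)) e2
  refine mul_right_cancel₀ hv ?_
  simp only [tri, c3_w3, c2_w2, c2_add, c2_smul, c2_neg, c1_add, c1_smul] at e3 ⊢
  linear_combination -e3

/-- The gauge transformation that normalizes an aligned frame, up to one entry. -/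
def normalizer (u x y w κ : M → ℂ) (q : M) : Matrix (Fin 3) (Fin 3) ℂ :=
  !![-2 * (u q)⁻¹, y q * (u q)⁻¹ * (x q)⁻¹, κ q; 0, -(x q)⁻¹, w q * (u q)⁻¹; 0, 0, 1]

theorem smoothInvertibleAt_normalizer (h : IsAlignedAt s g u x y z w p) (hu : u p ≠ 0)
    {κ : M → ℂ} (hκ : FunSmoothAt κ p) : SmoothInvertibleAt (normalizer u x y w κ) p := by
  have const : ∀ c : ℂ, FunSmoothAt (fun _ : M => c) p := fun c =>
    (funSmoothFamilyAt_const (t := 0) c).slice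
  refine ⟨fun i j => ?_, ?_⟩
  · fin_cases i <;> fin_cases j
    · exact (const (-2)).mul (h.smooth_u.inv hu)
    · exact (h.smooth_y.mul (h.smooth_u.inv hu)).mul (h.smooth_x.inv h.x_ne)
    · exact hκ
    · exact const 0
    · exact (h.smooth_x.inv h.x_ne).neg
    · exact h.smooth_w.mul (h.smooth_u.inv hu)
    · exact const 0
    · exact const 0
    · exact const 1
  · rw [Matrix.det_fin_three]
    simp [normalizer, hu, h.x_ne]

/-- The part of `φ` that is determined by an aligned frame before the last normalization. -/
def preφ (s : Coframe M) (g : M → Matrix (Fin 3) (Fin 3) ℂ) (u x y w : M → ℂ) : Form M 1 :=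
  Form.fmul (fun q => w q * (u q)⁻¹) (mc g 2 1) + (mc g 2 2 - mc g 0 0) +
    Form.fmul (fun q => u q * 2⁻¹) (dFun fun q => -2 * (u q)⁻¹) +
    Form.fmul (fun q => y q * (x q)⁻¹) s.θ₂

/-- The last entry of the normalizing gauge transformation. -/
def lastEntry (s : Coframe M) (g : M → Matrix (Fin 3) (Fin 3) ℂ) (u x y w : M → ℂ) (q : M) : ℂ :=
  s.coef (s.φ - preφ s g u x y w) q * (2⁻¹ * (u q)⁻¹)

theorem funSmoothAt_lastEntry (hs : s.IsFramed) (h : IsAlignedAt s g u x y z w p) (hu : u p ≠ 0) :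
    FunSmoothAt (lastEntry s g u x y w) p := by
  have const : ∀ c : ℂ, FunSmoothAt (fun _ : M => c) p := fun c =>
    (funSmoothFamilyAt_const (t := 0) c).slice
  have hui := h.smooth_u.inv hu
  have hpre : (preφ s g u x y w).SmoothAt p :=
    ((((h.smooth_w.mul hui).fmul' (h.inv.smoothAt_mc 2 1)).add
      ((h.inv.smoothAt_mc 2 2).sub (h.inv.smoothAt_mc 0 0))).add
      ((h.smooth_u.mul (const _)).fmul' ((const (-2)).mul hui).dFun)).add
      ((h.smooth_y.mul (h.smooth_x.inv h.x_ne)).fmul' (hs p).1.θ₂)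
  have hc := (((hs p).1.family 0).coef (hs p).2.vol_ne (((hs p).1.φ.sub hpre).family 0)).slice
  exact hc.mul ((const _).mul hui)

/-- An aligned frame can be normalized. -/
theorem isFlatFrameAt_of_aligned (hs : s.IsFramed) {U : Set M} (hU : IsOpen U)
    (h : ∀ q ∈ U, IsAlignedAt s g u x y z w q) (hp : p ∈ U) :
    IsFlatFrameAt s
      (mc fun q => g q * normalizer u x y w (lastEntry s g u x y w) q) p := by
  have huq : ∀ q ∈ U, u q = -(x q * z q) := fun q hq =>
    IsAlignedAt.u_eq hs (Filter.mem_of_superset (hU.mem_nhds hq) h)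
  have hu0 : ∀ q ∈ U, u q ≠ 0 := fun q hq => by
    rw [huq q hq]
    exact neg_ne_zero.2 (mul_ne_zero (h q hq).x_ne (h q hq).z_ne)
  set κ := lastEntry s g u x y w with hκ
  -- The gauge change b stays upper triangular, but its determinant is not required to be 1. Its
  -- first column rescales θ, its second rescales θ₁ and removes the θ term beside it, and the entry
  -- w/u removes the θ term beside θ₂. The entry κ adjusts the θ coefficient of the difference of
  -- the diagonal entries.
  set b := normalizer u x y w κ with hb
  have hbs : ∀ q ∈ U, SmoothInvertibleAt b q := fun q hq =>
    smoothInvertibleAt_normalizer (h q hq) (hu0 q hq) (funSmoothAt_lastEntry hs (h q hq) (hu0 q hq))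
  have hgb : ∀ q ∈ U, SmoothInvertibleAt (fun q => g q * b q) q := fun q hq =>
    (h q hq).inv.mul (hbs q hq)
  have const : ∀ (c : ℂ) (q : M), (dFun fun _ : M => c).val q = 0 := fun c q => by
    rw [Form.val_dFun]
    refine alt1_ext fun i => ?_
    simp [c1]
  have ev0 : ∀ q, b q 0 0 = -2 * (u q)⁻¹ := fun q => rfl
  have row2 := fun q hq j => (h q hq).inv.mc_mul (hbs q hq) 2 j
  have row1 := (h p hp).inv.mc_mul (hbs p hp) 1 0
  have row0 := (h p hp).inv.mc_mul (hbs p hp) 0 0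
  have b01 : b p 0 1 = y p * (u p)⁻¹ * (x p)⁻¹ := rfl
  have b02 : b p 0 2 = κ p := rfl
  have b10 : ∀ q, b q 1 0 = 0 := fun q => rfl
  have b11 : b p 1 1 = -(x p)⁻¹ := rfl
  have b12 : b p 1 2 = w p * (u p)⁻¹ := rfl
  have b20 : ∀ q, b q 2 0 = 0 := fun q => rfl
  have b21 : ∀ q, b q 2 1 = 0 := fun q => rfl
  have b22 : ∀ q, b q 2 2 = 1 := fun q => rfl
  have dd : ∀ q j, (dFun fun q => b q 2 j).val q = 0 := by
    intro q j
    fin_cases j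
    exacts [const 0 q, const 0 q, const 1 q]
  have al := h p hp
  have hx := al.x_ne
  have hu := hu0 p hp
  have huxz := huq p hp
  have hui := mul_inv_cancel₀ hu
  have hxi := mul_inv_cancel₀ hx
  set E := mc fun q => g q * b q with hE
  simp only [Fin.sum_univ_three, b20, b21, b22, dd] at row2
  simp only [Fin.sum_univ_three, b10, b11, b12, ev0, b20, const] at row1
  simp only [Fin.sum_univ_three, b01, b02, b10, b20, ev0] at row0
  have e20 : ∀ q ∈ U, (E 2 0).val q = (-2 : ℂ) • s.θ.val q := by
    intro q hq
    have := row2 q hq 0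
    have hu := hu0 q hq
    rw [(h q hq).mc₂₀, (h q hq).mc₂₁, ev0, b10, b20] at this
    refine alt1_ext fun i => ?_
    have := congrArg (fun a => c1 a i) this
    simp only [c1_add, c1_smul, c1_zero] at this ⊢
    field_simp at this
    linear_combination this
  have e21 : (E 2 1).val p = -s.θ₁.val p := by
    have := row2 p hp 1
    rw [al.mc₂₀, al.mc₂₁, b01, b11, b21] at this
    refine alt1_ext fun i => ?_
    have := congrArg (fun a => c1 a i) this
    simp only [c1_add, c1_smul, c1_zero, c1_neg] at this ⊢
    linear_combination this + y p * (x p)⁻¹ * c1 (s.θ.val p) i * hui - c1 (s.θ₁.val p) i * hxi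
  have e10 : (E 1 0).val p = (-2 : ℂ) • s.θ₂.val p := by
    rw [al.mc₁₀, e20 p hp] at row1
    refine alt1_ext fun i => ?_
    have := congrArg (fun a => c1 a i) row1
    simp only [c1_add, c1_smul, c1_zero, c1_neg] at this ⊢
    linear_combination -x p * this - c1 ((E 1 0).val p) i * hxi +
      2 * (u p)⁻¹ * c1 (s.θ₂.val p) i * huxz - 2 * c1 (s.θ₂.val p) i * hui
  have eφ : (E 2 2).val p - (E 0 0).val p = (2 * u p * κ p) • s.θ.val p +
      (preφ s g u x y w).val p := by
    have h2 := row2 p hp 2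
    rw [al.mc₂₀, b02, b12, b22] at h2
    rw [e10, e20 p hp] at row0
    simp only [preφ, Form.val_add, Form.val_fmul, Form.val_sub]
    generalize (dFun fun q => -2 * (u q)⁻¹).val p = D at row0 ⊢
    refine alt1_ext fun i => ?_
    have k0 := congrArg (fun a => c1 a i) row0
    have k2 := congrArg (fun a => c1 a i) h2
    simp only [c1_add, c1_smul, c1_zero, c1_neg, c1_sub] at k0 k2 ⊢
    linear_combination k2 + (u p / 2) * k0 +
      (c1 ((E 0 0).val p) i + y p * (x p)⁻¹ * c1 (s.θ₂.val p) i - c1 ((mc g 0 0).val p) i) * hui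
  have flat : ∀ i j, dv (E i j) p = -∑ k, w2 ((E i k).val p) ((E k j).val p) :=
    SmoothInvertibleAt.dv_mc (Filter.mem_of_superset (hU.mem_nhds hp) hgb)
  refine ⟨fun i j => (hgb p hp).smoothAt_mc i j, flat, e20 p hp, e21, e10, ?_⟩
  have hv := (hs p).2.vol_ne
  have hX := Coframe.decomp hv (s.φ - preφ s g u x y w)
  have hκ' : 2 * u p * κ p = s.coef (s.φ - preφ s g u x y w) p := by
    rw [hκ, lastEntry]
    field_simp
  rw [hκ'] at eφ
  rw [Form.val_sub] at hX
  generalize s.coef (s.φ - preφ s g u x y w) p = A at hX eφ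
  generalize s.coef₁ (s.φ - preφ s g u x y w) p = B at hX
  generalize s.coef₂ (s.φ - preφ s g u x y w) p = C at hX
  have hdiff : (E 2 2).val p - (E 0 0).val p =
      s.φ.val p - B • s.θ₁.val p - C • s.θ₂.val p := by
    rw [eφ, sub_eq_iff_eq_add.1 hX]
    abel
  -- The choice of κ matches the θ components. The θ₁ and θ₂ components cannot differ, because the
  -- Maurer–Cartan equation for E₂₀ = -2θ and the structure equation compute the same dθ.
  have hθ : dv (E 2 0) p = dv ((-2 : ℂ) • s.θ) p :=
    dv_congr (Filter.mem_of_superset (hU.mem_nhds hp) e20)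
  rw [dv_smul _ (hs p).1.θ, (hs p).2.d_θ, flat, Fin.sum_univ_three, e20 p hp, e21, e10,
    sub_eq_iff_eq_add.1 hdiff] at hθ
  have k1 := congrArg (fun β => c3 (w3 (s.θ₂.val p) β)) hθ
  have k2 := congrArg (fun β => c3 (w3 (s.θ₁.val p) β)) hθ
  have hB : B = 0 := by
    refine (mul_eq_zero.1 ?_).resolve_right hv
    simp only [tri, c3_w3, c2_w2, c2_add, c2_smul, c2_neg, c1_add, c1_smul, c1_neg, c1_sub] at k1 ⊢
    linear_combination (1 / 2) * k1
  have hC : C = 0 := by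
    refine (mul_eq_zero.1 ?_).resolve_right hv
    simp only [tri, c3_w3, c2_w2, c2_add, c2_smul, c2_neg, c1_add, c1_smul, c1_neg, c1_sub] at k2 ⊢
    linear_combination (-1 / 2) * k2
  rw [hdiff, hB, hC]
  module

end gauge

section induced
variable {G : FlagStructure M} {f : M → FlagSpace} {g : M → SL3} {U : Set M} {s : Coframe M} {p : M}

theorem IsInducedBy.mem_T₁ (hf : IsInducedBy G f) (hg : IsSmoothLiftOn f g U) (hp : p ∈ U)
    {v : CE} (hv : v ∈ (G.T₁ p : Submodule ℂ CE)) :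
    cx ((mc (fun q => (g q).1) 1 0).val p) v = 0 ∧
      cx ((mc (fun q => (g q).1) 2 0).val p) v = 0 := by
  have h : v ∈ (parabolic₁.comap (maurerCartanCE g p) : Submodule ℂ CE) :=
    (hf.T₁_eq p U g hp hg).le hv
  rw [← hg.maurerCartan_apply hp, ← hg.maurerCartan_apply hp]
  exact h

theorem IsInducedBy.mem_T₂ (hf : IsInducedBy G f) (hg : IsSmoothLiftOn f g U) (hp : p ∈ U)
    {v : CE} (hv : v ∈ (G.T₂ p : Submodule ℂ CE)) :
    cx ((mc (fun q => (g q).1) 2 0).val p) v = 0 ∧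
      cx ((mc (fun q => (g q).1) 2 1).val p) v = 0 := by
  have h : v ∈ (parabolic₂.comap (maurerCartanCE g p) : Submodule ℂ CE) :=
    (hf.T₂_eq p U g hp hg).le hv
  rw [← hg.maurerCartan_apply hp, ← hg.maurerCartan_apply hp]
  exact h

theorem IsInducedBy.eq_zero (hf : IsInducedBy G f) (hg : IsSmoothLiftOn f g U) (hp : p ∈ U)
    {v : CE} (h₁₀ : cx ((mc (fun q => (g q).1) 1 0).val p) v = 0)
    (h₂₀ : cx ((mc (fun q => (g q).1) 2 0).val p) v = 0)
    (h₂₁ : cx ((mc (fun q => (g q).1) 2 1).val p) v = 0) : v = 0 := by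
  rw [← hg.maurerCartan_apply hp] at h₁₀ h₂₀ h₂₁
  have hinj : Function.Injective (upperTriangular.mkQ ∘ₗ maurerCartanCE g p) :=
    (hf.immersion.bijective p U g hp hg).1
  refine hinj ?_
  rw [map_zero, LinearMap.comp_apply, Submodule.mkQ_apply, Submodule.Quotient.mk_eq_zero]
  exact ⟨h₁₀, h₂₀, h₂₁⟩

/-- On T₁ the entries (1, 0) and (2, 0) of g⁻¹ dg vanish, and on T₂ the entries (2, 0) and (2, 1)
do. Each entry below the diagonal therefore loses the corresponding coefficients. -/
theorem IsInducedBy.isAlignedAt (hf : IsInducedBy G f) (h : IsSection G s)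
    (hg : IsSmoothLiftOn f g U) (hp : p ∈ U) :
    IsAlignedAt s (fun q => (g q).1) (s.coef (mc (fun q => (g q).1) 2 0))
      (s.coef₁ (mc (fun q => (g q).1) 2 1)) (s.coef (mc (fun q => (g q).1) 2 1))
      (s.coef₂ (mc (fun q => (g q).1) 1 0)) (s.coef (mc (fun q => (g q).1) 1 0)) p := by
  obtain ⟨hs, hfr⟩ := h.isFramed p
  have hv := hfr.vol_ne
  have inv := hg.smoothInvertibleAt hp
  obtain ⟨v, hvT, hv1⟩ : ∃ v : CE, v ∈ (G.T₁ p : Submodule ℂ CE) ∧ cx (s.θ₁.val p) v ≠ 0 :=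
    SetLike.not_le_iff_exists.1 (h.θ₁_T₁ p)
  obtain ⟨w, hwT, hw2⟩ : ∃ w : CE, w ∈ (G.T₂ p : Submodule ℂ CE) ∧ cx (s.θ₂.val p) w ≠ 0 :=
    SetLike.not_le_iff_exists.1 (h.θ₂_T₂ p)
  have hker := h.ker_θ p
  have hv0 : cx (s.θ.val p) v = 0 := hker.ge (Submodule.mem_sup_left hvT)
  have hw0 : cx (s.θ.val p) w = 0 := hker.ge (Submodule.mem_sup_right hwT)
  have hv2 : cx (s.θ₂.val p) v = 0 := h.θ₂_T₁ p hvT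
  have hw1 : cx (s.θ₁.val p) w = 0 := h.θ₁_T₂ p hwT
  obtain ⟨v10, v20⟩ := hf.mem_T₁ hg hp hvT
  obtain ⟨w20, w21⟩ := hf.mem_T₂ hg hp hwT
  have onv : ∀ α : Form M 1, cx (α.val p) v = s.coef₁ α p * cx (s.θ₁.val p) v := fun α => by
    conv_lhs => rw [Coframe.decomp hv α]
    rw [cx_add, cx_add, cx_smul, cx_smul, cx_smul, hv0, hv2]
    ring
  have onw : ∀ α : Form M 1, cx (α.val p) w = s.coef₂ α p * cx (s.θ₂.val p) w := fun α => by
    conv_lhs => rw [Coframe.decomp hv α]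
    rw [cx_add, cx_add, cx_smul, cx_smul, cx_smul, hw0, hw1]
    ring
  have z1 : ∀ α : Form M 1, cx (α.val p) v = 0 → s.coef₁ α p = 0 := fun α hα =>
    (mul_eq_zero.1 ((onv α).symm.trans hα)).resolve_right hv1
  have z2 : ∀ α : Form M 1, cx (α.val p) w = 0 → s.coef₂ α p = 0 := fun α hα =>
    (mul_eq_zero.1 ((onw α).symm.trans hα)).resolve_right hw2
  have coef : ∀ {α : Form M 1}, α.SmoothAt p → FunSmoothAt (s.coef α) p := fun hα =>
    ((hs.family 0).coef hv (hα.family 0)).slice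
  refine ⟨inv, coef (inv.smoothAt_mc 2 0),
    ((hs.family 0).coef₁ hv ((inv.smoothAt_mc 2 1).family 0)).slice, coef (inv.smoothAt_mc 2 1),
    coef (inv.smoothAt_mc 1 0), ?_, ?_, ?_, ?_, ?_⟩
  · conv_lhs => rw [Coframe.decomp hv (mc _ 2 0), z1 _ v20, z2 _ w20]
    module
  · conv_lhs => rw [Coframe.decomp hv (mc _ 2 1), z2 _ w21]
    module
  · conv_lhs => rw [Coframe.decomp hv (mc _ 1 0), z1 _ v10]
    module
  -- If this coefficient vanished, a nonzero vector of T₁ would be mapped to an upper triangular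
  -- matrix, against injectivity of the complexified differential. The next case is the same for T₂.
  · intro h0
    have : v = 0 := hf.eq_zero hg hp v10 v20 (by rw [onv, h0, zero_mul])
    exact hv1 (by rw [this, map_zero])
  · intro h0
    have : w = 0 := hf.eq_zero hg hp (by rw [onw, h0, zero_mul]) w20 w21
    exact hw2 (by rw [this, map_zero])

/-- Structures induced by totally real immersions into the flag space have zero curvature. -/
theorem IsInducedBy.curvature_eq_zero (hf : IsInducedBy G f) (h : IsSection G s) :
    s.curvature = 0 := by
  have hs := h.isFramed
  refine Matrix.ext fun i j => Form.ext_val fun p => ?_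
  obtain ⟨U, g, hp, hg⟩ := hf.immersion.smooth p
  rw [val_curvature, hs.connection]
  exact curvAt_eq_zero_of_flat hs hg.isOpen (fun q hq => isFlatFrameAt_of_aligned hs hg.isOpen
    (fun q hq => hf.isAlignedAt h hg hq) hq) hp i j

end induced

/-! ### The variation of the invariant -/

section variation
variable [CompactSpace M] [T2Space M] {F : ℝ → FlagStructure M} {S : ℝ → Coframe M} {δ : ℝ}

theorem IsSmoothSectionFamily.eventually_isFramed (h : IsSmoothSectionFamily F S δ) {t : ℝ}
    (ht : t ∈ Ioo (-δ) δ) : ∀ᶠ t' in 𝓝 t, (S t').IsFramed :=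
  Filter.mem_of_superset (isOpen_Ioo.mem_nhds ht) fun t' ht' => (h.isSection t' ht').isFramed

theorem IsSmoothSectionFamily.smooth_connection (h : IsSmoothSectionFamily F S δ) (i j : Fin 3) :
    Form.SmoothFamilyOn (fun t => (S t).connection i j) (Ioo (-δ) δ ×ˢ univ) :=
  (Form.smoothFamilyOn_iff (isOpen_Ioo.prod isOpen_univ)).2 fun z hz =>
    smoothFamilyAt_connection (h.eventually_isFramed hz.1) (h.smoothFamilyAt hz.1 z.2) i j

theorem IsSmoothSectionFamily.hasDerivAt_mu (hM : IsOrientedAtlas M)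
    (h : IsSmoothSectionFamily F S δ) (hδ : 0 < δ) :
    HasDerivAt (fun t => (F t).mu)
      (-(1 / (4 * (Real.pi : ℂ) ^ 2)) *
        (trWedge (Matrix.of fun i j => Form.dot fun t => (S t).connection i j)
          (S 0).curvature).integral) 0 := by
  have h0 : (0 : ℝ) ∈ Ioo (-δ) δ := ⟨by linarith, hδ⟩
  have key := Coframe.hasDerivAt_muIntegral hM (fun p => h.smoothFamilyAt h0 p)
    (h.eventually_isFramed h0)
  refine HasDerivAt.congr_of_eventuallyEq key ?_
  filter_upwards [isOpen_Ioo.mem_nhds h0] with t ht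
  exact ((h.isSection t ht).muIntegral_eq_mu hM).symm

/-- The family of sections is chosen through the given section at t = 0, so the curvature in the
variation formula is the one known to vanish. -/
theorem IsSection.hasDerivAt_mu_of_curvature_eq_zero (hM : IsOrientedAtlas M)
    (hF : IsSmoothDeformation F) {s : Coframe M} (h : IsSection (F 0) s) (hs : s.curvature = 0) :
    HasDerivAt (fun t => (F t).mu) 0 0 := by
  obtain ⟨S, rfl, δ, hδ, hS⟩ := hF.exists_sections h
  have := hS.hasDerivAt_mu hM hδ
  rw [hs] at this
  have z : ∀ A : Matrix (Fin 3) (Fin 3) (Form M 1),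
      trWedge A (0 : Matrix (Fin 3) (Fin 3) (Form M 2)) = 0 := fun A => by
    refine Form.ext_val fun p => ?_
    have e : ∀ i j, (A i j ⋏ (0 : Matrix (Fin 3) (Fin 3) (Form M 2)) j i).val p = 0 := fun i j =>
      w3_zero ((A i j).val p)
    simp only [trWedge, Fin.sum_univ_three, Form.val_add, e, add_zero]
    rfl
  rwa [z, Form.integral_zero, mul_zero] at this

end variation

end FlagGeometry

end

theorem proposition6p3 {M : Type*} [TopologicalSpace M] [ChartedSpace E3 M]
    [IsManifold (𝓡 3) ∞ M] [CompactSpace M] [T2Space M] (hM : IsOrientedAtlas M)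
    (F : ℝ → FlagStructure M) (hF : IsSmoothDeformation F)
    (hY : ∃ s, IsSection (F 0) s) :
    -- the adapted connection exists and is unique, and the invariant does not depend on the section
    (∀ (G : FlagStructure M) (s : Coframe M), IsSection G s →
      (∃! c, IsAdapted s c) ∧ s.muIntegral = G.mu) ∧
    -- there are smooth families of sections along the deformation
    (∃ s : ℝ → Coframe M, ∃ δ > 0, IsSmoothSectionFamily F s δ) ∧
    -- the first variation formula
    (∀ (s : ℝ → Coframe M) (δ : ℝ), 0 < δ → IsSmoothSectionFamily F s δ →
      (∀ i j, Form.SmoothFamilyOn (fun t => (s t).connection i j) (Ioo (-δ) δ ×ˢ univ)) ∧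
      HasDerivAt (fun t => (F t).mu)
        (-(1 / (4 * (Real.pi : ℂ) ^ 2)) *
          (trWedge (Matrix.of fun i j => Form.dot fun t => (s t).connection i j)
            (s 0).curvature).integral) 0) ∧
    -- structures with zero curvature are critical points
    (∀ s, IsSection (F 0) s → s.curvature = 0 → HasDerivAt (fun t => (F t).mu) 0 0) ∧
    -- structures induced by totally real immersions have zero curvature and are critical points
    (∀ f : M → FlagSpace, IsInducedBy (F 0) f →
      (∀ s, IsSection (F 0) s → s.curvature = 0) ∧ HasDerivAt (fun t => (F t).mu) 0 0) := by
  refine ⟨fun G s h => ⟨h.isFramed.existsUnique, h.muIntegral_eq_mu hM⟩, ?_, ?_, ?_, ?_⟩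
  · obtain ⟨s, h⟩ := hY
    obtain ⟨S, -, δ, hδ, hS⟩ := hF.exists_sections h
    exact ⟨S, δ, hδ, hS⟩
  · exact fun S δ hδ hS => ⟨hS.smooth_connection, hS.hasDerivAt_mu hM hδ⟩
  · exact fun s h hs => h.hasDerivAt_mu_of_curvature_eq_zero hM hF hs
  · intro f hf
    obtain ⟨s, h⟩ := hY
    exact ⟨fun s h => hf.curvature_eq_zero h,
      h.hasDerivAt_mu_of_curvature_eq_zero hM hF (hf.curvature_eq_zero h)⟩
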